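/- Let $K$ be an infinite field, $\Gamma$ a finite quiver, $I$ an admissible ideal of the path algebra $K\Gamma$ and $\Lambda=K\Gamma/I$, with Jacobson radical $J$. Paths are composed so that $qp$ means "$q$ after $p$"; a right subpath of $p$ is a path $u$ with $p=u'u$ for some path $u'$. A module is uniserial if it is nonzero, of finite length, and its submodules form a chain. $\Lambda$ has *finite uniserial type* if there are only finitely many isomorphism classes of uniserial left $\Lambda$-modules. A path $p$ of length $l$ is a *mast* of a uniserial left $\Lambda$-module $U$ if $U$ has composition length $l+1$ and $pU\ne 0$. A *top element* of $U$ is an element $x\in U\setminus JU$ with $x=ex$ for some vertex $e$. *Condition (N)*: whenever $\alpha:e\to e'$ is an arrow and a path $p:e\to e'$ of positive length is a mast of a uniserial left $\Lambda$-module, then $p=c'\alpha$ for a (possibly trivial) oriented cycle $c'$ at $e'$, or $p=\alpha c$ for a (possibly trivial) oriented cycle $c$ at $e$. A *detour* on a path $p$ is a pair $(\alpha,u)$, where $u$ is a right subpath of $p$ and $\alpha$ is an arrow starting where $u$ ends such that $\alpha u$ is not a right subpath of $p$, while the family $(v_i(\alpha,u))_{i\in I(\alpha,u)}$ of all right subpaths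 of $p$ which are longer than $u$ and end in the same vertex as $\alpha$ is non-empty. The variety $V_p$ is the set of all points $(k_i(\alpha,u))$ in the affine space with coordinates $X_i(\alpha,u)$ ($(\alpha,u)$ a detour on $p$, $i\in I(\alpha,u)$) for which there are a uniserial left $\Lambda$-module with mast $p$ and a top element $x$ of it with $\alpha ux=\sum_i k_i(\alpha,u)\,v_i(\alpha,u)x$ for all detours $(\alpha,u)$ on $p$; its coordinate ring $A_p$ is the polynomial ring over $K$ in the $X_i(\alpha,u)$ modulo the ideal of polynomials vanishing on $V_p$. A detour $(\alpha,u)$ on a mast $p$ is a *halyard* if some $X_i(\alpha,u)$ has nonzero image in $A_p$, and a *slack halyard* if the image of some $X_i(\alpha,u)$ in $A_p$ is transcendental over $K$. It *does not emerge from the top vertex* if $u$ has positive length. A *graph* of the halyard $(\alpha,u)$ on $p$ consists of the edge path $p$ and an additional edge labeled $\alpha$ from the end of $u$ to the end of $v_i(\alpha,u)$, where $i\in I(\alpha,u)$ is such that $\Lambda\alpha ux=\Lambda v_i(\alpha,u)x$ for some top element $x$ of some uniserial left $\Lambda$-module with mast $p$. Suppose that $J^5=0$. Then the following are equivalent: (1)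 $\Lambda$ has finite uniserial type. (2) $\Lambda$ satisfies condition (N), and all graphs of slack halyards on masts of uniserial left $\Lambda$-modules which do not emerge from the top vertex of the mast are among the subgraphs of the following three graphs, where $1,2,3$ are distinct vertices and the sequence displayed is the mast, read from the top vertex down: (i) $1\to 1\to 1\xrightarrow{\alpha}2\to 3$, with an additional edge $\alpha$ from the second to the fourth entry; (ii) $1\to 1\to 1\to 1\xrightarrow{\alpha}2$, with additional edges $\alpha$ from the second to the fifth and from the third to the fifth entry; (iii) $1\xrightarrow{\alpha}2\xrightarrow{\beta}1\xrightarrow{\alpha}2\xrightarrow{\gamma}3$, with an additional edge $\gamma$ from the second to the fifth entry. (The subgraphs in question are those which consist of a mast and one additional edge not emerging from its top vertex: (i), (i) without the bottom edge $2\to3$, (ii) with just one of its two additional edges, and (iii).) Moreover, if $\Lambda$ has finite uniserial type (and $J^5=0$), then for every mast $p$ the variety $V_p$ is a non-empty affine-linear subspace of its coordinate space, and the relation "$p$ is a mast of $U$" induces a bijection between the masts $p$ of uniserial left $\Lambda$-modules and the isomorphism classes of uniserial left $\Lambda$-modules $U$. -/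

import Mathlib

universe u v w

noncomputable section

namespace BoundQuiver

open Quiver

/-- A path of the quiver `V`, bundled with its initial vertex `src` and terminal vertex `tgt`. -/
@[ext]
structure AnyPath (V : Type v) [Quiver.{w} V] where
  src : V
  tgt : V
  path : Path src tgt

/-- The underlying vector space of the path algebra: formal `K`-linear combinations of paths. -/
def PathAlgebra (K : Type u) (V : Type v) [Field K] [Quiver.{w} V] : Type (max u v w) :=
  AnyPath.{v, w} V →₀ K

namespace PathAlgebra

variable {K : Type u} {V : Type v} [Field K] [Quiver.{w} V]

instance : AddCommGroup (PathAlgebra K V) := inferInstanceAs (AddCommGroup (AnyPath V →₀ K))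

instance : Module K (PathAlgebra K V) := inferInstanceAs (Module K (AnyPath V →₀ K))

/-- The basis element of the path algebra given by a path. -/
def of (x : AnyPath V) : PathAlgebra K V := Finsupp.single x 1

/-- The coefficient of a path in an element of the path algebra. -/
def coeff (f : PathAlgebra K V) (x : AnyPath V) : K := (show AnyPath V →₀ K from f) x

open Classical in
/-- The product `x y` (first `y`, then `x`) of two paths; it is `0` unless `y` ends where `x`
starts. -/
def mulPath (x y : AnyPath V) : PathAlgebra K V :=
  if h : y.tgt = x.src then of ⟨y.src, x.tgt, y.path.comp (x.path.cast h.symm rfl)⟩ else 0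

theorem mulPath_comp {a b c : V} (p : Path a b) (q : Path b c) :
    mulPath (K := K) ⟨b, c, q⟩ ⟨a, b, p⟩ = of ⟨a, c, p.comp q⟩ := by
  simp [mulPath]

theorem mulPath_of_ne {x y : AnyPath V} (h : y.tgt ≠ x.src) : mulPath (K := K) x y = 0 := by
  simp [mulPath, h]

/-- Multiplication of the path algebra, the bilinear extension of `mulPath`. -/
def mulHom : PathAlgebra K V →ₗ[K] PathAlgebra K V →ₗ[K] PathAlgebra K V :=
  Finsupp.lift (PathAlgebra K V →ₗ[K] PathAlgebra K V) K (AnyPath V) fun x =>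
    Finsupp.lift (PathAlgebra K V) K (AnyPath V) fun y => mulPath x y

instance : Mul (PathAlgebra K V) := ⟨fun f g => mulHom f g⟩

theorem mul_def (f g : PathAlgebra K V) : f * g = mulHom f g := rfl

theorem lift_of {M : Type*} [AddCommMonoid M] [Module K M] (F : AnyPath V → M) (x : AnyPath V) :
    Finsupp.lift M K (AnyPath V) F (of (K := K) x) = F x :=
  (Finsupp.sum_single_index (h := fun x r => r • F x) (zero_smul K _)).trans (one_smul K _)

theorem of_mul_of (x y : AnyPath V) : (of x * of y : PathAlgebra K V) = mulPath x y := by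
  exact (congrArg (fun F : PathAlgebra K V →ₗ[K] PathAlgebra K V => F (of y))
    (lift_of _ x)).trans (lift_of _ y)

theorem hom_ext {M : Type*} [AddCommMonoid M] [Module K M] {f g : PathAlgebra K V →ₗ[K] M}
    (h : ∀ x, f (of x) = g (of x)) : f = g :=
  Finsupp.lhom_ext' fun x => LinearMap.ext_ring (h x)

theorem mulPath_assoc (x y z : AnyPath V) :
    (mulPath x y * of z : PathAlgebra K V) = of x * mulPath y z := by
  obtain ⟨a, b, p⟩ := x
  obtain ⟨c, d, q⟩ := y
  obtain ⟨e, f, r⟩ := z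
  by_cases h₁ : d = a
  · subst h₁
    by_cases h₂ : f = c
    · subst h₂
      simp only [mulPath_comp, of_mul_of, Path.comp_assoc]
    · rw [mulPath_comp, of_mul_of, mulPath_of_ne (x := ⟨c, b, q.comp p⟩) (by simpa using h₂),
        mulPath_of_ne (by simpa using h₂)]
      simp [mul_def]
  · rw [mulPath_of_ne (by simpa using h₁)]
    by_cases h₂ : f = c
    · subst h₂
      rw [mulPath_comp, of_mul_of, mulPath_of_ne (by simpa using h₁)]
      simp [mul_def]
    · rw [mulPath_of_ne (by simpa using h₂)]
      simp [mul_def]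

theorem assoc_aux (f g h : PathAlgebra K V) : f * g * h = f * (g * h) := by
  have h₁ : ∀ x y, mulHom (mulHom (of x) (of y)) =
      mulHom (of (K := K) (V := V) x) ∘ₗ mulHom (of y) := by
    refine fun x y => hom_ext fun z => ?_
    have := mulPath_assoc (K := K) x y z
    rwa [← of_mul_of, ← of_mul_of] at this
  have h₂ : ∀ x, mulHom ∘ₗ mulHom (of x) =
      LinearMap.llcomp K _ _ _ (mulHom (of (K := K) (V := V) x)) ∘ₗ mulHom :=
    fun x => hom_ext fun y => h₁ x y
  have h₃ : mulHom.flip h ∘ₗ mulHom.flip g = mulHom.flip (mulHom (K := K) g h) :=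
    hom_ext fun x => congrArg (fun F => F g h) (h₂ x)
  exact congrArg (fun F => F f) h₃

variable [Fintype V]

instance : One (PathAlgebra K V) := ⟨∑ e : V, of ⟨e, e, Path.nil⟩⟩

theorem one_def : (1 : PathAlgebra K V) = ∑ e : V, of ⟨e, e, Path.nil⟩ := rfl

theorem one_mul_aux (f : PathAlgebra K V) : mulHom 1 f = f := by
  have : mulHom (1 : PathAlgebra K V) = LinearMap.id := by
    refine hom_ext fun x => ?_
    obtain ⟨a, b, p⟩ := x
    rw [one_def, map_sum, LinearMap.sum_apply, Finset.sum_eq_single b]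
    · rw [← mul_def, of_mul_of, mulPath_comp]
      simp
    · intro c _ hc
      rw [← mul_def, of_mul_of, mulPath_of_ne (by simpa using hc.symm)]
    · simp
  rw [this, LinearMap.id_apply]

theorem mul_one_aux (f : PathAlgebra K V) : mulHom f 1 = f := by
  have : (mulHom.flip (1 : PathAlgebra K V)) = LinearMap.id := by
    refine hom_ext fun x => ?_
    obtain ⟨a, b, p⟩ := x
    rw [LinearMap.flip_apply, one_def, map_sum, Finset.sum_eq_single a]
    · rw [← mul_def, of_mul_of, mulPath_comp]
      simp
    · intro c _ hc
      rw [← mul_def, of_mul_of, mulPath_of_ne (by simpa using hc)]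
    · simp
  rw [← LinearMap.flip_apply, this, LinearMap.id_apply]

/-- The path algebra of a quiver with finitely many vertices is a ring. -/
instance : Ring (PathAlgebra K V) :=
  { (inferInstance : AddCommGroup (PathAlgebra K V)),
    (inferInstance : Mul (PathAlgebra K V)),
    (inferInstance : One (PathAlgebra K V)) with
    left_distrib := fun f g h => by simp [mul_def]
    right_distrib := fun f g h => by simp [mul_def]
    zero_mul := fun f => by simp [mul_def]
    mul_zero := fun f => by simp [mul_def]
    mul_assoc := assoc_aux
    one_mul := one_mul_aux
    mul_one := mul_one_aux }

instance : Algebra K (PathAlgebra K V) :=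
  Algebra.ofModule (fun r f g => by simp [mul_def]) (fun r f g => by simp [mul_def])

end PathAlgebra

variable {K : Type u} {V : Type v} [Field K] [Quiver.{w} V] [Fintype V]

/-- Admissibility of an ideal `I` of the path algebra: `I` contains all paths of length `≥ m` for
some `m ≥ 2`, and every element of `I` is a linear combination of paths of length `≥ 2`. -/
def IsAdmissible (I : Ideal (PathAlgebra K V)) : Prop :=
  (∃ m : ℕ, 2 ≤ m ∧ ∀ x : AnyPath V, m ≤ x.path.length → PathAlgebra.of x ∈ I) ∧
    ∀ f ∈ I, ∀ x : AnyPath V, f.coeff x ≠ 0 → 2 ≤ x.path.length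

/-- A module is uniserial if it is nonzero, has finite length, and its submodules form a chain. -/
def IsUniserial (R : Type*) (M : Type*) [Ring R] [AddCommGroup M] [Module R M] : Prop :=
  Nontrivial M ∧ IsFiniteLength R M ∧ ∀ N₁ N₂ : Submodule R M, N₁ ≤ N₂ ∨ N₂ ≤ N₁

section BoundAlgebra

variable (I : Ideal (PathAlgebra K V)) [I.IsTwoSided]

/-- The residue class of a path in the algebra `Λ = KΓ/I`. -/
def pathElem {a b : V} (p : Path a b) : PathAlgebra K V ⧸ I :=
  Ideal.Quotient.mk I (PathAlgebra.of ⟨a, b, p⟩)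

/-- The isomorphism classes of uniserial left `Λ`-modules, `Λ = KΓ/I`. -/
def uniserialClasses : Set (Quotient (CategoryTheory.isIsomorphicSetoid
    (ModuleCat.{max u v w} (PathAlgebra K V ⧸ I)))) :=
  {c | ∃ M : ModuleCat.{max u v w} (PathAlgebra K V ⧸ I),
    IsUniserial (PathAlgebra K V ⧸ I) M ∧ Quotient.mk _ M = c}

/-- `Λ = KΓ/I` has finite uniserial type: there are only finitely many isomorphism classes of
uniserial left `Λ`-modules. -/
def FiniteUniserialType : Prop := (uniserialClasses I).Finite

/-- `p` is a mast of the module `M`: `M` is uniserial of composition length `length p + 1`, and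
`p M ≠ 0`. -/
def IsMastOf {a b : V} (p : Path a b) (M : Type*) [AddCommGroup M]
    [Module (PathAlgebra K V ⧸ I) M] : Prop :=
  IsUniserial (PathAlgebra K V ⧸ I) M ∧
    Module.length (PathAlgebra K V ⧸ I) M = (p.length : ℕ∞) + 1 ∧
    ∃ m : M, pathElem I p • m ≠ 0

/-- `p` is a mast of some uniserial left `Λ`-module. -/
def IsMast {a b : V} (p : Path a b) : Prop :=
  ∃ M : ModuleCat.{max u v w} (PathAlgebra K V ⧸ I), IsMastOf I p M

/-- Condition (N): if `α : e ⟶ e'` is an arrow and `p : e → e'` is a mast of positive length, then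
`p` is `α` followed by a (possibly trivial) oriented cycle at `e'`, or `α` preceded by a (possibly
trivial) oriented cycle at `e`. -/
def ConditionN : Prop :=
  ∀ (e e' : V) (α : e ⟶ e') (p : Path e e'), 0 < p.length → IsMast I p →
    (∃ c' : Path e' e', p = α.toPath.comp c') ∨ (∃ c : Path e e, p = c.cons α)

/-- A top element of a left `Λ`-module `M`: an element `x` outside `J M` with `x = e x` for some
vertex `e`. -/
def IsTopElement (M : Type*) [AddCommGroup M] [Module (PathAlgebra K V ⧸ I) M] (x : M) : Prop :=
  x ∉ Ring.jacobson (PathAlgebra K V ⧸ I) • (⊤ : Submodule (PathAlgebra K V ⧸ I) M) ∧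
    ∃ e : V, pathElem I (Path.nil : Path e e) • x = x

end BoundAlgebra

/-- `u` is a right subpath (that is, an initial segment) of `p`: one has `p = u' u` for some path
`u'`. In `Path.comp`, the segment traversed first is written first. -/
def IsRightSubpath {a b c : V} (u : Path a c) (p : Path a b) : Prop :=
  ∃ u' : Path c b, p = u.comp u'

/-- A detour `(α, u)` on `p`: here `u` is a right subpath of `p` and `α` is an arrow starting where
`u` ends such that `α u` is not a right subpath of `p`, but some right subpath of `p` that is
strictly longer than `u` ends in the same vertex as `α`. -/
structure Detour {a b : V} (p : Path a b) where
  mid : V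
  fin : V
  u : Path a mid
  α : mid ⟶ fin
  isRightSubpath : IsRightSubpath u p
  not_isRightSubpath : ¬ IsRightSubpath (u.cons α) p
  exists_longer : ∃ v : Path a fin, IsRightSubpath v p ∧ u.length < v.length

/-- The index set `I(α, u)` of a detour `(α, u)` on `p`, namely the set of all right subpaths `v`
of `p` which are longer than `u` and end in the same vertex as `α`. -/
def Detour.Index {a b : V} {p : Path a b} (D : Detour p) : Type (max v w) :=
  {v : Path a D.fin // IsRightSubpath v p ∧ D.u.length < v.length}

instance Detour.finite_index {a b : V} {p : Path a b} (D : Detour p) : Finite D.Index := by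
  refine Finite.of_injective
    (β := Fin (p.length + 1)) (fun v => ⟨v.1.length, ?_⟩) ?_
  · obtain ⟨v', hv⟩ := v.2.1
    have := congrArg Path.length hv
    rw [Path.length_comp] at this
    omega
  · rintro ⟨v₁, ⟨q₁, h₁⟩, _⟩ ⟨v₂, ⟨q₂, h₂⟩, _⟩ h
    have hl : v₁.length = v₂.length := by simpa using h
    exact Subtype.ext ((Path.comp_inj' hl).1 (h₁.symm.trans h₂)).1

instance Detour.fintype_index {a b : V} {p : Path a b} (D : Detour p) : Fintype D.Index :=
  Fintype.ofFinite _

/-- The set of triples `(α, u, i)` with `(α, u)` a detour on `p` and `i ∈ I(α, u)`, which label the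
coordinates `X_i(α, u)` of the variety `V_p`. -/
abbrev Coord {a b : V} (p : Path a b) : Type (max v w) := Σ D : Detour p, D.Index

section Varieties

variable (I : Ideal (PathAlgebra K V)) [I.IsTwoSided]

/-- The variety `V_p`, as a subset of the affine space with coordinates `X_i(α, u)`: a point
`(k_i(α, u))` belongs to `V_p` if and only if there are a uniserial left `Λ`-module with mast `p`
and a top element `x` of it such that `α u x = ∑ i, k_i(α, u) v_i(α, u) x` for every detour
`(α, u)` on `p`. -/
def uniserialVariety {a b : V} (p : Path a b) : Set (Coord p → K) :=
  {k | ∃ (M : ModuleCat.{max u v w} (PathAlgebra K V ⧸ I)) (x : M),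
    IsMastOf I p M ∧ IsTopElement I M x ∧
    ∀ D : Detour p, pathElem I (D.u.cons D.α) • x =
      (∑ i : D.Index, k ⟨D, i⟩ • pathElem I i.1) • x}

/-- The coordinate ring `A_p` of `V_p`. -/
abbrev CoordinateRing {a b : V} (p : Path a b) : Type (max u v w) :=
  MvPolynomial (Coord p) K ⧸ MvPolynomial.vanishingIdeal K (uniserialVariety I p)

/-- The image in `A_p` of the variable `X_i(α, u)`. -/
def coordFn {a b : V} {p : Path a b} (D : Detour p) (i : D.Index) : CoordinateRing I p :=
  Ideal.Quotient.mk _ (MvPolynomial.X (⟨D, i⟩ : Coord p))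

/-- A detour on the mast `p` is a halyard if at least one of its variables has nonzero image in
the coordinate ring of `V_p`. -/
def IsHalyard {a b : V} {p : Path a b} (D : Detour p) : Prop :=
  ∃ i : D.Index, coordFn I D i ≠ 0

/-- A halyard is slack if the image in `A_p` of at least one of its variables is transcendental
over `K`. -/
def IsSlackHalyard {a b : V} {p : Path a b} (D : Detour p) : Prop :=
  IsHalyard I D ∧ ∃ i : D.Index, Transcendental K (coordFn I D i)

/-- The edge path `p`, together with an additional edge `α` from the end of `u` down to the end of
`v_i(α, u)`, is a graph of the halyard `(α, u)` on `p`: there are a uniserial module `U` with mast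
`p` and a top element `x` of `U` with `Λ α u x = Λ v_i(α, u) x`. -/
def HasGraph {a b : V} {p : Path a b} (D : Detour p) (i : D.Index) : Prop :=
  ∃ (M : ModuleCat.{max u v w} (PathAlgebra K V ⧸ I)) (x : M),
    IsMastOf I p M ∧ IsTopElement I M x ∧
    Submodule.span (PathAlgebra K V ⧸ I) {pathElem I (D.u.cons D.α) • x} =
      Submodule.span (PathAlgebra K V ⧸ I) {pathElem I i.1 • x}

end Varieties

/-- The list of admissible halyard graphs. `IsListedGraph p u α v` says that the edge path `p`
with the additional edge `α` from the end of its right subpath `u` to the end of its right subpath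
`v` is one of the following subgraphs, not emerging from the top vertex, of the three graphs
(i)  `1 — 1 — 1 —α— 2 — 3` with `α` from the second vertex to the fourth,
(ii) `1 — 1 — 1 — 1 —α— 2` with `α` from the second and from the third vertex to the fifth,
(iii) `1 —α— 2 —β— 1 —α— 2 —γ— 3` with `γ` from the second vertex to the fifth,
where `1, 2, 3` are distinct vertices. -/
inductive IsListedGraph :
    ∀ {a b c d : V}, Path a b → Path a c → (c ⟶ d) → Path a d → Prop
  /-- graph (i) without its bottom edge -/
  | loop_two {e₁ e₂ : V} (h₁₂ : e₁ ≠ e₂) (ω ω' : e₁ ⟶ e₁) (α : e₁ ⟶ e₂) :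
      IsListedGraph (((Path.nil.cons ω).cons ω').cons α) (Path.nil.cons ω) α
        (((Path.nil.cons ω).cons ω').cons α)
  /-- graph (i) -/
  | loop_two_tail {e₁ e₂ e₃ : V} (h₁₂ : e₁ ≠ e₂) (h₁₃ : e₁ ≠ e₃) (h₂₃ : e₂ ≠ e₃)
      (ω ω' : e₁ ⟶ e₁) (α : e₁ ⟶ e₂) (δ : e₂ ⟶ e₃) :
      IsListedGraph ((((Path.nil.cons ω).cons ω').cons α).cons δ) (Path.nil.cons ω) α
        (((Path.nil.cons ω).cons ω').cons α)
  /-- graph (ii) with only the edge `α` emerging from its second vertex -/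
  | loop_three_second {e₁ e₂ : V} (h₁₂ : e₁ ≠ e₂) (ω ω' ω'' : e₁ ⟶ e₁) (α : e₁ ⟶ e₂) :
      IsListedGraph ((((Path.nil.cons ω).cons ω').cons ω'').cons α) (Path.nil.cons ω) α
        ((((Path.nil.cons ω).cons ω').cons ω'').cons α)
  /-- graph (ii) with only the edge `α` emerging from its third vertex -/
  | loop_three_third {e₁ e₂ : V} (h₁₂ : e₁ ≠ e₂) (ω ω' ω'' : e₁ ⟶ e₁) (α : e₁ ⟶ e₂) :
      IsListedGraph ((((Path.nil.cons ω).cons ω').cons ω'').cons α)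
        ((Path.nil.cons ω).cons ω') α
        ((((Path.nil.cons ω).cons ω').cons ω'').cons α)
  /-- graph (iii) -/
  | two_cycle {e₁ e₂ e₃ : V} (h₁₂ : e₁ ≠ e₂) (h₁₃ : e₁ ≠ e₃) (h₂₃ : e₂ ≠ e₃)
      (α : e₁ ⟶ e₂) (β : e₂ ⟶ e₁) (γ : e₂ ⟶ e₃) :
      IsListedGraph ((((Path.nil.cons α).cons β).cons α).cons γ) (Path.nil.cons α) γ
        ((((Path.nil.cons α).cons β).cons α).cons γ)

/-- All graphs of slack halyards that occur on masts of uniserial left `Λ`-modules and do not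
emerge from the top vertex of the mast are on the list. -/
def SlackHalyardsListed (I : Ideal (PathAlgebra K V)) [I.IsTwoSided] : Prop :=
  ∀ (a b : V) (p : Path a b), IsMast I p → ∀ D : Detour p, IsSlackHalyard I D →
    0 < D.u.length → ∀ i : D.Index, HasGraph I D i → IsListedGraph p D.u D.α i.1

end BoundQuiver

end

set_option linter.unusedSectionVars false

/-! Let `U` be uniserial with mast `p` of length `l` and top element `x`. The images `x_r` of `x`
under the initial segments of `p` form a basis adapted to the radical filtration (`IsFlag`).

Necessity of (N): take a shortest mast parallel to an arrow `α` which neither starts nor ends with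
`α`. Adding `s` times the socle vector to `α x` deforms `U` (`IsFlag.exists_socle_twist`), and
comparing socle coefficients shows that different `s` give non-isomorphic modules
(`exists_ne_of_finite`). As `K` is infinite, this contradicts finite type.

Under (N) and `J^5 = 0` one has `l ≤ 4`, and an arrow leaving the mast at position `j` sends `x_j`
to a multiple of a single `x_k`, where `(j, k)` is a chord (`IsChord`); there is at most one chord
for each `j`. So `U` together with `x` amounts to one scalar per chord, and these scalars determine
`U` (`IsNMast.nonempty_equiv`).

Everything rests on a dichotomy of chords. If the first `j` arrows of `p` are repeated so as to end
at position `k - 1` (`IsPeriodic`), then replacing `x` by `x + t x_{k-1-j}` adds `t` to the scalar,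
so the periodic scalars can be prescribed (`exists_top`). Otherwise the scalar does not depend on
`x` (`point_eq_of_not_isPeriodic`) and is an invariant of `U`. Chords from the top vertex are always
periodic; the other periodic ones are exactly the listed graphs (`isListedGraph_iff`).

Finite type therefore leaves finitely many values to a non-periodic coordinate, which is then
algebraic: slack halyards are listed. Conversely, suppose two points of `V_p` differ in a
non-periodic coordinate, and make their periodic coordinates agree. The difference of the two
actions maps into the third radical layer and kills that layer, so it is a crossed derivation of
square zero and `V_p` contains the whole line (`exists_line`). This yields an unlisted slack
halyard. Under the graph condition the non-periodic coordinates are thus constant: `V_p` is affine,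
modules with equal masts are isomorphic, and a module has only one mast. There are finitely many
masts, since their length is at most 4. -/

noncomputable section

namespace BoundQuiver

open Quiver

/-! ### Positions, vertices and arrows along a path. -/

section Paths

variable {V : Type v} [Quiver.{w} V]

/-- The initial segment of length `j` of a path. -/
def initSeg {a : V} : {b : V} → Path a b → ℕ → AnyPath V
  | _, .nil, _ => ⟨a, a, .nil⟩
  -- For `j` beyond the length the value is the whole path.
  | b, .cons q β, j => if j ≤ q.length then initSeg q j else ⟨a, b, q.cons β⟩

/-- The arrow number `j` (counted from `0`) of a path. -/
def arrowAt {a : V} : {b : V} → Path a b → ℕ → AnyPath V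
  | _, .nil, _ => ⟨a, a, .nil⟩
  -- For `j` beyond the length the value is the last arrow.
  | b, .cons (b := c) q β, j => if j < q.length then arrowAt q j else ⟨c, b, β.toPath⟩

/-- The vertex number `j` of a path. -/
def vtx {a b : V} (p : Path a b) (j : ℕ) : V := (initSeg p j).tgt

variable {a b c : V}

theorem initSeg_length (p : Path a b) : initSeg p p.length = ⟨a, b, p⟩ := by
  cases p <;> simp [initSeg]

theorem initSeg_comp (u : Path a c) (v : Path c b) {j : ℕ} (hj : j ≤ u.length) :
    initSeg (u.comp v) j = initSeg u j := by
  induction v with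
  | nil => rfl
  | cons q β ih =>
    rw [Path.comp_cons, initSeg, if_pos (by rw [Path.length_comp]; omega), ih]

theorem initSeg_comp_length (u : Path a c) (v : Path c b) :
    initSeg (u.comp v) u.length = ⟨a, c, u⟩ := by
  rw [initSeg_comp u v le_rfl, initSeg_length]

theorem exists_split (p : Path a b) {j : ℕ} (hj : j ≤ p.length) :
    ∃ (c : V) (u : Path a c) (v : Path c b), p = u.comp v ∧ u.length = j ∧
      initSeg p j = ⟨a, c, u⟩ := by
  obtain ⟨c, u, v, h, rfl⟩ := p.exists_eq_comp_of_le_length hj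
  exact ⟨c, u, v, h, rfl, by rw [h, initSeg_comp_length]⟩

theorem arrowAt_comp_left (u : Path a c) (v : Path c b) {j : ℕ} (hj : j < u.length) :
    arrowAt (u.comp v) j = arrowAt u j := by
  induction v with
  | nil => rfl
  | cons q β ih =>
    rw [Path.comp_cons, arrowAt, if_pos (by rw [Path.length_comp]; omega), ih]

theorem arrowAt_comp_right (u : Path a c) (v : Path c b) {j : ℕ} (hj : j < v.length) :
    arrowAt (u.comp v) (u.length + j) = arrowAt v j := by
  induction v with
  | nil => simp at hj
  | cons q β ih =>
    rw [Path.comp_cons, arrowAt, arrowAt, Path.length_comp]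
    by_cases h : j < q.length
    · rw [if_pos (by omega), if_pos h, ih h]
    · rw [if_neg (by omega), if_neg h]

theorem arrowAt_cons (q : Path a c) (β : c ⟶ b) :
    arrowAt (q.cons β) q.length = ⟨c, b, β.toPath⟩ := by
  simp [arrowAt]

theorem exists_split_arrow (p : Path a b) {j : ℕ} (hj : j < p.length) :
    ∃ (c d : V) (u : Path a c) (β : c ⟶ d) (v : Path d b), p = (u.cons β).comp v ∧
      u.length = j ∧ initSeg p j = ⟨a, c, u⟩ ∧ initSeg p (j + 1) = ⟨a, d, u.cons β⟩ ∧
      arrowAt p j = ⟨c, d, β.toPath⟩ := by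
  obtain ⟨d, u', v, h, hu', h₂⟩ := exists_split p (Nat.succ_le_of_lt hj)
  cases u' with
  | nil => simp at hu'
  | cons u β =>
    have hu : u.length = j := by simpa using hu'
    refine ⟨_, d, u, β, v, h, hu, ?_, h₂, ?_⟩
    · subst hu
      rw [h, initSeg_comp _ _ (by simp)]
      simp [initSeg, initSeg_length]
    · subst hu
      rw [h, arrowAt_comp_left _ _ (by simp), arrowAt_cons]

theorem length_initSeg (p : Path a b) {j : ℕ} (hj : j ≤ p.length) :
    (initSeg p j).path.length = j := by
  obtain ⟨c, u, v, -, hu, h⟩ := exists_split p hj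
  rw [h, hu]

theorem vtx_zero (p : Path a b) : vtx p 0 = a := by
  obtain ⟨c, u, v, -, hu, h⟩ := exists_split p (Nat.zero_le _)
  rw [vtx, h]
  exact (Path.eq_of_length_zero u hu).symm

theorem initSeg_zero (p : Path a b) : initSeg p 0 = ⟨a, a, Path.nil⟩ := by
  obtain ⟨c, u, v, -, hu, h⟩ := exists_split p (Nat.zero_le _)
  rw [h]
  cases u with
  | nil => rfl
  | cons => simp at hu

theorem vtx_length (p : Path a b) : vtx p p.length = b := by
  rw [vtx, initSeg_length]

theorem arrowAt_src (p : Path a b) {j : ℕ} (hj : j < p.length) :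
    (arrowAt p j).src = vtx p j := by
  obtain ⟨c, d, u, β, v, -, -, h₁, -, h₂⟩ := exists_split_arrow p hj
  rw [vtx, h₁, h₂]

theorem arrowAt_tgt (p : Path a b) {j : ℕ} (hj : j < p.length) :
    (arrowAt p j).tgt = vtx p (j + 1) := by
  obtain ⟨c, d, u, β, v, -, -, -, h₁, h₂⟩ := exists_split_arrow p hj
  rw [vtx, h₁, h₂]

theorem length_arrowAt (p : Path a b) {j : ℕ} (hj : j < p.length) :
    (arrowAt p j).path.length = 1 := by
  obtain ⟨c, d, u, β, v, -, -, -, -, h₂⟩ := exists_split_arrow p hj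
  rw [h₂]; rfl

theorem AnyPath.exists_arrow {β : AnyPath V} (h : β.path.length = 1) :
    ∃ (c d : V) (α : c ⟶ d), β = ⟨c, d, α.toPath⟩ := by
  obtain ⟨c, d, p⟩ := β
  cases p with
  | nil => simp at h
  | cons q α =>
    cases q with
    | nil => exact ⟨_, _, α, rfl⟩
    | cons => simp at h

theorem arrowAt_zero_toPath_comp (α : a ⟶ c) (q : Path c b) :
    arrowAt (α.toPath.comp q) 0 = ⟨a, c, α.toPath⟩ := by
  rw [arrowAt_comp_left _ _ (by simp)]
  simp [Quiver.Hom.toPath, arrowAt]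

theorem isRightSubpath_iff {u : Path a c} {p : Path a b} :
    IsRightSubpath u p ↔ u.length ≤ p.length ∧ initSeg p u.length = ⟨a, c, u⟩ := by
  constructor
  · rintro ⟨v, rfl⟩
    exact ⟨by simp, initSeg_comp_length u v⟩
  · rintro ⟨h, h'⟩
    obtain ⟨d, u', v, hp, -, h₂⟩ := exists_split p h
    rw [h'] at h₂
    obtain rfl : c = d := congrArg AnyPath.tgt h₂
    obtain rfl : u = u' := by simpa using h₂
    exact ⟨v, hp⟩

end Paths

/-! ### Coefficients of products in the path algebra. -/

section Algebra

variable {K : Type u} {V : Type v} [Field K] [Quiver.{w} V]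

namespace PathAlgebra

theorem induction_of {P : PathAlgebra K V → Prop} (zero : P 0) (of : ∀ x, P (of x))
    (add : ∀ f g, P f → P g → P (f + g)) (smul : ∀ (c : K) f, P f → P (c • f))
    (f : PathAlgebra K V) : P f := by
  refine Finsupp.induction_linear (motive := P) f zero add fun x c => ?_
  have h := smul c _ (of x)
  have e : c • PathAlgebra.of x = (Finsupp.single x c : AnyPath V →₀ K) :=
    (Finsupp.smul_single c x 1).trans (by rw [smul_eq_mul, mul_one])
  exact (congrArg P e).mp h

theorem coeff_add (f g : PathAlgebra K V) (x : AnyPath V) :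
    (f + g).coeff x = f.coeff x + g.coeff x := rfl

theorem coeff_sub (f g : PathAlgebra K V) (x : AnyPath V) :
    (f - g).coeff x = f.coeff x - g.coeff x := rfl

theorem coeff_smul (c : K) (f : PathAlgebra K V) (x : AnyPath V) :
    (c • f).coeff x = c * f.coeff x := rfl

theorem coeff_zero (x : AnyPath V) : (0 : PathAlgebra K V).coeff x = 0 := rfl

open Classical in
theorem coeff_of (x y : AnyPath V) : (of x : PathAlgebra K V).coeff y = if x = y then 1 else 0 :=
  Finsupp.single_apply

theorem of_mul_of_comp {a b c : V} (q : Path b c) (p : Path a b) [Fintype V] :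
    (of ⟨b, c, q⟩ * of ⟨a, b, p⟩ : PathAlgebra K V) = of ⟨a, c, p.comp q⟩ := by
  rw [of_mul_of, mulPath_comp]

theorem coeff_of_of_length_ne {x y : AnyPath V} (h : x.path.length ≠ y.path.length) :
    (of x : PathAlgebra K V).coeff y = 0 := by
  rw [coeff_of, if_neg (by rintro rfl; exact h rfl)]

theorem _root_.BoundQuiver.AnyPath.eq_nil_iff {x : AnyPath V} {e : V} :
    x = ⟨e, e, .nil⟩ ↔ x.src = e ∧ x.path.length = 0 := by
  constructor
  · rintro rfl; exact ⟨rfl, rfl⟩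
  · obtain ⟨a, b, p⟩ := x
    rintro ⟨rfl, h⟩
    cases p with
    | nil => rfl
    | cons => simp at h

variable [Fintype V]

/-- A trivial path factors only as itself times itself. This multiplicativity yields the characters
`vertexChar`. -/
theorem coeff_mul_nil (f g : PathAlgebra K V) (e : V) :
    (f * g).coeff ⟨e, e, .nil⟩ = f.coeff ⟨e, e, .nil⟩ * g.coeff ⟨e, e, .nil⟩ := by
  induction f using induction_of with
  | zero => simp [coeff_zero]
  | add f f' h h' => rw [add_mul, coeff_add, coeff_add, h, h']; ring
  | smul c f h => rw [smul_mul_assoc, coeff_smul, coeff_smul, h]; ring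
  | of x =>
    induction g using induction_of with
    | zero => simp [coeff_zero]
    | add f f' h h' => rw [mul_add, coeff_add, coeff_add, h, h']; ring
    | smul c f h => rw [mul_smul_comm, coeff_smul, coeff_smul, h]; ring
    | of y =>
      obtain ⟨a, b, p⟩ := x
      obtain ⟨c, d, q⟩ := y
      by_cases h : d = a
      · subst h
        rw [of_mul_of_comp, coeff_of, coeff_of, coeff_of]
        have hq : q.length = 0 → c = d := Path.eq_of_length_zero q
        have h₁ := AnyPath.eq_nil_iff (x := ⟨c, b, q.comp p⟩) (e := e)
        have h₂ := AnyPath.eq_nil_iff (x := ⟨c, d, q⟩) (e := e)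
        have h₃ := AnyPath.eq_nil_iff (x := ⟨d, b, p⟩) (e := e)
        rw [Path.length_comp] at h₁
        split_ifs <;> grind
      · rw [of_mul_of, mulPath_of_ne h, coeff_zero, coeff_of, coeff_of]
        grind

/-- An arrow factors only with a trivial path on one side, so its coefficient is a derivation
between the characters at `e` and `e'`. This crossed Leibniz rule drives the socle deformation. -/
theorem coeff_mul_arrow (f g : PathAlgebra K V) {e e' : V} (α : e ⟶ e') :
    (f * g).coeff ⟨e, e', α.toPath⟩ = f.coeff ⟨e, e', α.toPath⟩ * g.coeff ⟨e, e, .nil⟩ +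
      f.coeff ⟨e', e', .nil⟩ * g.coeff ⟨e, e', α.toPath⟩ := by
  induction f using induction_of with
  | zero => simp [coeff_zero]
  | add f f' h h' => simp only [add_mul, coeff_add, h, h']; ring
  | smul c f h => simp only [smul_mul_assoc, coeff_smul, h]; ring
  | of x =>
    induction g using induction_of with
    | zero => simp [coeff_zero]
    | add f f' h h' => simp only [mul_add, coeff_add, h, h']; ring
    | smul c f h => simp only [mul_smul_comm, coeff_smul, h]; ring
    | of y =>
      obtain ⟨a, b, p⟩ := x
      obtain ⟨c, d, q⟩ := y
      by_cases h : d = a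
      · subst h
        rw [of_mul_of_comp]
        cases p with
        | nil =>
          rw [coeff_of_of_length_ne (x := ⟨_, _, .nil⟩) (y := ⟨e, e', α.toPath⟩) (by simp),
            Path.comp_nil, coeff_of ⟨_, _, Path.nil⟩, coeff_of]
          split_ifs <;> grind
        | cons p β =>
          rw [coeff_of_of_length_ne (x := ⟨d, b, p.cons β⟩) (y := ⟨e', e', .nil⟩) (by simp)]
          cases q with
          | nil =>
            rw [Path.nil_comp, coeff_of, coeff_of]
            split_ifs <;> grind
          | cons q γ =>
            rw [coeff_of_of_length_ne (y := ⟨e, e', α.toPath⟩) (by simp),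
              coeff_of_of_length_ne (y := ⟨e, e, .nil⟩) (by simp)]
            simp
      · rw [of_mul_of, mulPath_of_ne h, coeff_zero, coeff_of, coeff_of, coeff_of, coeff_of]
        split_ifs <;> grind

end PathAlgebra

end Algebra

/-! ### Low coefficients and vertex characters of the quotient algebra. -/

section BoundAlgebraBasics

variable {K : Type u} {V : Type v} [Field K] [Quiver.{w} V] [Fintype V]
variable (I : Ideal (PathAlgebra K V)) [I.IsTwoSided]

theorem pathElem_mul {a b c : V} (q : Path b c) (p : Path a b) :
    pathElem I q * pathElem I p = pathElem I (p.comp q) := by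
  rw [pathElem, pathElem, ← map_mul, PathAlgebra.of_mul_of_comp, pathElem]

theorem pathElem_mul_of_ne {a b c d : V} (q : Path c d) (p : Path a b) (h : b ≠ c) :
    pathElem I q * pathElem I p = 0 := by
  rw [pathElem, pathElem, ← map_mul, PathAlgebra.of_mul_of, PathAlgebra.mulPath_of_ne h, map_zero]

theorem one_eq_sum : (1 : PathAlgebra K V ⧸ I) = ∑ e : V, pathElem I (Path.nil : Path e e) := by
  rw [← map_one (Ideal.Quotient.mk I), PathAlgebra.one_def, map_sum]
  rfl

variable {I} in
theorem quotient_induction {P : PathAlgebra K V ⧸ I → Prop} (zero : P 0)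
    (path : ∀ {a b : V} (p : Path a b), P (pathElem I p))
    (add : ∀ f g, P f → P g → P (f + g)) (smul : ∀ (c : K) f, P f → P (c • f))
    (f : PathAlgebra K V ⧸ I) : P f := by
  obtain ⟨f, rfl⟩ := Ideal.Quotient.mk_surjective f
  induction f using PathAlgebra.induction_of with
  | zero => simpa using zero
  | of x => exact path x.path
  | add f g hf hg => rw [map_add]; exact add _ _ hf hg
  | smul c f hf => exact smul c _ hf

/-- The coefficient of a path of length at most one in an element of `KΓ/I`, for `I` admissible. -/
def lowCoeff (x : AnyPath V) (f : PathAlgebra K V ⧸ I) : K :=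
  (Function.surjInv Ideal.Quotient.mk_surjective f).coeff x

variable {I}

/-- Two lifts differ by an element of `I`, which by admissibility has no terms of length below 2. -/
theorem lowCoeff_mk (hI : IsAdmissible I) {x : AnyPath V} (hx : x.path.length < 2)
    (f : PathAlgebra K V) : lowCoeff I x (Ideal.Quotient.mk I f) = f.coeff x := by
  have h := Function.surjInv_eq (f := Ideal.Quotient.mk I) Ideal.Quotient.mk_surjective
    (Ideal.Quotient.mk I f)
  by_contra hne
  have := hI.2 _ (Ideal.Quotient.eq.1 h) x (by
    rw [PathAlgebra.coeff_sub]
    exact sub_ne_zero.2 hne)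
  omega

section lowCoeff

variable (hI : IsAdmissible I)
include hI

theorem lowCoeff_add {x : AnyPath V} (hx : x.path.length < 2) (f g : PathAlgebra K V ⧸ I) :
    lowCoeff I x (f + g) = lowCoeff I x f + lowCoeff I x g := by
  obtain ⟨f, rfl⟩ := Ideal.Quotient.mk_surjective f
  obtain ⟨g, rfl⟩ := Ideal.Quotient.mk_surjective g
  rw [← map_add, lowCoeff_mk hI hx, lowCoeff_mk hI hx, lowCoeff_mk hI hx, PathAlgebra.coeff_add]

theorem lowCoeff_smul {x : AnyPath V} (hx : x.path.length < 2) (c : K) (f : PathAlgebra K V ⧸ I) :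
    lowCoeff I x (c • f) = c * lowCoeff I x f := by
  obtain ⟨f, rfl⟩ := Ideal.Quotient.mk_surjective f
  rw [show c • Ideal.Quotient.mk I f = Ideal.Quotient.mk I (c • f) from rfl,
    lowCoeff_mk hI hx, lowCoeff_mk hI hx, PathAlgebra.coeff_smul]

theorem lowCoeff_zero {x : AnyPath V} (hx : x.path.length < 2) :
    lowCoeff I x 0 = 0 := by
  rw [← map_zero (Ideal.Quotient.mk I), lowCoeff_mk hI hx, PathAlgebra.coeff_zero]

open Classical in
theorem lowCoeff_pathElem {x : AnyPath V} (hx : x.path.length < 2) {a b : V} (p : Path a b) :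
    lowCoeff I x (pathElem I p) = if ⟨a, b, p⟩ = x then 1 else 0 := by
  rw [pathElem, lowCoeff_mk hI hx, PathAlgebra.coeff_of]

theorem lowCoeff_mul_nil (e : V) (f g : PathAlgebra K V ⧸ I) :
    lowCoeff I ⟨e, e, .nil⟩ (f * g) = lowCoeff I ⟨e, e, .nil⟩ f * lowCoeff I ⟨e, e, .nil⟩ g := by
  obtain ⟨f, rfl⟩ := Ideal.Quotient.mk_surjective f
  obtain ⟨g, rfl⟩ := Ideal.Quotient.mk_surjective g
  rw [← map_mul, lowCoeff_mk hI (by simp), lowCoeff_mk hI (by simp), lowCoeff_mk hI (by simp),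
    PathAlgebra.coeff_mul_nil]

theorem lowCoeff_mul_arrow {e e' : V} (α : e ⟶ e') (f g : PathAlgebra K V ⧸ I) :
    lowCoeff I ⟨e, e', α.toPath⟩ (f * g) =
      lowCoeff I ⟨e, e', α.toPath⟩ f * lowCoeff I ⟨e, e, .nil⟩ g +
        lowCoeff I ⟨e', e', .nil⟩ f * lowCoeff I ⟨e, e', α.toPath⟩ g := by
  obtain ⟨f, rfl⟩ := Ideal.Quotient.mk_surjective f
  obtain ⟨g, rfl⟩ := Ideal.Quotient.mk_surjective g
  rw [← map_mul, lowCoeff_mk hI (by simp), lowCoeff_mk hI (by simp), lowCoeff_mk hI (by simp),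
    lowCoeff_mk hI (by simp), lowCoeff_mk hI (by simp), PathAlgebra.coeff_mul_arrow]

/-- The character of `KΓ/I` belonging to a vertex. -/
def vertexChar (e : V) : (PathAlgebra K V ⧸ I) →+* K where
  toFun := lowCoeff I ⟨e, e, .nil⟩
  map_one' := by
    rw [← map_one (Ideal.Quotient.mk I), lowCoeff_mk hI (by simp)]
    have : ∀ s : Finset V, PathAlgebra.coeff (K := K)
        (∑ a ∈ s, PathAlgebra.of ⟨a, a, Path.nil⟩) ⟨e, e, .nil⟩ =
        ∑ a ∈ s, PathAlgebra.coeff (K := K) (PathAlgebra.of ⟨a, a, Path.nil⟩) ⟨e, e, .nil⟩ := by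
      classical
      intro s
      induction s using Finset.induction_on with
      | empty => simp [PathAlgebra.coeff_zero]
      | insert a s ha ih => rw [Finset.sum_insert ha, Finset.sum_insert ha,
          PathAlgebra.coeff_add, ih]
    rw [PathAlgebra.one_def, this, Finset.sum_eq_single e]
    · rw [PathAlgebra.coeff_of, if_pos rfl]
    · intro a _ ha
      rw [PathAlgebra.coeff_of, if_neg]
      intro h
      exact ha (congrArg AnyPath.src h)
    · simp
  map_mul' := lowCoeff_mul_nil hI e
  map_zero' := lowCoeff_zero hI (by simp)
  map_add' := lowCoeff_add hI (by simp)

end lowCoeff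

end BoundAlgebraBasics

/-! ### The radical filtration of a module. -/

section Filtration

variable {K : Type u} {V : Type v} [Field K] [Quiver.{w} V] [Fintype V]
variable (I : Ideal (PathAlgebra K V)) [I.IsTwoSided]
variable (M : Type*) [AddCommGroup M] [Module (PathAlgebra K V ⧸ I) M]

/-- The submodule generated by all `q m` with `q` a path of length at least `r`. -/
def radFilt (r : ℕ) : Submodule (PathAlgebra K V ⧸ I) M :=
  Submodule.span _ {y | ∃ (q : AnyPath V) (m : M), r ≤ q.path.length ∧ pathElem I q.path • m = y}

variable {I M}

theorem pathElem_smul_mem {a b : V} (q : Path a b) (m : M) {r : ℕ} (h : r ≤ q.length) :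
    pathElem I q • m ∈ radFilt I M r :=
  Submodule.subset_span ⟨⟨a, b, q⟩, m, h, rfl⟩

theorem pathElem_smul_smul {a b c : V} (q : Path b c) (p : Path a b) (m : M) :
    pathElem I q • pathElem I p • m = pathElem I (p.comp q) • m := by
  rw [← mul_smul, pathElem_mul]

theorem pathElem_smul_smul_of_ne {a b c d : V} (q : Path c d) (p : Path a b) (h : b ≠ c) (m : M) :
    pathElem I q • pathElem I p • m = 0 := by
  rw [← mul_smul, pathElem_mul_of_ne I q p h, zero_smul]

theorem sum_nil_smul (m : M) : ∑ e : V, pathElem I (Path.nil : Path e e) • m = m := by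
  rw [← Finset.sum_smul, ← one_eq_sum, one_smul]

theorem radFilt_zero : radFilt I M 0 = ⊤ := by
  refine eq_top_iff.2 fun m _ => ?_
  rw [← sum_nil_smul (I := I) m]
  exact Submodule.sum_mem _ fun e _ => pathElem_smul_mem _ _ (Nat.zero_le _)

theorem radFilt_antitone : Antitone (radFilt I M) := fun _ _ h =>
  Submodule.span_mono fun _ ⟨q, m, hq, e⟩ => ⟨q, m, h.trans hq, e⟩

variable [Module K M] [IsScalarTower K (PathAlgebra K V ⧸ I) M]

/-- The layers are spanned over the algebra, so a scalar `f` may stand between two paths. Expanding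
`f` into paths only lengthens the product, which is why the induction keeps `q` arbitrary. -/
theorem smul_mem_radFilt {a b : V} (q : Path a b) {r s : ℕ} {y : M} (hy : y ∈ radFilt I M r)
    (hs : s ≤ r + q.length) : pathElem I q • y ∈ radFilt I M s := by
  suffices ∀ {a b : V} (q : Path a b), pathElem I q • y ∈ radFilt I M (r + q.length) from
    radFilt_antitone hs (this q)
  clear hs q
  induction hy using Submodule.span_induction with
  | mem y hy =>
    obtain ⟨⟨c, d, p⟩, m, hp, rfl⟩ := hy
    intro a b q
    by_cases h : d = a
    · subst h
      rw [pathElem_smul_smul]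
      exact pathElem_smul_mem _ _ (by simpa using hp)
    · rw [pathElem_smul_smul_of_ne _ _ h]
      exact zero_mem _
  | zero => intro a b q; rw [smul_zero]; exact zero_mem _
  | add y z _ _ hy hz => intro a b q; rw [smul_add]; exact add_mem (hy q) (hz q)
  | smul f y _ hy =>
    intro a b q
    induction f using quotient_induction with
    | zero => rw [zero_smul, smul_zero]; exact zero_mem _
    | add f g hf hg => rw [add_smul, smul_add]; exact add_mem hf hg
    | smul c f hf =>
      rw [smul_assoc, smul_comm]
      exact Submodule.smul_of_tower_mem _ c hf
    | @path c d p =>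
      by_cases h : d = a
      · subst h
        rw [pathElem_smul_smul]
        exact radFilt_antitone (by simp) (hy _)
      · rw [pathElem_smul_smul_of_ne _ _ h]
        exact zero_mem _

/-- Modulo the next layer paths of positive length act as zero, and among trivial paths only the one
at `e` survives, so the algebra acts on `y` through scalars. -/
theorem exists_smul_sub_mem {r : ℕ} {e : V} {y : M} (hy : y ∈ radFilt I M r)
    (he : pathElem I (Path.nil : Path e e) • y = y) (f : PathAlgebra K V ⧸ I) :
    ∃ c : K, f • y - c • y ∈ radFilt I M (r + 1) := by
  induction f using quotient_induction with
  | zero => exact ⟨0, by simp⟩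
  | add f g hf hg =>
    obtain ⟨c, hc⟩ := hf
    obtain ⟨d, hd⟩ := hg
    refine ⟨c + d, ?_⟩
    convert add_mem hc hd using 1
    rw [add_smul, add_smul]; abel
  | smul t f hf =>
    obtain ⟨c, hc⟩ := hf
    refine ⟨t * c, ?_⟩
    convert Submodule.smul_of_tower_mem _ t hc using 1
    rw [smul_sub, smul_assoc, mul_smul]
  | @path a b p =>
    cases p with
    | nil =>
      by_cases h : e = a
      · subst h
        exact ⟨1, by rw [he, one_smul, sub_self]; exact zero_mem _⟩
      · refine ⟨0, ?_⟩
        rw [← he, pathElem_smul_smul_of_ne _ _ h, zero_smul, sub_zero]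
        exact zero_mem _
    | cons p α =>
      refine ⟨0, ?_⟩
      rw [zero_smul, sub_zero]
      exact smul_mem_radFilt _ hy (by simp)

/-- In a uniserial module every layer of the radical filtration is at most one-dimensional. -/
theorem exists_sub_smul_mem (hM : ∀ N₁ N₂ : Submodule (PathAlgebra K V ⧸ I) M, N₁ ≤ N₂ ∨ N₂ ≤ N₁)
    {r : ℕ} {e : V} {y z : M} (hz : z ∈ radFilt I M r) (hz' : z ∉ radFilt I M (r + 1))
    (he : pathElem I (Path.nil : Path e e) • z = z) (hy : y ∈ radFilt I M r) :
    ∃ c : K, y - c • z ∈ radFilt I M (r + 1) := by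
  have key : ∀ (e' : V) (y : M), y ∈ radFilt I M r → pathElem I (Path.nil : Path e' e') • y = y →
      ∃ c : K, y - c • z ∈ radFilt I M (r + 1) := by
    intro e' y hy he'
    -- One of two cyclic submodules contains the other. If `z` is a multiple of `y`, the scalar is
    -- invertible because `z` lies outside the next layer.
    rcases hM (Submodule.span _ {y}) (Submodule.span _ {z}) with h | h
    · obtain ⟨f, rfl⟩ := Submodule.mem_span_singleton.1 (h (Submodule.mem_span_singleton_self y))
      exact exists_smul_sub_mem hz he f
    · obtain ⟨f, rfl⟩ := Submodule.mem_span_singleton.1 (h (Submodule.mem_span_singleton_self z))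
      obtain ⟨c, hc⟩ := exists_smul_sub_mem hy he' f
      have hc0 : c ≠ 0 := by
        rintro rfl
        rw [zero_smul, sub_zero] at hc
        exact hz' hc
      refine ⟨c⁻¹, ?_⟩
      convert Submodule.smul_of_tower_mem _ (-c⁻¹) hc using 1
      rw [smul_sub, smul_smul, neg_mul, inv_mul_cancel₀ hc0, neg_smul, neg_one_smul]
      abel
  -- A general `y` is the sum of its components at the vertices.
  choose c hc using fun e' : V => key e' (pathElem I (Path.nil : Path e' e') • y)
    (smul_mem_radFilt _ hy (by simp)) (by rw [pathElem_smul_smul]; rfl)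
  refine ⟨∑ e', c e', ?_⟩
  convert Submodule.sum_mem _ fun e' (_ : e' ∈ Finset.univ) => hc e' using 1
  rw [Finset.sum_sub_distrib, sum_nil_smul, Finset.sum_smul]

end Filtration

section Split

variable {V : Type v} [Quiver.{w} V] {a b : V}

theorem exists_split_three (p : Path a b) {i m : ℕ} (hi : i ≤ m) (hm : m ≤ p.length) :
    ∃ (c d : V) (u : Path a c) (q : Path c d) (z : Path d b), p = (u.comp q).comp z ∧
      u.length = i ∧ q.length = m - i ∧ initSeg p i = ⟨a, c, u⟩ ∧
      initSeg p m = ⟨a, d, u.comp q⟩ := by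
  obtain ⟨d, u', z, h, hu', hs⟩ := exists_split p hm
  obtain ⟨c, u, q, h₂, hu, hs₂⟩ := exists_split u' (j := i) (by omega)
  subst h₂
  rw [Path.length_comp] at hu'
  refine ⟨c, d, u, q, z, h, hu, by omega, ?_, hs⟩
  rw [h, initSeg_comp _ _ (by rw [Path.length_comp]; omega), hs₂]

end Split

/-! ### Uniserial modules as flags along a mast. -/

section Flag

variable {K : Type u} {V : Type v} [Field K] [Quiver.{w} V] [Fintype V]
variable (I : Ideal (PathAlgebra K V)) [I.IsTwoSided]

/-- The element obtained by applying the initial segment of length `r` of `p` to `x`. -/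
def along {M : Type*} [AddCommGroup M] [Module (PathAlgebra K V ⧸ I) M] {a b : V} (p : Path a b)
    (x : M) (r : ℕ) : M :=
  pathElem I (initSeg p r).path • x

/-- The layers of the radical filtration of `M` are spanned by the images of `x` under the initial
segments of `p`, the last of which does not vanish. -/
structure IsFlag {M : Type*} [AddCommGroup M] [Module (PathAlgebra K V ⧸ I) M] [Module K M]
    {a b : V} (p : Path a b) (x : M) : Prop where
  src_smul : pathElem I (Path.nil : Path a a) • x = x
  bot : radFilt I M (p.length + 1) = ⊥
  ne_zero : pathElem I p • x ≠ 0
  step : ∀ r ≤ p.length, ∀ y ∈ radFilt I M r, ∃ c : K, y - c • along I p x r ∈ radFilt I M (r + 1)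

variable {I}
variable {M : Type*} [AddCommGroup M] [Module (PathAlgebra K V ⧸ I) M] {a b : V} (p : Path a b)
  (x : M)

theorem along_zero : along I p x 0 = pathElem I (Path.nil : Path a a) • x := by
  rw [along, initSeg_zero]

theorem along_length : along I p x p.length = pathElem I p • x := by
  rw [along, initSeg_length]

theorem along_mem {r : ℕ} (hr : r ≤ p.length) : along I p x r ∈ radFilt I M r :=
  pathElem_smul_mem _ _ (length_initSeg p hr).ge

theorem nil_smul_along (r : ℕ) :
    pathElem I (Path.nil : Path (vtx p r) (vtx p r)) • along I p x r = along I p x r :=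
  pathElem_smul_smul (I := I) (Path.nil : Path (initSeg p r).tgt _) (initSeg p r).path x

theorem smul_along_of_ne {c d : V} (q : Path c d) {r : ℕ} (h : vtx p r ≠ c) :
    pathElem I q • along I p x r = 0 :=
  pathElem_smul_smul_of_ne _ _ h _

theorem arrowAt_smul_along {r : ℕ} (hr : r < p.length) :
    pathElem I (arrowAt p r).path • along I p x r = along I p x (r + 1) := by
  obtain ⟨c, d, u, β, v, -, -, h₁, h₂, h₃⟩ := exists_split_arrow p hr
  rw [along, along, h₁, h₂, h₃, pathElem_smul_smul]; rfl

theorem exists_smul_along {i m : ℕ} (hi : i ≤ m) (hm : m ≤ p.length) :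
    ∃ q : AnyPath V, q.path.length = m - i ∧
      pathElem I q.path • along I p x i = along I p x m := by
  obtain ⟨c, d, u, q, z, -, -, hq, h₁, h₂⟩ := exists_split_three p hi hm
  refine ⟨⟨c, d, q⟩, hq, ?_⟩
  rw [along, along, h₁, h₂, pathElem_smul_smul]

variable [Module K M] [IsScalarTower K (PathAlgebra K V ⧸ I) M]

theorem quotient_smul_comm (c : K) (f : PathAlgebra K V ⧸ I) (y : M) :
    f • c • y = c • f • y :=
  smul_comm _ _ _

variable {p x}

/-- A filtration with these properties must be the radical one: it contains the latter because
arrows move down a layer, and the reverse inclusion follows by descending induction, each layer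
being spanned by a vector along `p`. -/
theorem isFlag_of_filtration (H : ℕ → Submodule (PathAlgebra K V ⧸ I) M) (hanti : Antitone H)
    (h0 : H 0 = ⊤) (hbot : H (p.length + 1) = ⊥)
    (harrow : ∀ {c d : V} (α : c ⟶ d) (r : ℕ) (y : M), y ∈ H r →
      pathElem I α.toPath • y ∈ H (r + 1))
    (hstep : ∀ r ≤ p.length, ∀ y ∈ H r, ∃ c : K, y - c • along I p x r ∈ H (r + 1))
    (hx : pathElem I (Path.nil : Path a a) • x = x) (hne : pathElem I p • x ≠ 0) :
    IsFlag I p x ∧ ∀ r ≤ p.length + 1, radFilt I M r = H r := by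
  have hpath : ∀ {c d : V} (q : Path c d) (m : M), pathElem I q • m ∈ H q.length := by
    intro c d q m
    induction q with
    | nil => rw [Path.length_nil, h0]; trivial
    | cons q α ih =>
      have := harrow α _ _ ih
      rwa [pathElem_smul_smul] at this
  have hle : ∀ r, radFilt I M r ≤ H r := fun r => by
    refine Submodule.span_le.2 ?_
    rintro _ ⟨q, m, hq, rfl⟩
    exact hanti hq (hpath q.path m)
  have hge : ∀ d r, r + d = p.length + 1 → H r ≤ radFilt I M r := by
    intro d
    induction d with
    | zero =>
      intro r hr
      rw [Nat.add_zero] at hr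
      rw [hr, hbot]
      exact bot_le
    | succ d ih =>
      intro r hr y hy
      obtain ⟨c, hc⟩ := hstep r (by omega) y hy
      have h₁ := radFilt_antitone (Nat.le_succ r) (ih (r + 1) (by omega) hc)
      have h₂ := Submodule.smul_of_tower_mem _ c (along_mem (I := I) p x (show r ≤ p.length by omega))
      simpa using add_mem h₁ h₂
  have heq : ∀ r ≤ p.length + 1, radFilt I M r = H r := fun r hr =>
    (hle r).antisymm (hge (p.length + 1 - r) r (by omega))
  refine ⟨⟨hx, by rw [heq _ le_rfl, hbot], hne, fun r hr y hy => ?_⟩, heq⟩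
  rw [heq (r + 1) (by omega)]
  exact hstep r hr y (hle r hy)

namespace IsFlag

variable (h : IsFlag I p x)
include h

theorem along_zero : along I p x 0 = x := by
  rw [BoundQuiver.along_zero, h.src_smul]

theorem along_not_mem {r : ℕ} (hr : r ≤ p.length) : along I p x r ∉ radFilt I M (r + 1) := by
  intro hmem
  obtain ⟨q, hq, h₂⟩ := exists_smul_along (I := I) p x hr le_rfl
  have := smul_mem_radFilt q.path hmem (s := p.length + 1) (by omega)
  rw [h₂, h.bot, along_length] at this
  exact h.ne_zero this

theorem radFilt_eq_bot {r : ℕ} (hr : p.length < r) : radFilt I M r = ⊥ :=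
  eq_bot_iff.2 (h.bot ▸ radFilt_antitone hr)

/-- Modulo the next layer `y` is a nonzero multiple of the vector along `p`. Pushing `y` down the
path gives each lower basis vector up to deeper terms, which descending induction has already placed
in `N`. -/
theorem radFilt_le {N : Submodule (PathAlgebra K V ⧸ I) M} {r : ℕ} {y : M}
    (hyN : y ∈ N) (hy : y ∈ radFilt I M r) (hy' : y ∉ radFilt I M (r + 1)) :
    radFilt I M r ≤ N := by
  by_cases hr : r ≤ p.length
  swap
  · rw [h.radFilt_eq_bot (by omega)]; exact bot_le
  suffices ∀ d m, m + d = p.length + 1 → r ≤ m → radFilt I M m ≤ N from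
    this (p.length + 1 - r) r (by omega) le_rfl
  obtain ⟨c, hc⟩ := h.step r hr y hy
  have hc0 : c ≠ 0 := by
    rintro rfl
    rw [zero_smul, sub_zero] at hc
    exact hy' hc
  intro d
  induction d with
  | zero => intro m hm _; rw [h.radFilt_eq_bot (by omega)]; exact bot_le
  | succ d ih =>
    intro m hm hrm z hz
    have ih := ih (m + 1) (by omega) (by omega)
    obtain ⟨q, hq, hqm⟩ := exists_smul_along (I := I) p x hrm (by omega)
    have h₁ : pathElem I q.path • (y - c • along I p x r) ∈ N :=
      ih (smul_mem_radFilt _ hc (by omega))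
    rw [smul_sub, quotient_smul_comm, hqm] at h₁
    have h₂ : c • along I p x m ∈ N := by
      simpa using sub_mem (Submodule.smul_mem N (pathElem I q.path) hyN) h₁
    have h₃ : along I p x m ∈ N := by
      simpa [smul_smul, inv_mul_cancel₀ hc0] using Submodule.smul_of_tower_mem N c⁻¹ h₂
    obtain ⟨t, ht⟩ := h.step m (by omega) z hz
    simpa using add_mem (ih ht) (Submodule.smul_of_tower_mem N t h₃)

theorem exists_eq_radFilt (N : Submodule (PathAlgebra K V ⧸ I) M) :
    ∃ r ≤ p.length + 1, N = radFilt I M r := by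
  suffices ∀ d r, r + d = p.length + 1 → N ≤ radFilt I M r → ∃ r ≤ p.length + 1, N = radFilt I M r
    from this (p.length + 1) 0 (by omega) (by rw [radFilt_zero]; exact le_top)
  intro d
  induction d with
  | zero =>
    intro r hr hN
    rw [Nat.add_zero] at hr
    subst hr
    exact ⟨p.length + 1, le_rfl, by rw [h.bot] at hN ⊢; exact le_bot_iff.1 hN⟩
  | succ d ih =>
    intro r hr hN
    by_cases hN' : N ≤ radFilt I M (r + 1)
    · exact ih (r + 1) (by omega) hN'
    · obtain ⟨y, hy, hy'⟩ := SetLike.not_le_iff_exists.1 hN'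
      exact ⟨r, by omega, hN.antisymm (h.radFilt_le hy (hN hy) hy')⟩

theorem radFilt_lt {r s : ℕ} (hrs : r < s) (hr : r ≤ p.length) : radFilt I M s < radFilt I M r :=
  lt_of_le_of_ne (radFilt_antitone hrs.le) fun he =>
    h.along_not_mem hr (radFilt_antitone hrs (he.ge (along_mem (I := I) p x hr)))

theorem chain (N₁ N₂ : Submodule (PathAlgebra K V ⧸ I) M) : N₁ ≤ N₂ ∨ N₂ ≤ N₁ := by
  obtain ⟨r, -, rfl⟩ := h.exists_eq_radFilt N₁
  obtain ⟨s, -, rfl⟩ := h.exists_eq_radFilt N₂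
  exact (le_total s r).imp (fun h => radFilt_antitone h) fun h => radFilt_antitone h

/-- Every submodule is a layer, so the layers read upwards form a composition series. -/
theorem length_eq : Module.length (PathAlgebra K V ⧸ I) M = (p.length : ℕ∞) + 1 := by
  let s : CompositionSeries (Submodule (PathAlgebra K V ⧸ I) M) :=
    { length := p.length + 1
      toFun := fun i => radFilt I M (p.length + 1 - i)
      step := fun i => by
        have hi := i.2
        have e : p.length + 1 - (i.castSucc : ℕ) = p.length - i + 1 := by
          simp only [Fin.val_castSucc]; omega
        have e' : p.length + 1 - (i.succ : ℕ) = p.length - i := by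
          simp only [Fin.val_succ]; omega
        change radFilt I M _ ⋖ radFilt I M _
        rw [e, e']
        refine ⟨h.radFilt_lt (Nat.lt_succ_self _) (by omega), fun N h₁ h₂ => ?_⟩
        obtain ⟨r, -, rfl⟩ := h.exists_eq_radFilt N
        rcases Nat.lt_or_ge (p.length - i) r with hr | hr
        · exact (radFilt_antitone hr).not_gt h₁
        · exact (radFilt_antitone hr).not_gt h₂ }
  have := Module.length_compositionSeries s
    (by change radFilt I M _ = ⊥; simpa using h.bot)
    (by
      have e : p.length + 1 - (Fin.last s.length : ℕ) = 0 := Nat.sub_self _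
      change radFilt I M _ = ⊤
      rw [e, radFilt_zero])
  rw [← this]
  rfl

theorem isMastOf : IsMastOf I p M := by
  refine ⟨⟨⟨⟨_, 0, h.ne_zero⟩⟩, Module.length_ne_top_iff.1 ?_, h.chain⟩, h.length_eq,
    x, h.ne_zero⟩
  rw [h.length_eq]
  exact_mod_cast ENat.natCast_ne_top (p.length + 1)

end IsFlag

/-- Modulo the first layer `m` is a multiple of `x`, and `p` kills the first layer, so `p x ≠ 0`.
Hence no vector along `p` can lie deeper than its position, and uniseriality makes it span its
layer. -/
theorem isFlag_of_smul_ne_zero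
    (hM : ∀ N₁ N₂ : Submodule (PathAlgebra K V ⧸ I) M, N₁ ≤ N₂ ∨ N₂ ≤ N₁)
    (hbot : radFilt I M (p.length + 1) = ⊥) (hx : x ∉ radFilt I M 1) {e : V}
    (he : pathElem I (Path.nil : Path e e) • x = x) {m : M} (hm : pathElem I p • m ≠ 0) :
    IsFlag I p x := by
  obtain ⟨c, hc⟩ := exists_sub_smul_mem hM (r := 0) (y := m) (by rw [radFilt_zero]; trivial)
    (by simpa using hx) he (by rw [radFilt_zero]; trivial)
  have hpx : pathElem I p • x ≠ 0 := by
    intro h0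
    have := smul_mem_radFilt p hc (s := p.length + 1) (by omega)
    rw [hbot, Submodule.mem_bot, smul_sub, quotient_smul_comm, h0, smul_zero, sub_zero] at this
    exact hm this
  have hea : e = a := by
    by_contra hne
    rw [← he, pathElem_smul_smul_of_ne _ _ hne] at hpx
    exact hpx rfl
  subst hea
  refine ⟨he, hbot, hpx, fun r hr y hy => ?_⟩
  refine exists_sub_smul_mem hM (along_mem p x hr) (fun hmem => ?_) (nil_smul_along p x r) hy
  obtain ⟨q, hq, h₂⟩ := exists_smul_along (I := I) p x hr le_rfl
  have := smul_mem_radFilt q.path hmem (s := p.length + 1) (by omega)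
  rw [h₂, hbot, along_length] at this
  exact hpx this

/-- The mast is a path of maximal length among those acting nontrivially on the module. -/
theorem exists_isFlag (hM : IsUniserial (PathAlgebra K V ⧸ I) M) {n : ℕ}
    (hn : radFilt I M n = ⊥) : ∃ (a b : V) (p : Path a b) (x : M), IsFlag I p x := by
  classical
  have hnt := hM.1
  have hex : ∃ n, radFilt I M n = ⊥ := ⟨n, hn⟩
  have hl := Nat.find_spec hex
  obtain ⟨l, hl'⟩ : ∃ l, Nat.find hex = l + 1 := Nat.exists_eq_succ_of_ne_zero fun h0 => by
    rw [h0, radFilt_zero] at hl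
    exact top_ne_bot hl
  have hmin : radFilt I M l ≠ ⊥ := Nat.find_min hex (by omega)
  rw [hl'] at hl
  obtain ⟨⟨a, b, p⟩, m, hp, hpm⟩ : ∃ (q : AnyPath V) (m : M), l ≤ q.path.length ∧
      pathElem I q.path • m ≠ 0 := by
    by_contra! hall
    refine hmin (eq_bot_iff.2 (Submodule.span_le.2 ?_))
    rintro _ ⟨q, m, hq, rfl⟩
    exact hall q m hq
  have hpl : p.length = l := by
    refine le_antisymm (Nat.le_of_not_lt fun hlt => hpm ?_) hp
    have := pathElem_smul_mem (I := I) p m (r := l + 1) hlt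
    rw [hl] at this
    exact this
  rw [← hpl] at hl
  have hpe : pathElem I p • pathElem I (Path.nil : Path a a) • m ≠ 0 := by
    rw [pathElem_smul_smul, Path.nil_comp]; exact hpm
  refine ⟨a, b, p, _, isFlag_of_smul_ne_zero hM.2.2 hl (fun hmem => hpe ?_)
    (e := a) (x := pathElem I (Path.nil : Path a a) • m) (by rw [pathElem_smul_smul]; rfl) hpm⟩
  have := smul_mem_radFilt p hmem (s := p.length + 1) (by omega)
  rwa [hl] at this

/-- An element outside the first layer generates a mast of a module which has that mast. -/
theorem IsMastOf.isFlag (hM : IsMastOf I p M) {n : ℕ} (hn : radFilt I M n = ⊥)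
    (hx : x ∉ radFilt I M 1) {e : V} (he : pathElem I (Path.nil : Path e e) • x = x) :
    IsFlag I p x := by
  obtain ⟨a', b', p', x', h'⟩ := exists_isFlag hM.1 hn
  have hlen : p'.length = p.length := by
    have h₁ : ((p'.length + 1 : ℕ) : ℕ∞) = ((p.length + 1 : ℕ) : ℕ∞) := by
      exact_mod_cast h'.length_eq.symm.trans hM.2.1
    exact Nat.succ_injective (Nat.cast_injective h₁)
  obtain ⟨m, hm⟩ := hM.2.2
  exact isFlag_of_smul_ne_zero hM.1.2.2 (hlen ▸ h'.bot) hx he hm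

end Flag

/-! ### Comparison with the Jacobson radical. -/

section Jacobson

variable {K : Type u} {V : Type v} [Field K] [Quiver.{w} V] [Fintype V]
variable {I : Ideal (PathAlgebra K V)} [I.IsTwoSided]

theorem radFilt_eq_bot_of_pathElem {n : ℕ}
    (hn : ∀ {a b : V} (p : Path a b), n ≤ p.length → pathElem I p = 0)
    (M : Type*) [AddCommGroup M] [Module (PathAlgebra K V ⧸ I) M] : radFilt I M n = ⊥ := by
  refine eq_bot_iff.2 (Submodule.span_le.2 ?_)
  rintro _ ⟨q, m, hq, rfl⟩
  rw [hn q.path hq, zero_smul]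
  exact zero_mem _

theorem IsAdmissible.exists_pathElem_eq_zero (hI : IsAdmissible I) :
    ∃ n : ℕ, ∀ {a b : V} (p : Path a b), n ≤ p.length → pathElem I p = 0 := by
  obtain ⟨n, -, hn⟩ := hI.1
  exact ⟨n, fun p hp => Ideal.Quotient.eq_zero_iff_mem.2 (hn ⟨_, _, p⟩ hp)⟩

/-- On a simple module the first layer is zero or everything; if it were everything, so would be all
later layers, contradicting that long paths vanish. -/
theorem pathElem_mem_jacobson (hI : IsAdmissible I) {a b : V} (q : Path a b) (hq : 1 ≤ q.length) :
    pathElem I q ∈ Ring.jacobson (PathAlgebra K V ⧸ I) := by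
  obtain ⟨n, hn⟩ := hI.exists_pathElem_eq_zero
  rw [Ring.jacobson_eq_sInf_isMaximal, Submodule.mem_sInf]
  intro m hm
  have hm' : Ideal.IsMaximal m := hm
  have : IsSimpleModule (PathAlgebra K V ⧸ I) ((PathAlgebra K V ⧸ I) ⧸ m) :=
    isSimpleModule_iff_isCoatom.2 hm'.out
  rcases eq_bot_or_eq_top (radFilt I ((PathAlgebra K V ⧸ I) ⧸ m) 1) with h | h
  · have := pathElem_smul_mem (I := I) q (Submodule.Quotient.mk (p := m) 1) hq
    rw [h, Submodule.mem_bot, ← Submodule.Quotient.mk_smul, smul_eq_mul, mul_one] at this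
    exact (Submodule.Quotient.mk_eq_zero m).1 this
  · exfalso
    have htop : ∀ r, radFilt I ((PathAlgebra K V ⧸ I) ⧸ m) r = ⊤ := by
      intro r
      induction r with
      | zero => exact radFilt_zero
      | succ r ih =>
        rw [eq_top_iff, ← h]
        refine Submodule.span_le.2 ?_
        rintro _ ⟨q, y, hq, rfl⟩
        exact smul_mem_radFilt (r := r) q.path (by rw [ih]; trivial) (by omega)
    have := htop n
    rw [radFilt_eq_bot_of_pathElem hn] at this
    exact bot_ne_top this

theorem pathElem_mem_jacobson_pow (hI : IsAdmissible I) {a b : V} (q : Path a b)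
    (hq : q.length ≠ 0) : pathElem I q ∈ Ring.jacobson (PathAlgebra K V ⧸ I) ^ q.length := by
  induction q with
  | nil => exact absurd rfl hq
  | cons q α ih =>
    by_cases h0 : q.length = 0
    · rw [Path.length_cons, h0, Submodule.pow_one]
      exact pathElem_mem_jacobson hI _ (by simp)
    · have : pathElem I (q.cons α) = pathElem I α.toPath * pathElem I q := by
        rw [pathElem_mul]; rfl
      rw [this, Path.length_cons, Submodule.pow_succ' _ h0]
      exact Submodule.mul_mem_mul (pathElem_mem_jacobson hI _ (by simp)) (ih h0)

theorem pathElem_eq_zero_of_le (hI : IsAdmissible I) {n : ℕ} (hn : n ≠ 0)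
    (hJ : Ring.jacobson (PathAlgebra K V ⧸ I) ^ n = ⊥) {a b : V} (q : Path a b)
    (hq : n ≤ q.length) : pathElem I q = 0 := by
  obtain ⟨c, u, v, rfl, rfl, -⟩ := exists_split q hq
  have := pathElem_mem_jacobson_pow hI u hn
  rw [hJ, Submodule.mem_bot] at this
  rw [← pathElem_mul, this, mul_zero]

variable {M : Type*} [AddCommGroup M] [Module (PathAlgebra K V ⧸ I) M] [Module K M]
  [IsScalarTower K (PathAlgebra K V ⧸ I) M]

theorem smul_sub_sum_mem (hI : IsAdmissible I) (f : PathAlgebra K V ⧸ I) {r : ℕ} {y : M}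
    (hy : y ∈ radFilt I M r) :
    f • y - ∑ e : V, vertexChar hI e f • pathElem I (Path.nil : Path e e) • y ∈
      radFilt I M (r + 1) := by
  classical
  induction f using quotient_induction with
  | zero => simp
  | add f g hf hg =>
    convert add_mem hf hg using 1
    simp only [map_add, add_smul, Finset.sum_add_distrib]
    abel
  | smul c f hf =>
    convert Submodule.smul_of_tower_mem _ c hf using 1
    have : ∀ e, vertexChar hI e (c • f) = c * vertexChar hI e f := fun e =>
      lowCoeff_smul hI (by simp) c f
    simp only [this, smul_sub, smul_assoc, mul_smul, Finset.smul_sum]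
  | @path a b p =>
    have hc : ∀ e, vertexChar hI e (pathElem I p) = if ⟨a, b, p⟩ = (⟨e, e, .nil⟩ : AnyPath V)
        then 1 else 0 := fun e => by
      rw [← lowCoeff_pathElem (I := I) hI (by simp)]; rfl
    simp only [hc]
    cases p with
    | nil =>
      rw [Finset.sum_eq_single a]
      · rw [if_pos rfl, one_smul, sub_self]; exact zero_mem _
      · intro e _ he
        rw [if_neg (fun h => he (congrArg AnyPath.src h).symm), zero_smul]
      · simp
    | cons p α =>
      rw [Finset.sum_eq_zero, sub_zero]
      · exact smul_mem_radFilt _ hy (by simp)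
      · intro e _
        rw [if_neg, zero_smul]
        intro h
        have := (AnyPath.eq_nil_iff.1 h).2
        simp at this

/-- The kernel of each vertex character is maximal and so contains the radical; an element killed by
all characters moves every vector into the first layer. Conversely, paths of positive length lie in
the radical. -/
theorem jacobson_smul_top (hI : IsAdmissible I) :
    Ring.jacobson (PathAlgebra K V ⧸ I) • (⊤ : Submodule (PathAlgebra K V ⧸ I) M) =
      radFilt I M 1 := by
  refine le_antisymm (Submodule.smul_le.2 fun f hf y _ => ?_) (Submodule.span_le.2 ?_)
  · have hχ : ∀ e, vertexChar hI e f = 0 := fun e => by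
      have hsurj : Function.Surjective (vertexChar hI e) := fun c => by
        refine ⟨c • 1, ?_⟩
        have := lowCoeff_smul hI (x := ⟨e, e, .nil⟩) (by simp) c 1
        change lowCoeff I _ _ = _
        rw [this, show lowCoeff I ⟨e, e, .nil⟩ 1 = 1 from map_one (vertexChar hI e), mul_one]
      have := RingHom.ker_isMaximal_of_surjective _ hsurj
      exact Ring.jacobson_le_of_isMaximal (RingHom.ker (vertexChar hI e)) hf
    have := smul_sub_sum_mem hI f (r := 0) (y := y) (by rw [radFilt_zero]; trivial)
    simpa [hχ] using this
  · rintro _ ⟨q, m, hq, rfl⟩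
    exact Submodule.smul_mem_smul (pathElem_mem_jacobson hI _ hq) trivial

theorem isTopElement_iff (hI : IsAdmissible I) {x : M} :
    IsTopElement I M x ↔ x ∉ radFilt I M 1 ∧ ∃ e : V, pathElem I (Path.nil : Path e e) • x = x := by
  rw [IsTopElement, jacobson_smul_top hI]

theorem IsFlag.isTopElement (hI : IsAdmissible I) {a b : V} {p : Path a b} {x : M}
    (h : IsFlag I p x) : IsTopElement I M x := by
  refine (isTopElement_iff hI).2 ⟨?_, a, h.src_smul⟩
  have := h.along_not_mem (Nat.zero_le _)
  rwa [h.along_zero] at this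

theorem IsMastOf.isFlag_of_isTopElement (hI : IsAdmissible I) {a b : V} {p : Path a b} {x : M}
    (hM : IsMastOf I p M) (hx : IsTopElement I M x) : IsFlag I p x := by
  obtain ⟨n, hn⟩ := hI.exists_pathElem_eq_zero
  obtain ⟨h₁, e, he⟩ := (isTopElement_iff hI).1 hx
  exact hM.isFlag (radFilt_eq_bot_of_pathElem hn M) h₁ he

theorem IsMastOf.exists_isFlag (hI : IsAdmissible I) {a b : V} {p : Path a b}
    (hM : IsMastOf I p M) : ∃ x : M, IsFlag I p x := by
  obtain ⟨n, hn⟩ := hI.exists_pathElem_eq_zero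
  have hbot := radFilt_eq_bot_of_pathElem hn M
  obtain ⟨a', b', p', x, h⟩ := BoundQuiver.exists_isFlag hM.1 hbot
  exact ⟨x, hM.isFlag_of_isTopElement hI (h.isTopElement hI)⟩

end Jacobson

/-! ### Segments of masts are masts. -/

section Segments

variable {K : Type u} {V : Type v} [Field K] [Quiver.{w} V] [Fintype V]
variable {I : Ideal (PathAlgebra K V)} [I.IsTwoSided]
variable {M : Type*} [AddCommGroup M] [Module (PathAlgebra K V ⧸ I) M] [Module K M]
  [IsScalarTower K (PathAlgebra K V ⧸ I) M]

/-- Factoring out the layer below the end of `u` truncates the mast to `u`; dually,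
`IsFlag.submodule` keeps only the part `v`. -/
theorem IsFlag.quotient {a b c : V} {u : Path a c} {v : Path c b} {x : M}
    (h : IsFlag I (u.comp v) x) :
    IsFlag I u (Submodule.Quotient.mk (p := radFilt I M (u.length + 1)) x) := by
  have hmk : ∀ y, (Submodule.Quotient.mk y : M ⧸ radFilt I M (u.length + 1)) =
    (radFilt I M (u.length + 1)).mkQ y := fun _ => rfl
  have hal : ∀ r ≤ u.length, along I u (Submodule.Quotient.mk x : M ⧸ radFilt I M (u.length + 1)) r
      = Submodule.Quotient.mk (along I (u.comp v) x r) := fun r hr => by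
    rw [along, along, initSeg_comp _ _ hr, Submodule.Quotient.mk_smul]
  refine (isFlag_of_filtration (fun r => (radFilt I M r).map (radFilt I M (u.length + 1)).mkQ)
    (fun r s hrs => Submodule.map_mono (radFilt_antitone hrs)) ?_ ?_ ?_ ?_ ?_ ?_).1
  · rw [radFilt_zero, Submodule.map_top, Submodule.range_mkQ]
  · rw [Submodule.mkQ_map_self]
  · rintro c d α r _ ⟨y, hy, rfl⟩
    exact ⟨_, smul_mem_radFilt α.toPath hy (by simp), by rw [map_smul]⟩
  · rintro r hr _ ⟨y, hy, rfl⟩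
    obtain ⟨c, hc⟩ := h.step r (by rw [Path.length_comp]; omega) y hy
    refine ⟨c, _, hc, ?_⟩
    rw [hal r hr, map_sub]
    rfl
  · rw [← Submodule.Quotient.mk_smul, h.src_smul]
  · rw [← Submodule.Quotient.mk_smul, Ne, Submodule.Quotient.mk_eq_zero]
    have := h.along_not_mem (r := u.length) (by simp)
    rwa [along, initSeg_comp_length] at this

theorem IsFlag.submodule {a b c : V} {u : Path a c} {v : Path c b} {x : M}
    (h : IsFlag I (u.comp v) x) :
    IsFlag I v (⟨pathElem I u • x, pathElem_smul_mem _ _ le_rfl⟩ : radFilt I M u.length) := by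
  have hal : ∀ r ≤ v.length, ((along I v (⟨pathElem I u • x, pathElem_smul_mem _ _ le_rfl⟩ :
      radFilt I M u.length) r : radFilt I M u.length) : M) =
      along I (u.comp v) x (u.length + r) := fun r hr => by
    obtain ⟨d, v₁, v₂, rfl, rfl, hs⟩ := exists_split v hr
    rw [along, along, hs, ← Path.length_comp, ← Path.comp_assoc, initSeg_comp_length]
    change pathElem I v₁ • pathElem I u • x = _
    rw [pathElem_smul_smul]
  refine (isFlag_of_filtration
    (fun r => (radFilt I M (u.length + r)).comap (radFilt I M u.length).subtype)
    (fun r s hrs => Submodule.comap_mono (radFilt_antitone (by omega))) ?_ ?_ ?_ ?_ ?_ ?_).1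
  · rw [Nat.add_zero, Submodule.comap_subtype_self]
  · rw [h.radFilt_eq_bot (r := u.length + (v.length + 1)) (by rw [Path.length_comp]; omega),
      Submodule.comap_bot,
      Submodule.ker_subtype]
  · rintro c d α r ⟨y, hy'⟩ hy
    exact smul_mem_radFilt α.toPath (y := y) hy (by simp; omega)
  · rintro r hr ⟨y, hy'⟩ hy
    obtain ⟨c, hc⟩ := h.step (u.length + r) (by rw [Path.length_comp]; omega) y hy
    refine ⟨c, ?_⟩
    rw [← hal r hr] at hc
    exact hc
  · refine Subtype.ext ?_
    change pathElem I _ • pathElem I u • x = pathElem I u • x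
    rw [pathElem_smul_smul]; rfl
  · intro h0
    have := congrArg Subtype.val h0
    change pathElem I v • pathElem I u • x = 0 at this
    rw [pathElem_smul_smul] at this
    exact h.ne_zero this

end Segments

section ModuleCat

variable {K : Type u} {V : Type v} [Field K] [Quiver.{w} V] [Fintype V]
variable {I : Ideal (PathAlgebra K V)} [I.IsTwoSided]

attribute [local instance] ModuleCat.moduleOfAlgebraModule ModuleCat.isScalarTower_of_algebra_moduleCat

theorem IsMast.of_isFlag {M : Type (max u v w)} [AddCommGroup M] [Module (PathAlgebra K V ⧸ I) M]
    [Module K M] [IsScalarTower K (PathAlgebra K V ⧸ I) M] {a b : V} {p : Path a b} {x : M}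
    (h : IsFlag I p x) : IsMast I p :=
  ⟨ModuleCat.of _ M, h.isMastOf⟩

theorem IsMast.exists_isFlag (hI : IsAdmissible I) {a b : V} {p : Path a b} (h : IsMast I p) :
    ∃ (M : ModuleCat.{max u v w} (PathAlgebra K V ⧸ I)) (x : M), IsFlag I p x := by
  obtain ⟨M, hM⟩ := h
  exact ⟨M, hM.exists_isFlag hI⟩

theorem IsMast.comp_left (hI : IsAdmissible I) {a b c : V} {u : Path a c} {v : Path c b}
    (h : IsMast I (u.comp v)) : IsMast I u := by
  obtain ⟨M, x, h⟩ := h.exists_isFlag hI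
  exact IsMast.of_isFlag h.quotient

theorem IsMast.comp_right (hI : IsAdmissible I) {a b c : V} {u : Path a c} {v : Path c b}
    (h : IsMast I (u.comp v)) : IsMast I v := by
  obtain ⟨M, x, h⟩ := h.exists_isFlag hI
  exact IsMast.of_isFlag h.submodule

end ModuleCat

section Segments

variable {K : Type u} {V : Type v} [Field K] [Quiver.{w} V] [Fintype V]
variable {I : Ideal (PathAlgebra K V)} [I.IsTwoSided]

theorem IsMast.exists_segment (hI : IsAdmissible I) {a b : V} {p : Path a b} (h : IsMast I p)
    {i m : ℕ} (him : i ≤ m) (hm : m ≤ p.length) :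
    ∃ (c d : V) (q : Path c d), IsMast I q ∧ c = vtx p i ∧ d = vtx p m ∧ q.length = m - i ∧
      ∀ r < m - i, arrowAt q r = arrowAt p (i + r) := by
  obtain ⟨c, d, u, q, z, rfl, hu, hq, h₁, h₂⟩ := exists_split_three p him hm
  refine ⟨c, d, q, (h.comp_left hI).comp_right hI, by rw [vtx, h₁], by rw [vtx, h₂], hq, ?_⟩
  intro r hr
  rw [arrowAt_comp_left _ _ (by rw [Path.length_comp]; omega), ← hu,
    arrowAt_comp_right _ _ (by omega)]

/-- This is (N) for the segment of `p` between the positions `i` and `m`, which is itself a mast. -/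
theorem ConditionN.arrowAt_eq (hI : IsAdmissible I) (hN : ConditionN I) {a b : V} {p : Path a b}
    (hp : IsMast I p) {i m : ℕ} (him : i < m) (hm : m ≤ p.length) {c d : V} (β : c ⟶ d)
    (hs : c = vtx p i) (ht : d = vtx p m) :
    arrowAt p i = ⟨c, d, β.toPath⟩ ∨ arrowAt p (m - 1) = ⟨c, d, β.toPath⟩ := by
  obtain ⟨c', d', q, hq, hc, hd, hl, hA⟩ := hp.exists_segment hI him.le hm
  obtain rfl : c = c' := hs.trans hc.symm
  obtain rfl : d = d' := ht.trans hd.symm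
  rcases hN c d β q (by omega) hq with ⟨c', rfl⟩ | ⟨c', rfl⟩
  · left
    rw [← Nat.add_zero i, ← hA 0 (by omega), arrowAt_zero_toPath_comp]
  · right
    rw [Path.length_cons] at hl
    have := hA c'.length (by omega)
    rw [arrowAt_cons] at this
    rw [this]
    congr 1
    omega

end Segments

/-! ### The basis along a mast and its coordinates. -/

section Basis

variable {K : Type u} {V : Type v} [Field K] [Quiver.{w} V] [Fintype V]
variable {I : Ideal (PathAlgebra K V)} [I.IsTwoSided]
variable {M : Type*} [AddCommGroup M] [Module (PathAlgebra K V ⧸ I) M] [Module K M]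
  [IsScalarTower K (PathAlgebra K V ⧸ I) M] {a b : V} {p : Path a b} {x : M}

namespace IsFlag

variable (h : IsFlag I p x)
include h

theorem eq_zero_of_smul_along_mem {r : ℕ} (hr : r ≤ p.length) {c : K}
    (hc : c • along I p x r ∈ radFilt I M (r + 1)) : c = 0 := by
  by_contra hc0
  refine h.along_not_mem hr ?_
  simpa [smul_smul, inv_mul_cancel₀ hc0] using Submodule.smul_of_tower_mem _ c⁻¹ hc

theorem linearIndependent :
    LinearIndependent K (fun i : Fin (p.length + 1) => along I p x i) := by
  rw [Fintype.linearIndependent_iff]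
  intro g hg
  suffices ∀ n, ∀ i : Fin (p.length + 1), i.1 = n → g i = 0 from fun i => this i i rfl
  intro n
  induction n using Nat.strong_induction_on with
  | _ n ih =>
    rintro i rfl
    refine h.eq_zero_of_smul_along_mem (Nat.lt_succ_iff.1 i.2) ?_
    rw [← Finset.add_sum_erase _ _ (Finset.mem_univ i)] at hg
    rw [eq_neg_of_add_eq_zero_left hg]
    refine neg_mem (Submodule.sum_mem _ fun j hj => ?_)
    rcases lt_or_ge j.1 i.1 with hji | hji
    · rw [ih j hji j rfl, zero_smul]; exact zero_mem _
    · have hne : j.1 ≠ i.1 := fun e => (Finset.ne_of_mem_erase hj) (Fin.ext e)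
      exact Submodule.smul_of_tower_mem _ _ (radFilt_antitone (show i.1 + 1 ≤ j.1 by omega)
        (along_mem p x (Nat.lt_succ_iff.1 j.2)))

theorem radFilt_le_span {d r : ℕ} (hd : r + d = p.length + 1) {y : M} (hy : y ∈ radFilt I M r) :
    y ∈ Submodule.span K (Set.range fun i : Fin (p.length + 1) => along I p x i) := by
  induction d generalizing r y with
  | zero =>
    rw [h.radFilt_eq_bot (by omega), Submodule.mem_bot] at hy
    rw [hy]; exact zero_mem _
  | succ d ih =>
    obtain ⟨c, hc⟩ := h.step r (by omega) y hy
    have h₁ := ih (r := r + 1) (by omega) hc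
    have h₂ : along I p x r ∈
        Submodule.span K (Set.range fun i : Fin (p.length + 1) => along I p x i) :=
      Submodule.subset_span ⟨⟨r, by omega⟩, rfl⟩
    simpa using add_mem h₁ (Submodule.smul_mem _ c h₂)

/-- The basis consisting of the images of `x` under the initial segments of the mast. -/
def basis : Module.Basis (Fin (p.length + 1)) K M :=
  Module.Basis.mk h.linearIndependent fun _ _ =>
    h.radFilt_le_span (Nat.zero_add _) (by rw [radFilt_zero]; trivial)

theorem basis_apply (i : Fin (p.length + 1)) : h.basis i = along I p x i := by
  rw [basis, Module.Basis.mk_apply]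

/-- The coordinate number `r` with respect to the basis along the mast. -/
def coord (r : ℕ) : M →ₗ[K] K :=
  if hr : r < p.length + 1 then h.basis.coord ⟨r, hr⟩ else 0

theorem coord_along {r s : ℕ} (hs : s ≤ p.length) :
    h.coord r (along I p x s) = if s = r then 1 else 0 := by
  rw [coord]
  split_ifs with h₁ h₂ h₂
  · subst h₂
    rw [← h.basis_apply ⟨s, h₁⟩, Module.Basis.coord_apply, Module.Basis.repr_self,
      Finsupp.single_eq_same]
  · rw [← h.basis_apply ⟨s, by omega⟩, Module.Basis.coord_apply, Module.Basis.repr_self,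
      Finsupp.single_apply, if_neg (by simpa using h₂)]
  · omega
  · rfl

theorem sum_coord (y : M) :
    ∑ r ∈ Finset.range (p.length + 1), h.coord r y • along I p x r = y := by
  rw [Finset.sum_range]
  conv_rhs => rw [← h.basis.sum_repr y]
  refine Finset.sum_congr rfl fun i _ => ?_
  rw [coord, dif_pos i.2, h.basis_apply]
  rfl

theorem coord_eq_zero {r i : ℕ} (hi : i < r) {y : M} (hy : y ∈ radFilt I M r) :
    h.coord i y = 0 := by
  by_cases hr : r ≤ p.length
  swap
  · rw [h.radFilt_eq_bot (by omega), Submodule.mem_bot] at hy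
    rw [hy, map_zero]
  obtain ⟨d, hd⟩ : ∃ d, r + d = p.length + 1 := ⟨p.length + 1 - r, by omega⟩
  clear hr
  induction d generalizing r y with
  | zero =>
    rw [h.radFilt_eq_bot (by omega), Submodule.mem_bot] at hy
    rw [hy, map_zero]
  | succ d ih =>
    obtain ⟨c, hc⟩ := h.step r (by omega) y hy
    have := ih (r := r + 1) (by omega) hc (by omega)
    rw [map_sub, map_smul, h.coord_along (by omega), if_neg (by omega), smul_zero,
      sub_zero] at this
    exact this

theorem mem_radFilt_iff {r : ℕ} {y : M} : y ∈ radFilt I M r ↔ ∀ i < r, h.coord i y = 0 := by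
  refine ⟨fun hy i hi => h.coord_eq_zero hi hy, fun hy => ?_⟩
  rw [← h.sum_coord y]
  refine Submodule.sum_mem _ fun i hi => ?_
  by_cases hir : i < r
  · rw [hy i hir, zero_smul]; exact zero_mem _
  · exact Submodule.smul_of_tower_mem _ _
      (radFilt_antitone (not_lt.1 hir) (along_mem p x (by simpa [Nat.lt_succ_iff] using hi)))

open Classical in
theorem coord_nil_smul (e : V) (r : ℕ) (y : M) :
    h.coord r (pathElem I (Path.nil : Path e e) • y) =
      if vtx p r = e then h.coord r y else 0 := by
  have hlin : ∀ z : M, pathElem I (Path.nil : Path e e) • z =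
      ∑ i ∈ Finset.range (p.length + 1),
        h.coord i z • pathElem I (Path.nil : Path e e) • along I p x i := fun z => by
    conv_lhs => rw [← h.sum_coord z, Finset.smul_sum]
    exact Finset.sum_congr rfl fun i _ => quotient_smul_comm _ _ _
  by_cases hr : r ≤ p.length
  · rw [hlin, map_sum, Finset.sum_eq_single r]
    · split_ifs with hv
      · subst hv
        rw [nil_smul_along, map_smul, h.coord_along hr, if_pos rfl, smul_eq_mul, mul_one]
      · rw [smul_along_of_ne _ _ _ hv, smul_zero, map_zero]
    · intro i hi hir
      have hi' : i ≤ p.length := by simpa [Nat.lt_succ_iff] using hi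
      by_cases hv : vtx p i = e
      · subst hv
        rw [nil_smul_along, map_smul, h.coord_along hi', if_neg hir, smul_zero]
      · rw [smul_along_of_ne _ _ _ hv, smul_zero, map_zero]
    · intro hr'; simp at hr'; omega
  · have : ∀ z, h.coord r z = 0 := fun z => by
      rw [coord, dif_neg (by omega)]; rfl
    rw [this, this, ite_self]

theorem coord_eq_zero_of_vtx_ne {e : V} {y : M}
    (hy : pathElem I (Path.nil : Path e e) • y = y) {r : ℕ} (hr : vtx p r ≠ e) :
    h.coord r y = 0 := by
  rw [← hy, h.coord_nil_smul, if_neg hr]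

end IsFlag

theorem map_mem_radFilt {M' : Type*} [AddCommGroup M'] [Module (PathAlgebra K V ⧸ I) M']
    (φ : M →ₗ[PathAlgebra K V ⧸ I] M') {r : ℕ} {y : M} (hy : y ∈ radFilt I M r) :
    φ y ∈ radFilt I M' r := by
  suffices radFilt I M r ≤ (radFilt I M' r).comap φ from this hy
  refine Submodule.span_le.2 ?_
  rintro _ ⟨q, m, hq, rfl⟩
  change φ _ ∈ radFilt I M' r
  rw [map_smul]
  exact pathElem_smul_mem _ _ hq

theorem IsFlag.map_equiv {M' : Type*} [AddCommGroup M'] [Module (PathAlgebra K V ⧸ I) M']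
    [Module K M'] [IsScalarTower K (PathAlgebra K V ⧸ I) M'] (h : IsFlag I p x)
    (φ : M ≃ₗ[PathAlgebra K V ⧸ I] M') : IsFlag I p (φ x) := by
  have hal : ∀ r, along I p (φ x) r = φ (along I p x r) := fun r => by
    rw [along, along, map_smul]
  refine ⟨by rw [← map_smul, h.src_smul], eq_bot_iff.2 fun y hy => ?_, ?_, fun r hr y hy => ?_⟩
  · have := map_mem_radFilt φ.symm.toLinearMap hy
    rw [h.bot, Submodule.mem_bot] at this
    simpa using this
  · rw [← map_smul]
    exact fun h0 => h.ne_zero (φ.map_eq_zero_iff.1 h0)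
  · obtain ⟨c, hc⟩ := h.step r hr _ (map_mem_radFilt φ.symm.toLinearMap hy)
    refine ⟨c, ?_⟩
    have := map_mem_radFilt φ.toLinearMap hc
    have e : φ (c • along I p x r) = c • φ (along I p x r) :=
      (φ.toLinearMap.restrictScalars K).map_smul c _
    rw [hal, ← e]
    simpa using this

end Basis

/-! ### Deforming a module by a crossed derivation. -/

section Twist

variable {K : Type u} {V : Type v} [Field K] [Quiver.{w} V] [Fintype V]
variable {I : Ideal (PathAlgebra K V)} [I.IsTwoSided]

attribute [local instance] ModuleCat.moduleOfAlgebraModule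
  ModuleCat.isScalarTower_of_algebra_moduleCat

variable {M : Type (max u v w)} [AddCommGroup M] [Module (PathAlgebra K V ⧸ I) M]
    [Module K M] [IsScalarTower K (PathAlgebra K V ⧸ I) M]

/-- A crossed derivation `D` of square zero, which is compatible with the radical filtration,
deforms the module structure of `M` along a line. -/
theorem IsFlag.exists_twist {a b : V} {p : Path a b} {x : M} (h : IsFlag I p x)
    (D : (PathAlgebra K V ⧸ I) →ₗ[K] M →ₗ[K] M)
    (hmul : ∀ f g y, D (f * g) y = f • D g y + D f (g • y))
    (hsq : ∀ f g y, D f (D g y) = 0)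
    (hrad : ∀ f r, ∀ y ∈ radFilt I M r, D f y ∈ radFilt I M (r + 1))
    (hx : ∀ r ≤ p.length, D (pathElem I (initSeg p r).path) x = 0) (s : K) :
    ∃ (M' : ModuleCat.{max u v w} (PathAlgebra K V ⧸ I)) (ψ : M ≃ₗ[K] M'),
      (∀ f y, f • ψ y = ψ (f • y + s • D f y)) ∧ IsFlag I p (ψ x) ∧
      (∀ r ≤ p.length + 1, ∀ y, ψ y ∈ radFilt I M' r ↔ y ∈ radFilt I M r) := by
  have hone : D 1 = 0 := by
    ext y
    have := hmul 1 1 y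
    rw [mul_one, one_smul, one_smul] at this
    simpa using this
  -- In the product the term quadratic in `s` vanishes by `hsq`, and the linear terms match by
  -- `hmul`.
  let ρ : (PathAlgebra K V ⧸ I) →+* AddMonoid.End M :=
    { toFun := fun f => AddMonoidHom.mk' (fun y => f • y + s • D f y) fun y z => by
        rw [smul_add, map_add, smul_add]; abel
      map_one' := by
        ext y
        change (1 : PathAlgebra K V ⧸ I) • y + s • D 1 y = y
        rw [hone, one_smul, LinearMap.zero_apply, smul_zero, add_zero]
      map_mul' := fun f g => by
        ext y
        change (f * g) • y + s • D (f * g) y = f • (g • y + s • D g y) + s • D f (g • y + s • D g y)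
        rw [hmul, map_add, LinearMap.map_smul, hsq, smul_zero, add_zero, smul_add, smul_add, mul_smul,
          quotient_smul_comm, add_assoc]
      map_zero' := by
        ext y
        change (0 : PathAlgebra K V ⧸ I) • y + s • D 0 y = 0
        simp
      map_add' := fun f g => by
        ext y
        change (f + g) • y + s • D (f + g) y = (f • y + s • D f y) + (g • y + s • D g y)
        rw [map_add, LinearMap.add_apply, smul_add, add_smul]
        abel }
  -- The new structure is hidden behind `M'` and a bijection, so that two actions on `M` do not
  -- compete.
  let inst : Module (PathAlgebra K V ⧸ I) M := Module.compHom M ρ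
  obtain ⟨M', ψ₀, hψ₀⟩ : ∃ (M' : ModuleCat.{max u v w} (PathAlgebra K V ⧸ I)) (ψ : M ≃+ M'),
      ∀ (f : PathAlgebra K V ⧸ I) (y : M), f • ψ y = ψ (ρ f y) :=
    ⟨@ModuleCat.of _ _ M _ inst, AddEquiv.refl M, fun f y => rfl⟩
  clear inst
  have hψ₁ : ∀ f y, f • ψ₀ y = ψ₀ (f • y + s • D f y) := hψ₀
  have hK : ∀ (c : K) (y : M), ψ₀ (c • y) = c • ψ₀ y := fun c y => by
    have hc : D (c • (1 : PathAlgebra K V ⧸ I)) = 0 := by rw [LinearMap.map_smul, hone, smul_zero]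
    rw [← algebraMap_smul (PathAlgebra K V ⧸ I) c (ψ₀ y), hψ₁, Algebra.algebraMap_eq_smul_one,
      hc, LinearMap.zero_apply, smul_zero, add_zero, smul_assoc, one_smul]
  let ψ : M ≃ₗ[K] M' := { ψ₀ with map_smul' := hK }
  have hψ : ∀ f y, f • ψ y = ψ (f • y + s • D f y) := hψ₀
  -- The old filtration stays stable under the new action and is recognised as its radical
  -- filtration.
  let H : ℕ → Submodule (PathAlgebra K V ⧸ I) M' := fun r =>
    { carrier := {z | ψ.symm z ∈ radFilt I M r}
      zero_mem' := by
        change ψ.symm 0 ∈ radFilt I M r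
        rw [map_zero]; exact zero_mem _
      add_mem' := fun {y z} hy hz => by
        change ψ.symm (y + z) ∈ radFilt I M r
        rw [map_add]; exact add_mem hy hz
      smul_mem' := fun f y hy => by
        change ψ.symm (f • y) ∈ radFilt I M r
        obtain ⟨y, rfl⟩ := ψ.surjective y
        change ψ.symm (ψ y) ∈ radFilt I M r at hy
        rw [ψ.symm_apply_apply] at hy
        rw [hψ, ψ.symm_apply_apply]
        exact add_mem (Submodule.smul_mem _ _ hy) (Submodule.smul_of_tower_mem _ _
          (radFilt_antitone (Nat.le_succ r) (hrad f r y hy))) }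
  have hH : ∀ r y, ψ y ∈ H r ↔ y ∈ radFilt I M r := fun r y => by
    change ψ.symm (ψ y) ∈ radFilt I M r ↔ _
    rw [ψ.symm_apply_apply]
  have hal : ∀ r ≤ p.length, along I p (ψ x) r = ψ (along I p x r) := fun r hr => by
    rw [along, hψ, hx r hr, smul_zero, add_zero, along]
  have key := isFlag_of_filtration (p := p) (x := ψ x) H (fun r s hrs y hy => radFilt_antitone hrs hy)
    (by rw [eq_top_iff]; intro y _; change _ ∈ radFilt I M 0; rw [radFilt_zero]; trivial)
    (by
      rw [eq_bot_iff]
      intro y hy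
      change _ ∈ radFilt I M _ at hy
      rw [h.bot, Submodule.mem_bot] at hy
      simpa using hy)
    (fun {c d} α r y hy => by
      obtain ⟨y, rfl⟩ := ψ.surjective y
      rw [hH] at hy
      rw [hψ, hH]
      exact add_mem (smul_mem_radFilt _ hy (by simp))
        (Submodule.smul_of_tower_mem _ _ (hrad _ r y hy)))
    (fun r hr y hy => by
      obtain ⟨y, rfl⟩ := ψ.surjective y
      rw [hH] at hy
      obtain ⟨c, hc⟩ := h.step r hr y hy
      refine ⟨c, ?_⟩
      rw [hal r hr, ← map_smul, ← map_sub, hH]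
      exact hc)
    (by
      have := hal 0 (Nat.zero_le _)
      rwa [BoundQuiver.along_zero, BoundQuiver.along_zero, h.src_smul] at this)
    (by
      have := hal p.length le_rfl
      rw [along_length, along_length] at this
      rw [this]
      simpa using h.ne_zero)
  exact ⟨M', ψ, hψ, key.1, fun r hr y => by rw [key.2 r hr, hH]⟩

end Twist

/-! ### Necessity of condition (N). -/

section SocleTwist

variable {K : Type u} {V : Type v} [Field K] [Quiver.{w} V] [Fintype V]
variable {I : Ideal (PathAlgebra K V)} [I.IsTwoSided]

theorem initSeg_one {a b : V} (p : Path a b) (hp : 0 < p.length) :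
    initSeg p 1 = arrowAt p 0 := by
  obtain ⟨c, d, u, β, v, -, hu, -, h₁, h₂⟩ := exists_split_arrow p hp
  rw [h₁, h₂]
  cases u with
  | nil => rfl
  | cons => simp at hu

section

variable {M : Type*} [AddCommGroup M] [Module (PathAlgebra K V ⧸ I) M] [Module K M]
  [IsScalarTower K (PathAlgebra K V ⧸ I) M] {a b : V} {p : Path a b} {x : M}

theorem IsFlag.smul_along_length (hI : IsAdmissible I) (h : IsFlag I p x)
    (f : PathAlgebra K V ⧸ I) :
    f • along I p x p.length = vertexChar hI b f • along I p x p.length := by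
  have := smul_sub_sum_mem hI f (along_mem (I := I) p x le_rfl)
  rw [h.bot, Submodule.mem_bot, Finset.sum_eq_single b] at this
  · have hb := nil_smul_along (I := I) p x p.length
    rw [vtx_length] at hb
    rwa [hb, sub_eq_zero] at this
  · intro e _ he
    rw [smul_along_of_ne _ _ _ (by rw [vtx_length]; exact he.symm), smul_zero]
  · simp

theorem IsFlag.coord_zero_smul (hI : IsAdmissible I) (h : IsFlag I p x)
    (f : PathAlgebra K V ⧸ I) (y : M) :
    h.coord 0 (f • y) = vertexChar hI a f * h.coord 0 y := by
  classical
  have h₀ := smul_sub_sum_mem hI f (r := 0) (y := y) (by rw [radFilt_zero]; trivial)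
  have := h.coord_eq_zero Nat.zero_lt_one h₀
  rw [map_sub, sub_eq_zero, map_sum, Finset.sum_eq_single a] at this
  · rw [this, map_smul, h.coord_nil_smul, vtx_zero, if_pos rfl, smul_eq_mul]
  · intro e _ he
    rw [map_smul, h.coord_nil_smul, vtx_zero, if_neg he.symm, smul_zero]
  · simp

/-- The crossed derivation by which the arrow `α` is made to send the top `x` to the socle. -/
def IsFlag.socleDerivation (hI : IsAdmissible I) (h : IsFlag I p x) (α : a ⟶ b) :
    (PathAlgebra K V ⧸ I) →ₗ[K] M →ₗ[K] M where
  toFun f := lowCoeff I ⟨a, b, α.toPath⟩ f •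
    (h.coord 0).smulRight (along I p x p.length)
  map_add' f g := by rw [lowCoeff_add hI (by simp), add_smul]
  map_smul' c f := by rw [lowCoeff_smul hI (by simp), mul_smul]; rfl

theorem IsFlag.socleDerivation_apply (hI : IsAdmissible I) (h : IsFlag I p x) (α : a ⟶ b)
    (f : PathAlgebra K V ⧸ I) (y : M) :
    h.socleDerivation hI α f y =
      (lowCoeff I ⟨a, b, α.toPath⟩ f * h.coord 0 y) • along I p x p.length := by
  rw [mul_smul]; rfl

end

attribute [local instance] ModuleCat.moduleOfAlgebraModule
  ModuleCat.isScalarTower_of_algebra_moduleCat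

variable {M : Type (max u v w)} [AddCommGroup M] [Module (PathAlgebra K V ⧸ I) M]
    [Module K M] [IsScalarTower K (PathAlgebra K V ⧸ I) M]

/-- The algebra acts on the top through the character at `a` and on the socle through that at `b`,
so the Leibniz rule for the coefficient of `α` gives a crossed derivation. Its square is zero
because `p` has positive length, and `hα` keeps the vectors along `p` unchanged. -/
theorem IsFlag.exists_socle_twist (hI : IsAdmissible I) {a b : V} {p : Path a b} {x : M}
    (h : IsFlag I p x) (hp : 0 < p.length) (α : a ⟶ b) (hα : arrowAt p 0 ≠ ⟨a, b, α.toPath⟩)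
    (s : K) :
    ∃ (M' : ModuleCat.{max u v w} (PathAlgebra K V ⧸ I)) (ψ : M ≃ₗ[K] M'),
      (∀ f y, f • ψ y = ψ (f • y + s • h.socleDerivation hI α f y)) ∧ IsFlag I p (ψ x) ∧
      (∀ r ≤ p.length + 1, ∀ y, ψ y ∈ radFilt I M' r ↔ y ∈ radFilt I M r) := by
  refine h.exists_twist _ ?_ ?_ ?_ ?_ s
  · intro f g y
    simp only [h.socleDerivation_apply, quotient_smul_comm, h.smul_along_length hI,
      h.coord_zero_smul hI, lowCoeff_mul_arrow hI, smul_smul, ← add_smul]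
    congr 1
    change (_ * vertexChar hI a g + vertexChar hI b f * _) * _ = _
    ring
  · intro f g y
    rw [h.socleDerivation_apply, h.socleDerivation_apply, map_smul, h.coord_along le_rfl,
      if_neg (by omega), smul_zero, mul_zero, zero_smul]
  · intro f r y hy
    rw [h.socleDerivation_apply]
    rcases Nat.eq_zero_or_pos r with rfl | hr
    · exact Submodule.smul_of_tower_mem _ _
        (radFilt_antitone (by omega) (along_mem p x le_rfl))
    · rw [h.coord_eq_zero hr hy, mul_zero, zero_smul]; exact zero_mem _
  · intro r hr
    classical
    rw [h.socleDerivation_apply, lowCoeff_pathElem hI (by simp), if_neg, zero_mul, zero_smul]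
    intro he
    have hlen := length_initSeg p hr
    have he' : initSeg p r = ⟨a, b, α.toPath⟩ := he
    rw [he'] at hlen
    obtain rfl : 1 = r := hlen
    exact hα ((initSeg_one p hp).symm.trans he')

/-- A mast parallel to an arrow `α` with neither its first nor its last arrow equal to `α` leads to
infinitely many pairwise non-isomorphic uniserial modules, provided that the shorter masts parallel
to `α` do start or end with `α`. -/
theorem exists_ne_of_finite [Infinite K] (hI : IsAdmissible I) (hfin : FiniteUniserialType I)
    {a b : V} {p : Path a b} (hp : IsMast I p) (hpos : 0 < p.length) (α : a ⟶ b)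
    (h₀ : arrowAt p 0 ≠ ⟨a, b, α.toPath⟩) (h₁ : arrowAt p (p.length - 1) ≠ ⟨a, b, α.toPath⟩)
    (hfst : ∀ i, 1 ≤ i → i < p.length → vtx p i = a → arrowAt p i = ⟨a, b, α.toPath⟩)
    (hlst : ∀ m, 1 ≤ m → m < p.length → vtx p m = b → arrowAt p (m - 1) = ⟨a, b, α.toPath⟩) :
    False := by
  obtain ⟨M, x, h⟩ := hp.exists_isFlag hI
  choose N ψ hψ hflag hrad using h.exists_socle_twist hI hpos α h₀
  let F : K → uniserialClasses I := fun s =>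
    ⟨Quotient.mk _ (N s), N s, (hflag s).isMastOf.1, rfl⟩
  have : Finite (uniserialClasses I) := hfin
  obtain ⟨s, t, hst, hF⟩ := Finite.exists_ne_map_eq_of_infinite F
  obtain ⟨φ⟩ : Nonempty (N s ≅ N t) := Quotient.exact (congrArg Subtype.val hF)
  -- The isomorphism between the deformations at `s` and `t`, read on the common space `M`.
  let θ : M ≃ₗ[K] M := (ψ s).trans ((φ.toLinearEquiv.restrictScalars K).trans (ψ t).symm)
  let D := h.socleDerivation hI α
  have hψθ : ∀ y, ψ t (θ y) = φ.toLinearEquiv (ψ s y) := fun y => (ψ t).apply_symm_apply _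
  have hθ : ∀ f y, θ (f • y + s • D f y) = f • θ y + t • D f (θ y) := fun f y => by
    apply (ψ t).injective
    rw [hψθ, ← hψ, ← hψ, hψθ, map_smul]
  have hθrad : ∀ r ≤ p.length + 1, ∀ y ∈ radFilt I M r, θ y ∈ radFilt I M r := fun r hr y hy => by
    rw [← hrad t r hr, hψθ]
    exact map_mem_radFilt φ.toLinearEquiv.toLinearMap ((hrad s r hr y).2 hy)
  have hD0 : ∀ f, lowCoeff I ⟨a, b, α.toPath⟩ f = 0 → ∀ y, D f y = 0 := fun f hf y => by
    rw [h.socleDerivation_apply, hf, zero_mul, zero_smul]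
  classical
  have hDp : ∀ {c d : V} (q : Path c d), (⟨c, d, q⟩ : AnyPath V) ≠ ⟨a, b, α.toPath⟩ →
      ∀ y, D (pathElem I q) y = 0 := fun q hq y =>
    hD0 _ (by rw [lowCoeff_pathElem hI (by simp), if_neg hq]) y
  have hDα : ∀ y, D (pathElem I α.toPath) y = h.coord 0 y • along I p x p.length := fun y => by
    rw [h.socleDerivation_apply, lowCoeff_pathElem hI (by simp), if_pos rfl, one_mul]
  have hθq : ∀ {c d : V} (q : Path c d), (⟨c, d, q⟩ : AnyPath V) ≠ ⟨a, b, α.toPath⟩ →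
      ∀ y, θ (pathElem I q • y) = pathElem I q • θ y := fun q hq y => by
    have := hθ (pathElem I q) y
    rwa [hDp q hq, hDp q hq, smul_zero, smul_zero, add_zero, add_zero] at this
  have hnil : ∀ e : V, (⟨e, e, Path.nil⟩ : AnyPath V) ≠ ⟨a, b, α.toPath⟩ := fun e he => by
    have := congrArg (fun q : AnyPath V => q.path.length) he
    simp at this
  -- On the elements of the radical starting at `a`, the arrow `α` does not reach the socle.
  have key : ∀ y ∈ radFilt I M 1, pathElem I (Path.nil : Path a a) • y = y →
      h.coord p.length (pathElem I α.toPath • y) = 0 := by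
    intro y hy hya
    rw [← h.sum_coord y, Finset.smul_sum, map_sum]
    refine Finset.sum_eq_zero fun i hi => ?_
    have hi : i ≤ p.length := by simpa [Nat.lt_succ_iff] using hi
    rw [quotient_smul_comm, map_smul]
    by_cases hv : vtx p i = a
    swap
    · rw [h.coord_eq_zero_of_vtx_ne hya hv, zero_smul]
    rcases Nat.eq_zero_or_pos i with rfl | hi0
    · rw [h.coord_eq_zero Nat.zero_lt_one hy, zero_smul]
    rcases hi.lt_or_eq with hil | rfl
    · have hA := hfst i hi0 hil hv
      have := arrowAt_smul_along (I := I) p x hil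
      rw [hA] at this
      rw [this, h.coord_along (by omega), if_neg, smul_zero]
      intro he
      exact h₁ (by rw [← hA]; congr 1; omega)
    · have := smul_mem_radFilt α.toPath (along_mem (I := I) p x le_rfl) (s := p.length + 1) (by simp)
      rw [h.bot, Submodule.mem_bot] at this
      rw [this, map_zero, smul_zero]
  have hθa : ∀ (e : V) (y : M), pathElem I (Path.nil : Path e e) • y = y →
      pathElem I (Path.nil : Path e e) • θ y = θ y := fun e y hy => by
    rw [← hθq _ (hnil e), hy]
  set c := h.coord 0 (θ x) with hc
  obtain ⟨z, hz⟩ : ∃ z, z = pathElem I α.toPath • x := ⟨_, rfl⟩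
  have hx0 : h.coord 0 x = 1 := by
    have := h.coord_along (r := 0) (Nat.zero_le _)
    rwa [h.along_zero, if_pos rfl] at this
  have hθx : θ x - c • x ∈ radFilt I M 1 := by
    rw [h.mem_radFilt_iff]
    intro i hi
    obtain rfl : i = 0 := by omega
    rw [map_sub, map_smul, hx0, smul_eq_mul, mul_one, sub_self]
  have hθxa : pathElem I (Path.nil : Path a a) • (θ x - c • x) = θ x - c • x := by
    rw [smul_sub, hθa a x h.src_smul, quotient_smul_comm, h.src_smul]
  have hpα : (⟨a, b, p⟩ : AnyPath V) ≠ ⟨a, b, α.toPath⟩ := fun he => by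
    have : p = α.toPath := by simpa using he
    subst this
    exact h₀ (by simp [Quiver.Hom.toPath, arrowAt])
  -- The top scalar `c` of `θ` is also its scalar on the socle, since `θ` commutes with `p`.
  have hθl : θ (along I p x p.length) = c • along I p x p.length := by
    have := smul_mem_radFilt p hθx (s := p.length + 1) (by omega)
    rw [h.bot, Submodule.mem_bot, smul_sub, sub_eq_zero, quotient_smul_comm] at this
    rw [along_length, hθq p hpα, this]
  have hc0 : c ≠ 0 := fun h0 => by
    rw [h0, zero_smul, θ.map_eq_zero_iff, along_length] at hθl
    exact h.ne_zero hθl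
  -- Below the socle, a component of `z` sits at the end of an occurrence of `α` that is not the
  -- first arrow; by `key` its image under `θ` has no socle coefficient.
  have hθz : h.coord p.length (θ z) = h.coord p.length z * c := by
    have hza : pathElem I (Path.nil : Path b b) • z = z := by
      rw [hz, pathElem_smul_smul]; rfl
    have hz1 : z ∈ radFilt I M 1 := by rw [hz]; exact pathElem_smul_mem _ _ (by simp)
    conv_lhs => rw [← h.sum_coord z, map_sum, map_sum]
    rw [Finset.sum_eq_single p.length]
    · rw [map_smul, hθl, map_smul, map_smul, h.coord_along le_rfl, if_pos rfl, smul_eq_mul,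
        smul_eq_mul, mul_one]
    · intro m hm hml
      have hm : m < p.length := by
        have : m < p.length + 1 := by simpa using hm
        omega
      rw [map_smul, map_smul]
      by_cases hv : vtx p m = b
      swap
      · rw [h.coord_eq_zero_of_vtx_ne hza hv, zero_smul]
      rcases Nat.eq_zero_or_pos m with rfl | hm0
      · rw [h.coord_eq_zero Nat.zero_lt_one hz1, zero_smul]
      have hA := hlst m hm0 hm hv
      have hm1 : m - 1 ≠ 0 := fun h' => h₀ (by rw [← hA, h'])
      have hmem : along I p x (m - 1) ∈ radFilt I M 1 :=
        radFilt_antitone (by omega) (along_mem p x (by omega))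
      have hsrc : vtx p (m - 1) = a := by
        rw [← arrowAt_src p (by omega), hA]
      have hxm : pathElem I α.toPath • along I p x (m - 1) = along I p x m := by
        have := arrowAt_smul_along (I := I) p x (r := m - 1) (by omega)
        rw [hA, Nat.sub_add_cancel hm0] at this
        exact this
      have := hθ (pathElem I α.toPath) (along I p x (m - 1))
      have hnil' := nil_smul_along (I := I) p x (m - 1)
      rw [hsrc] at hnil'
      rw [hDα, hDα, h.coord_eq_zero Nat.zero_lt_one hmem,
        h.coord_eq_zero Nat.zero_lt_one (hθrad 1 (by omega) _ hmem), zero_smul, smul_zero,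
        smul_zero, add_zero, add_zero, hxm] at this
      rw [this, key _ (hθrad 1 (by omega) _ hmem) (hθa a _ hnil'), smul_zero]
    · intro hm; simp at hm
  -- With `z_l` the socle coefficient of `z`, the two sides become `z_l c + s c` and `c z_l + t c`,
  -- forcing `s = t`.
  have h₂ := congrArg (h.coord p.length) (hθ (pathElem I α.toPath) x)
  rw [hDα, hDα, ← hc, hx0, one_smul, ← hz, map_add, θ.map_smul s, hθl, map_add, map_add, hθz]
    at h₂
  simp only [LinearMap.map_smul, h.coord_along le_rfl, if_pos] at h₂
  have h₃ : h.coord p.length (pathElem I α.toPath • θ x) = c * h.coord p.length z := by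
    have := key _ hθx hθxa
    rwa [smul_sub, map_sub, sub_eq_zero, quotient_smul_comm, LinearMap.map_smul, ← hz] at this
  rw [h₃] at h₂
  simp only [smul_eq_mul, mul_one] at h₂
  exact hst (mul_right_cancel₀ hc0 (by linear_combination h₂))

/-- Strong induction on the length: in a shortest violation, each proper end or initial segment
parallel to `α` starts or ends with `α`, and the violation itself rules out one of the two
alternatives. This supplies the hypotheses of `exists_ne_of_finite`. -/
theorem FiniteUniserialType.conditionN [Infinite K] (hI : IsAdmissible I)
    (hfin : FiniteUniserialType I) : ConditionN I := by
  intro e e' α p hpos hp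
  suffices ∀ (n : ℕ) (a b : V) (q : Path a b), a = e → b = e' → q.length = n → 0 < n →
      IsMast I q → arrowAt q 0 = ⟨e, e', α.toPath⟩ ∨ arrowAt q (n - 1) = ⟨e, e', α.toPath⟩ by
    rcases this p.length e e' p rfl rfl rfl hpos hp with h | h
    · left
      obtain ⟨c, d, u, β, v, hpq, hu, -, -, h₂⟩ := exists_split_arrow p hpos
      cases u with
      | cons => simp at hu
      | nil =>
        rw [h] at h₂
        obtain rfl : e' = d := congrArg AnyPath.tgt h₂
        have : α = β := by simpa [Quiver.Hom.toPath] using h₂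
        subst this
        exact ⟨v, hpq⟩
    · right
      cases p with
      | nil => simp at hpos
      | @cons f _ q β =>
        rw [Path.length_cons, Nat.add_sub_cancel, arrowAt_cons] at h
        obtain rfl : f = e := congrArg AnyPath.src h
        have : β = α := by simpa [Quiver.Hom.toPath] using h
        subst this
        exact ⟨q, rfl⟩
  intro n
  induction n using Nat.strong_induction_on with
  | _ n ih =>
    rintro a b q rfl rfl rfl hpos hq
    by_contra! hcon
    refine exists_ne_of_finite hI hfin hq hpos α hcon.1 hcon.2 (fun i hi hil hv => ?_)
      fun m hm hml hv => ?_
    · obtain ⟨c, d, r, hr, hc, hd, hl, hA⟩ := hq.exists_segment hI hil.le le_rfl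
      rcases ih r.length (by omega) c d r (hc.trans hv) (hd.trans (vtx_length q)) rfl (by omega) hr
        with h | h
      · rwa [hA 0 (by omega), Nat.add_zero] at h
      · rw [hA _ (by omega)] at h
        refine absurd ?_ hcon.2
        rw [← h]
        congr 1
        omega
    · obtain ⟨c, d, r, hr, hc, hd, hl, hA⟩ := hq.exists_segment hI (Nat.zero_le m) hml.le
      rcases ih r.length (by omega) c d r (hc.trans (vtx_zero q)) (hd.trans hv) rfl (by omega) hr
        with h | h
      · rw [hA 0 (by omega), Nat.add_zero] at h
        exact absurd h hcon.1
      · rw [hA _ (by omega)] at h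
        rw [← h]
        congr 1
        omega

end SocleTwist

/-! ### Combinatorics of vertex sequences of length at most four. -/

section Combinatorics

variable {V : Type v} {l : ℕ} {e : ℕ → V}

/-- Condition (N), as a property of the sequence of vertices of a mast. -/
def SequenceN (l : ℕ) (e : ℕ → V) : Prop :=
  ∀ i m r, i < m → m ≤ l → r < l → e r = e i → e (r + 1) = e m → e (i + 1) = e m ∨ e (m - 1) = e i

/-- An arrow like the one from position `k - 1` to position `k`, emerging from position `j`. -/
def IsChord (l : ℕ) (e : ℕ → V) (j k : ℕ) : Prop :=
  j + 1 < k ∧ k ≤ l ∧ e j = e (k - 1) ∧ e (j + 1) ≠ e k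

/-- The sequence of the first `j` arrows is repeated immediately before the chord `(j, k)` ends. -/
def IsPeriodic (e : ℕ → V) (j k : ℕ) : Prop :=
  ∀ r ≤ j, e (k - 1 - j + r) = e r

/-- Applied to the loop and two visits of its vertex, (N) moves one of the visits inwards by a step;
iterating, the sequence never leaves the vertex between them. -/
theorem SequenceN.eq_of_loop (hN : SequenceN l e) {r i m : ℕ} (hr : r < l) (hloop : e (r + 1) = e r)
    (hm : m ≤ l) (hi : e i = e r) (hm' : e m = e r) {t : ℕ} (hit : i ≤ t) (htm : t ≤ m) :
    e t = e r := by
  obtain ⟨n, hn⟩ : ∃ n, m - i = n := ⟨_, rfl⟩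
  induction n generalizing i m with
  | zero => obtain rfl : t = i := by omega
            exact hi
  | succ n ih =>
    rcases hN i m r (by omega) hm hr hi.symm (hloop.trans hm'.symm) with h | h
    · rcases hit.eq_or_lt with rfl | hlt
      · exact hi
      · exact ih hm (h.trans hm') hm' hlt htm (by omega)
    · rcases htm.eq_or_lt with rfl | hlt
      · exact hm'
      · exact ih (m := m - 1) (by omega) hi (h.trans hi) hit (by omega) (by omega)

theorem SequenceN.not_return (hN : SequenceN l e) (hl : l ≤ 4) {j k m : ℕ} (h : IsChord l e j k)
    (hkm : k ≤ m) (hm : m < l) (he : e m = e j) : False := by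
  obtain ⟨h₁, h₂, h₃, h₄⟩ := h
  -- As `l ≤ 4`, either the chord spans two steps, and then step `j` is a loop, or `m = k`, and then
  -- the step into `k` is a loop.
  have hcase : k - 1 = j + 1 ∨ m = k := by omega
  have hall : ∀ t, j ≤ t → t ≤ m → e t = e j := by
    intro t ht htm
    rcases hcase with hk | rfl
    · exact hN.eq_of_loop (r := j) (by omega) (by rw [← hk, h₃]) hm.le rfl he ht htm
    · have := hN.eq_of_loop (r := m - 1) (i := j) (m := m) (by omega)
        (by rw [Nat.sub_add_cancel (by omega), he, h₃]) hm.le h₃ (he.trans h₃) ht htm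
      exact this.trans h₃.symm
  exact h₄ ((hall _ (by omega) (by omega)).trans (hall _ (by omega) hkm).symm)

/-- The step at which a longer chord ends would start at the vertex `e j` again, after the end of
the shorter one. -/
theorem SequenceN.chord_unique (hN : SequenceN l e) (hl : l ≤ 4) {j k k' : ℕ}
    (h : IsChord l e j k) (h' : IsChord l e j k') : k = k' := by
  rcases lt_trichotomy k k' with hlt | heq | hlt
  · exact (hN.not_return hl h (m := k' - 1) (by omega) (by have := h'.2.1; omega)
      h'.2.2.1.symm).elim
  · exact heq
  · exact (hN.not_return hl h' (m := k - 1) (by omega) (by have := h.2.1; omega)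
      h.2.2.1.symm).elim

/-- A correction of the top element by `x_i` can change the scalar of the chord only if it reaches
depth `k` after `j + 1` arrows, that is, if `i + j < k`. Without periodicity this leaves one
exceptional configuration. -/
theorem SequenceN.of_not_isPeriodic (hN : SequenceN l e) (hl : l ≤ 4) {j k i : ℕ}
    (h : IsChord l e j k) (hp : ¬ IsPeriodic e j k) (hj : 0 < j) (hi : 0 < i) (he : e i = e 0) :
    k ≤ i + j ∨ (j = 2 ∧ i = 1 ∧ e 2 ≠ e 1) := by
  obtain ⟨h₁, h₂, h₃, h₄⟩ := h
  by_contra! hcon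
  obtain ⟨hk, hcon⟩ := hcon
  apply hp
  obtain rfl | rfl : j = 1 ∨ j = 2 := by omega
  · obtain rfl | rfl : k = 3 ∨ k = 4 := by omega
    · obtain rfl : i = 1 := by omega
      simp only [Nat.reduceSub] at h₃
      intro r hr
      obtain rfl | rfl : r = 0 ∨ r = 1 := by omega
      · exact he
      · exact h₃.symm
    · simp only [Nat.reduceSub] at h₃
      obtain rfl | rfl : i = 1 ∨ i = 2 := by omega
      · have h2 := hN.eq_of_loop (r := 0) (i := 1) (m := 3) (t := 2) (by omega) he (by omega) he
          (h₃.symm.trans he) (by omega) (by omega)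
        intro r hr
        obtain rfl | rfl : r = 0 ∨ r = 1 := by omega
        · exact h2
        · exact h₃.symm
      · intro r hr
        obtain rfl | rfl : r = 0 ∨ r = 1 := by omega
        · exact he
        · exact h₃.symm
  · obtain rfl : k = 4 := by omega
    obtain rfl : i = 1 := by omega
    have h2 := hcon rfl rfl
    simp only [Nat.reduceSub] at h₃
    intro r hr
    obtain rfl | rfl | rfl : r = 0 ∨ r = 1 ∨ r = 2 := by omega
    · exact he
    · exact h2
    · exact h₃.symm

end Combinatorics

/-! ### How arrows off the mast act under condition (N). -/

section Chords

variable {K : Type u} {V : Type v} [Field K] [Quiver.{w} V] [Fintype V]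
variable {I : Ideal (PathAlgebra K V)} [I.IsTwoSided]

/-- A mast of an algebra with condition (N). -/
structure IsNMast (I : Ideal (PathAlgebra K V)) [I.IsTwoSided] {a b : V} (p : Path a b) : Prop where
  length_le : p.length ≤ 4
  arrowAt_eq : ∀ {i m : ℕ}, i < m → m ≤ p.length → ∀ {c d : V} (β : c ⟶ d), c = vtx p i →
    d = vtx p m → arrowAt p i = ⟨c, d, β.toPath⟩ ∨ arrowAt p (m - 1) = ⟨c, d, β.toPath⟩

variable {a b : V} {p : Path a b}

namespace IsNMast

variable (hp : IsNMast I p)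
include hp

/-- For a segment of length one both alternatives of (N) coincide: a mast arrow has no other arrow
parallel to it. -/
theorem arrowAt_eq_of_vtx {i : ℕ} (hi : i < p.length) {c d : V} (β : c ⟶ d) (hc : c = vtx p i)
    (hd : d = vtx p (i + 1)) : arrowAt p i = ⟨c, d, β.toPath⟩ := by
  rcases hp.arrowAt_eq (Nat.lt_succ_self i) hi β hc hd with h | h <;> exact h

theorem arrowAt_eq_arrowAt {i r : ℕ} (hi : i < p.length) (hr : r < p.length)
    (h₁ : vtx p i = vtx p r) (h₂ : vtx p (i + 1) = vtx p (r + 1)) : arrowAt p i = arrowAt p r := by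
  obtain ⟨c, d, u, β, v, -, -, e₁, e₂, e₃⟩ := exists_split_arrow p hr
  rw [e₃]
  exact hp.arrowAt_eq_of_vtx hi β (by rw [h₁, vtx, e₁]) (by rw [h₂, vtx, e₂])

theorem sequenceN : SequenceN p.length (vtx p) := by
  intro i m r him hm hr h₁ h₂
  obtain ⟨c, d, u, β, v, -, -, e₁, e₂, e₃⟩ := exists_split_arrow p hr
  have hc : c = vtx p r := by rw [vtx, e₁]
  have hd : d = vtx p (r + 1) := by rw [vtx, e₂]
  rcases hp.arrowAt_eq him hm β (hc.trans h₁) (hd.trans h₂) with h | h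
  · left
    rw [← arrowAt_tgt p (by omega), h, ← h₂, ← hd]
  · right
    rw [← arrowAt_src p (by omega), h, ← h₁, ← hc]

variable {M : Type*} [AddCommGroup M] [Module (PathAlgebra K V ⧸ I) M] [Module K M]
  [IsScalarTower K (PathAlgebra K V ⧸ I) M] {x : M}

/-- Between the positions `j` and `r` condition (N) applies to `β`; as `β` is not the mast arrow at
`j`, it must be the one ending at `r`. -/
theorem isChord_of_coord_ne_zero (h : IsFlag I p x) {c d : V} (β : c ⟶ d) {j r : ℕ}
    (hj : j ≤ p.length) (hβ : j < p.length → arrowAt p j ≠ ⟨c, d, β.toPath⟩)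
    (hr : h.coord r (pathElem I β.toPath • along I p x j) ≠ 0) :
    IsChord p.length (vtx p) j r ∧ vtx p r = d ∧ arrowAt p (r - 1) = ⟨c, d, β.toPath⟩ := by
  have hc : c = vtx p j := by
    by_contra hne
    rw [smul_along_of_ne _ _ _ (Ne.symm hne), map_zero] at hr
    exact hr rfl
  have hjr : j < r := by
    by_contra hle
    exact hr (h.coord_eq_zero (r := j + 1) (by omega)
      (smul_mem_radFilt β.toPath (along_mem p x hj) (by simp)))
  have hrl : r ≤ p.length := by
    by_contra hlt
    refine hr ?_
    rw [IsFlag.coord, dif_neg (by omega)]; rfl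
  have hd : vtx p r = d := by
    by_contra hne
    exact hr (h.coord_eq_zero_of_vtx_ne (by rw [pathElem_smul_smul]; rfl) hne)
  have hA := (hp.arrowAt_eq hjr hrl β hc hd.symm).resolve_left (hβ (by omega))
  refine ⟨⟨?_, hrl, ?_, ?_⟩, hd, hA⟩
  · by_contra hlt
    obtain rfl : r = j + 1 := by omega
    exact hβ (by omega) hA
  · rw [← arrowAt_src p (j := r - 1) (by omega), hA]
    exact hc.symm
  · intro he
    exact hβ (by omega) (hp.arrowAt_eq_of_vtx (by omega) β hc (by rw [he, hd]))

theorem arrow_smul_eq (h : IsFlag I p x) {c d : V} (β : c ⟶ d) {j k : ℕ} (hj : j ≤ p.length)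
    (hβ : j < p.length → arrowAt p j ≠ ⟨c, d, β.toPath⟩)
    (hk : IsChord p.length (vtx p) j k) :
    pathElem I β.toPath • along I p x j =
      h.coord k (pathElem I β.toPath • along I p x j) • along I p x k := by
  conv_lhs => rw [← h.sum_coord (pathElem I β.toPath • along I p x j)]
  refine Finset.sum_eq_single k (fun r _ hrk => ?_) fun hk' => ?_
  · by_contra hne
    have := hp.isChord_of_coord_ne_zero h β hj hβ fun h0 => hne (by rw [h0, zero_smul])
    exact hrk (hp.sequenceN.chord_unique hp.length_le this.1 hk)
  · have := hk.2.1
    simp at hk'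
    omega

theorem arrow_smul_eq_zero (h : IsFlag I p x) {c d : V} (β : c ⟶ d) {j : ℕ} (hj : j ≤ p.length)
    (hβ : j < p.length → arrowAt p j ≠ ⟨c, d, β.toPath⟩)
    (hno : ∀ k, IsChord p.length (vtx p) j k → vtx p k = d →
      arrowAt p (k - 1) = ⟨c, d, β.toPath⟩ → False) :
    pathElem I β.toPath • along I p x j = 0 := by
  rw [← h.sum_coord (pathElem I β.toPath • along I p x j)]
  refine Finset.sum_eq_zero fun r _ => ?_
  by_contra hne
  have := hp.isChord_of_coord_ne_zero h β hj hβ fun h0 => hne (by rw [h0, zero_smul])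
  exact hno r this.1 this.2.1 this.2.2

/-- Under condition (N) the mast of a uniserial module is unique. -/
theorem eq_of_isFlag (h : IsFlag I p x) {b' : V} {p' : Path a b'} (h' : IsFlag I p' x) :
    (⟨a, b, p⟩ : AnyPath V) = ⟨a, b', p'⟩ := by
  have hlen : p.length = p'.length := by
    have := h.length_eq.symm.trans h'.length_eq
    have h₁ : ((p.length + 1 : ℕ) : ℕ∞) = ((p'.length + 1 : ℕ) : ℕ∞) := by exact_mod_cast this
    exact Nat.succ_injective (Nat.cast_injective h₁)
  suffices ∀ n ≤ p.length, initSeg p n = initSeg p' n by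
    have := this _ le_rfl
    rwa [initSeg_length, hlen, initSeg_length] at this
  intro n
  induction n with
  | zero => intro _; rw [initSeg_zero, initSeg_zero]
  | succ n ih =>
    intro hn
    have ih := ih (by omega)
    obtain ⟨c, d, u, β, v, -, -, e₁, e₂, e₃⟩ := exists_split_arrow p' (j := n) (by omega)
    by_cases hA : arrowAt p n = ⟨c, d, β.toPath⟩
    · obtain ⟨c', d', u', β', v', -, -, e₁', e₂', e₃'⟩ := exists_split_arrow p (j := n) (by omega)
      rw [e₁, e₁'] at ih
      obtain rfl : c' = c := congrArg AnyPath.tgt ih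
      obtain rfl : u' = u := by simpa using ih
      rw [e₃'] at hA
      obtain rfl : d' = d := congrArg AnyPath.tgt hA
      have : β' = β := by simpa [Quiver.Hom.toPath] using hA
      rw [e₂, e₂', this]
    -- At the first disagreement `β` leaves `p`, so it moves `x_n` at least two layers down; being
    -- the next arrow of `p'`, it should move it exactly one.
    · exfalso
      have hx : pathElem I β.toPath • along I p x n = along I p' x (n + 1) := by
        have := arrowAt_smul_along (I := I) p' x (r := n) (by omega)
        rw [e₃] at this
        rw [← this, along, along, ih]
      refine h'.along_not_mem (r := n + 1) (by omega) ?_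
      rw [← hx, h.mem_radFilt_iff]
      intro i hi
      by_contra hne
      have := (hp.isChord_of_coord_ne_zero h β (by omega) (fun _ => hA) hne).1.1
      omega

end IsNMast

end Chords

/-! ### Coordinates of the variety correspond to chords. -/

section Coordinates

variable {K : Type u} {V : Type v} [Field K] [Quiver.{w} V] [Fintype V]
variable {I : Ideal (PathAlgebra K V)} [I.IsTwoSided]
variable {a b : V} {p : Path a b}

/-- The position from which the arrow of a coordinate of the variety emerges. -/
def Coord.lo (d : Coord p) : ℕ := d.1.u.length

/-- The position of the vertex to which a coordinate of the variety belongs. -/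
def Coord.hi (d : Coord p) : ℕ := d.2.1.length

theorem Detour.initSeg_lo (D : Detour p) : initSeg p D.u.length = ⟨a, D.mid, D.u⟩ :=
  (isRightSubpath_iff.1 D.isRightSubpath).2

theorem Coord.hi_le (d : Coord p) : d.hi ≤ p.length :=
  (isRightSubpath_iff.1 d.2.2.1).1

theorem Coord.initSeg_hi (d : Coord p) : initSeg p d.hi = ⟨a, d.1.fin, d.2.1⟩ :=
  (isRightSubpath_iff.1 d.2.2.1).2

theorem Coord.lo_lt_hi (d : Coord p) : d.lo < d.hi := d.2.2.2

theorem Detour.vtx_lo (D : Detour p) : vtx p D.u.length = D.mid := by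
  rw [vtx, D.initSeg_lo]

theorem Coord.vtx_hi (d : Coord p) : vtx p d.hi = d.1.fin := by
  rw [vtx, d.initSeg_hi]

theorem Detour.arrowAt_ne (D : Detour p) (hD : D.u.length < p.length) :
    arrowAt p D.u.length ≠ ⟨D.mid, D.fin, D.α.toPath⟩ := by
  intro he
  obtain ⟨c, d, u, β, v, hpv, hu, h₁, h₂, h₃⟩ := exists_split_arrow p hD
  refine D.not_isRightSubpath ?_
  have h₁' := D.initSeg_lo
  obtain ⟨mid, fin, u', α, h, h', h''⟩ := D
  simp only at *
  rw [h₁] at h₁'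
  obtain rfl : c = mid := congrArg AnyPath.tgt h₁'
  obtain rfl : u = u' := by simpa using h₁'
  rw [h₃] at he
  obtain rfl : d = fin := congrArg AnyPath.tgt he
  have : β = α := by simpa [Quiver.Hom.toPath] using he
  subst this
  exact ⟨v, hpv⟩

namespace IsNMast

variable (hp : IsNMast I p)
include hp

theorem arrowAt_hi (d : Coord p) :
    arrowAt p (d.hi - 1) = ⟨d.1.mid, d.1.fin, d.1.α.toPath⟩ :=
  (hp.arrowAt_eq d.lo_lt_hi d.hi_le d.1.α d.1.vtx_lo.symm d.vtx_hi.symm).resolve_left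
    (d.1.arrowAt_ne (d.lo_lt_hi.trans_le d.hi_le))

theorem isChord (d : Coord p) : IsChord p.length (vtx p) d.lo d.hi := by
  have hlt := d.lo_lt_hi
  have hle := d.hi_le
  have hA := hp.arrowAt_hi d
  have hne := d.1.arrowAt_ne (hlt.trans_le hle)
  refine ⟨?_, hle, ?_, fun he => hne ?_⟩
  · by_contra hcon
    have e : d.hi - 1 = d.lo := by omega
    rw [e] at hA
    exact hne hA
  · rw [← arrowAt_src p (j := d.hi - 1) (by omega), hA]
    exact d.1.vtx_lo
  · exact hp.arrowAt_eq_of_vtx (hlt.trans_le hle) _ d.1.vtx_lo.symm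
      (d.vtx_hi.symm.trans he.symm)

/-- The start determines the chord, the end of the chord determines its arrow, and so the whole
detour with its index is determined. -/
theorem coord_ext {d d' : Coord p} (h : d.lo = d'.lo) : d = d' := by
  have hhi : d.hi = d'.hi :=
    hp.sequenceN.chord_unique hp.length_le (hp.isChord d) (h ▸ hp.isChord d')
  have h₁ := d.1.initSeg_lo
  have h₂ := d.initSeg_hi
  have h₃ := hp.arrowAt_hi d
  change initSeg p d.lo = _ at h₁
  rw [h] at h₁
  rw [hhi] at h₂ h₃
  have h₁' := h₁.symm.trans d'.1.initSeg_lo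
  have h₂' := h₂.symm.trans d'.initSeg_hi
  have h₃' := h₃.symm.trans (hp.arrowAt_hi d')
  clear h₁ h₂ h₃ h hhi
  obtain ⟨⟨mid, fin, u, α, _, _, _⟩, v, _⟩ := d
  obtain ⟨⟨mid', fin', u', α', _, _, _⟩, v', _⟩ := d'
  simp only at h₁' h₂' h₃'
  obtain rfl : mid = mid' := congrArg AnyPath.tgt h₁'
  obtain rfl : fin = fin' := congrArg AnyPath.tgt h₂'
  obtain rfl : u = u' := by simpa using h₁'
  obtain rfl : v = v' := by simpa using h₂'
  obtain rfl : α = α' := by simpa [Quiver.Hom.toPath] using h₃'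
  rfl

theorem exists_coord {j k : ℕ} (h : IsChord p.length (vtx p) j k) :
    ∃ d : Coord p, d.lo = j ∧ d.hi = k := by
  obtain ⟨h₁, h₂, h₃, h₄⟩ := h
  obtain ⟨c, u, z, hz, hu, hu'⟩ := exists_split p (j := j) (by omega)
  obtain ⟨c', d, u', β, v, hv, hlen, e₁, e₂, e₃⟩ := exists_split_arrow p (j := k - 1) (by omega)
  rw [Nat.sub_add_cancel (by omega)] at e₂
  have hc : vtx p j = c := by rw [vtx, hu']
  have hd : vtx p k = d := by rw [vtx, e₂]
  obtain rfl : c = c' := by rw [← hc, h₃, vtx, e₁]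
  have hvl : (u'.cons β).length = k := by rw [Path.length_cons]; omega
  have hvr : IsRightSubpath (u'.cons β) p := ⟨v, hv⟩
  let D : Detour p :=
    { mid := c
      fin := d
      u := u
      α := β
      isRightSubpath := ⟨z, hz⟩
      not_isRightSubpath := fun hr => by
        have := (isRightSubpath_iff.1 hr).2
        rw [Path.length_cons, hu] at this
        refine h₄ ?_
        rw [hd, vtx, this]
      exists_longer := ⟨u'.cons β, hvr, by omega⟩ }
  exact ⟨⟨D, u'.cons β, hvr, by change u.length < _; omega⟩, hu, hvl⟩

end IsNMast

variable {M : Type*} [AddCommGroup M] [Module (PathAlgebra K V ⧸ I) M] [Module K M]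
  [IsScalarTower K (PathAlgebra K V ⧸ I) M] {x : M}

variable (I) in
/-- The point `κ` of affine space describes the module `M` with respect to the element `x`. -/
def IsPoint {M : Type*} [AddCommGroup M] [Module (PathAlgebra K V ⧸ I) M] [Module K M]
    (x : M) (κ : Coord p → K) : Prop :=
  ∀ d : Coord p, pathElem I (arrowAt p (d.hi - 1)).path • along I p x d.lo =
    κ d • along I p x d.hi

namespace IsNMast

variable (hp : IsNMast I p)
include hp

theorem arrowAt_ne_of_isChord {j k : ℕ} (hc : IsChord p.length (vtx p) j k) :
    arrowAt p j ≠ arrowAt p (k - 1) := by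
  intro h
  obtain ⟨h₁, h₂, h₃, h₄⟩ := hc
  have := congrArg AnyPath.tgt h
  rw [arrowAt_tgt p (by omega), arrowAt_tgt p (by omega), Nat.sub_add_cancel (by omega)] at this
  exact h₄ this

theorem arrowAt_smul_eq (h : IsFlag I p x) {j k : ℕ} (hc : IsChord p.length (vtx p) j k) :
    pathElem I (arrowAt p (k - 1)).path • along I p x j =
      h.coord k (pathElem I (arrowAt p (k - 1)).path • along I p x j) • along I p x k := by
  have h₁ := hc.1
  have h₂ := hc.2.1
  obtain ⟨c, d, β, e⟩ := AnyPath.exists_arrow (length_arrowAt p (j := k - 1) (by omega))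
  rw [e]
  exact hp.arrow_smul_eq h β (by omega)
    (fun _ => by rw [← e]; exact hp.arrowAt_ne_of_isChord hc) hc

theorem exists_isPoint (h : IsFlag I p x) : ∃ κ : Coord p → K, IsPoint I x κ :=
  ⟨fun d => h.coord d.hi (pathElem I (arrowAt p (d.hi - 1)).path • along I p x d.lo),
    fun d => hp.arrowAt_smul_eq h (hp.isChord d)⟩

theorem index_eq (D : Detour p) (i i' : D.Index) : i = i' := by
  have : (⟨D, i⟩ : Coord p) = ⟨D, i'⟩ := hp.coord_ext rfl
  simpa using this

/-- The index set of a detour has a single element, so the sum collapses. -/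
theorem detour_smul_iff (x : M) (D : Detour p) (κ : Coord p → K) (i : D.Index) :
    pathElem I (D.u.cons D.α) • x = (∑ i : D.Index, κ ⟨D, i⟩ • pathElem I i.1) • x ↔
      pathElem I (arrowAt p (Coord.hi ⟨D, i⟩ - 1)).path • along I p x D.u.length =
        κ ⟨D, i⟩ • along I p x (Coord.hi ⟨D, i⟩) := by
  rw [Finset.sum_eq_single i (fun i' _ hi' => absurd (hp.index_eq D i' i) hi')
    (fun hi => absurd (Finset.mem_univ i) hi), hp.arrowAt_hi, along, along, D.initSeg_lo,
    Coord.initSeg_hi, pathElem_smul_smul, smul_assoc]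
  rfl

theorem forall_detour_iff (x : M) (κ : Coord p → K) :
    (∀ D : Detour p, pathElem I (D.u.cons D.α) • x =
      (∑ i : D.Index, κ ⟨D, i⟩ • pathElem I i.1) • x) ↔ IsPoint I x κ := by
  constructor
  · rintro h ⟨D, i⟩
    exact (hp.detour_smul_iff x D κ i).1 (h D)
  · intro h D
    obtain ⟨v, hv⟩ := D.exists_longer
    exact (hp.detour_smul_iff x D κ ⟨v, hv⟩).2 (h ⟨D, ⟨v, hv⟩⟩)

end IsNMast

end Coordinates

section Variety

variable {K : Type u} {V : Type v} [Field K] [Quiver.{w} V] [Fintype V]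
variable {I : Ideal (PathAlgebra K V)} [I.IsTwoSided]
variable {a b : V} {p : Path a b}

attribute [local instance] ModuleCat.moduleOfAlgebraModule
  ModuleCat.isScalarTower_of_algebra_moduleCat

theorem IsNMast.mem_uniserialVariety_iff (hI : IsAdmissible I) (hp : IsNMast I p)
    {κ : Coord p → K} : κ ∈ uniserialVariety I p ↔
      ∃ (M : ModuleCat.{max u v w} (PathAlgebra K V ⧸ I)) (x : M),
        IsFlag I p x ∧ IsPoint I x κ := by
  constructor
  · rintro ⟨M, x, hM, hx, h⟩
    exact ⟨M, x, hM.isFlag_of_isTopElement hI hx, (hp.forall_detour_iff x κ).1 h⟩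
  · rintro ⟨M, x, h, hκ⟩
    exact ⟨M, x, h.isMastOf, h.isTopElement hI, (hp.forall_detour_iff x κ).2 hκ⟩

theorem IsNMast.hasGraph (hI : IsAdmissible I) (hp : IsNMast I p)
    {M : ModuleCat.{max u v w} (PathAlgebra K V ⧸ I)} {x : M} (h : IsFlag I p x)
    {κ : Coord p → K} (hκ : IsPoint I x κ) (d : Coord p) (hd : κ d ≠ 0) : HasGraph I d.1 d.2 := by
  refine ⟨M, x, h.isMastOf, h.isTopElement hI, ?_⟩
  have h₁ : pathElem I (d.1.u.cons d.1.α) • x = κ d • pathElem I d.2.1 • x := by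
    have := (hp.forall_detour_iff x κ).2 hκ d.1
    rw [Finset.sum_eq_single d.2 (fun i' _ hi' => absurd (hp.index_eq d.1 i' d.2) hi')
      (fun hi => absurd (Finset.mem_univ _) hi), smul_assoc] at this
    exact this
  rw [h₁, ← algebraMap_smul (PathAlgebra K V ⧸ I) (κ d)]
  exact Submodule.span_singleton_smul_eq ((IsUnit.mk0 _ hd).map (algebraMap K _)) _

end Variety

/-! ### Dependence of the coordinates on the top element. -/

section TopElements

variable {K : Type u} {V : Type v} [Field K] [Quiver.{w} V] [Fintype V]
variable {I : Ideal (PathAlgebra K V)} [I.IsTwoSided]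
variable {a b : V} {p : Path a b}
variable {M : Type*} [AddCommGroup M] [Module (PathAlgebra K V ⧸ I) M] [Module K M]
  [IsScalarTower K (PathAlgebra K V ⧸ I) M] {x : M}

/-- The sequence of arrows of `p` leading to a coordinate is repeated before its end. -/
def Coord.IsPeriodic (d : Coord p) : Prop := BoundQuiver.IsPeriodic (vtx p) d.lo d.hi

theorem IsFlag.along_ne_zero (h : IsFlag I p x) {r : ℕ} (hr : r ≤ p.length) :
    along I p x r ≠ 0 := fun h0 =>
  h.along_not_mem hr (h0 ▸ zero_mem _)

theorem IsFlag.smul_along_injective (h : IsFlag I p x) {r : ℕ} (hr : r ≤ p.length) {c c' : K}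
    (hc : c • along I p x r = c' • along I p x r) : c = c' := by
  refine sub_eq_zero.1 (h.eq_zero_of_smul_along_mem hr ?_)
  rw [sub_smul, hc, sub_self]
  exact zero_mem _

theorem along_add (x y : M) (r : ℕ) : along I p (x + y) r = along I p x r + along I p y r :=
  smul_add _ _ _

theorem along_smul (c : K) (x : M) (r : ℕ) : along I p (c • x) r = c • along I p x r :=
  quotient_smul_comm _ _ _

theorem along_mem_add {y : M} {s r : ℕ} (hy : y ∈ radFilt I M s) (hr : r ≤ p.length) :
    along I p y r ∈ radFilt I M (s + r) :=
  smul_mem_radFilt _ hy (by rw [length_initSeg p hr])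

namespace IsNMast

variable (hp : IsNMast I p)
include hp

theorem isPeriodic_of_lo_eq_zero (d : Coord p) (hd : d.lo = 0) : d.IsPeriodic := by
  intro r hr
  obtain rfl : r = 0 := by omega
  rw [hd]
  exact (hd ▸ (hp.isChord d).2.2.1).symm

/-- Counting depths suffices when `d.hi ≤ i + d.lo`. In the exceptional case the first arrow is a
loop that annihilates `x_1`. -/
theorem arrowAt_smul_along_mem (h : IsFlag I p x) (d : Coord p) (hd : ¬ d.IsPeriodic)
    {i : ℕ} (hi : 0 < i) (hil : i ≤ p.length) (hia : vtx p i = a) :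
    pathElem I (arrowAt p (d.hi - 1)).path • along I p (along I p x i) d.lo ∈
      radFilt I M (d.hi + 1) := by
  have hlo : 0 < d.lo := Nat.pos_of_ne_zero fun h0 => hd (hp.isPeriodic_of_lo_eq_zero d h0)
  have hc := hp.isChord d
  have h₁ := d.lo_lt_hi
  have h₂ := d.hi_le
  rcases hp.sequenceN.of_not_isPeriodic hp.length_le hc hd hlo hi (hia.trans (vtx_zero p).symm)
    with hk | ⟨hj, rfl, hne⟩
  · exact smul_mem_radFilt _ (along_mem_add (along_mem p x hil) (by omega))
      (by rw [length_arrowAt p (by omega)]; omega)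
  · suffices along I p (along I p x 1) d.lo = 0 by
      rw [this, smul_zero]
      exact zero_mem _
    have h0 : along I p (along I p x 1) 1 = 0 := by
      rw [← arrowAt_smul_along (r := 0) _ _ (by omega), along_zero]
      have : pathElem I (Path.nil : Path a a) • along I p x 1 = along I p x 1 := by
        have := nil_smul_along (I := I) p x 1
        rwa [hia] at this
      rw [this]
      obtain ⟨c, e, β, hβ⟩ := AnyPath.exists_arrow (length_arrowAt p (j := 0) (by omega))
      have he : vtx p 1 = e := by rw [← arrowAt_tgt p (j := 0) (by omega), hβ]
      rw [hβ]
      refine hp.arrow_smul_eq_zero h β (by omega) (fun _ h' => ?_) fun k hk hk' _ => ?_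
      · refine hne ?_
        rw [he, ← arrowAt_tgt p (j := 1) (by omega), h']
      -- A chord for the loop would return to its vertex later, so by `eq_of_loop` the mast would
      -- still be there at position 2.
      · have h01 : vtx p 1 = vtx p 0 := hia.trans (vtx_zero p).symm
        have := hk.1
        refine hne ((hp.sequenceN.eq_of_loop (r := 0) (i := 0) (m := k) (t := 2) (by omega) h01
          hk.2.1 rfl (hk'.trans (he.symm.trans h01)) (by omega) (by omega)).trans h01.symm)
    rw [hj, ← arrowAt_smul_along (r := 1) _ _ (by omega), h0, smul_zero]

/-- The non-periodic coordinates of a module do not depend on the choice of a top element. -/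
theorem point_eq_of_not_isPeriodic (h : IsFlag I p x) {x' : M} (h' : IsFlag I p x')
    {κ κ' : Coord p → K} (hκ : IsPoint I x κ) (hκ' : IsPoint I x' κ') (d : Coord p)
    (hd : ¬ d.IsPeriodic) : κ' d = κ d := by
  have h₁ := d.lo_lt_hi
  have h₂ := d.hi_le
  obtain ⟨c, hc⟩ : ∃ c, c = h.coord 0 x' := ⟨_, rfl⟩
  obtain ⟨y, hy⟩ : ∃ y, y = ∑ i ∈ Finset.range p.length, h.coord (i + 1) x' • along I p x (i + 1) :=
    ⟨_, rfl⟩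
  have hx' : x' = c • x + y := by
    conv_lhs => rw [← h.sum_coord x']
    rw [Finset.sum_range_succ', h.along_zero, ← hc, ← hy, add_comm]
  have hy₁ : y ∈ radFilt I M 1 := by
    rw [hy]
    exact sum_mem fun i hi => Submodule.smul_of_tower_mem _ _
      (radFilt_antitone (Nat.le_add_left _ _) (along_mem p x (by simpa using hi)))
  -- The correction `y` contributes only below depth `d.hi`, so at that depth `c κ' d = c κ d`
  -- remains.
  have hy₂ : pathElem I (arrowAt p (d.hi - 1)).path • along I p y d.lo ∈
      radFilt I M (d.hi + 1) := by
    rw [hy, along, Finset.smul_sum, Finset.smul_sum]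
    refine sum_mem fun i hi => ?_
    rw [quotient_smul_comm, quotient_smul_comm]
    by_cases hv : vtx p (i + 1) = a
    · exact Submodule.smul_of_tower_mem _ _ (hp.arrowAt_smul_along_mem h d hd (Nat.succ_pos i)
        (by simpa using hi) hv)
    · rw [h.coord_eq_zero_of_vtx_ne h'.src_smul hv, zero_smul]
      exact zero_mem _
  have hc0 : c ≠ 0 := by
    rintro rfl
    refine h'.along_not_mem (Nat.zero_le _) ?_
    rw [h'.along_zero, hx', zero_smul, zero_add, zero_add]
    exact hy₁
  have key := hκ' d
  rw [hx', along_add, along_add, along_smul, along_smul, smul_add, quotient_smul_comm, hκ d] at key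
  have : (c * (κ' d - κ d)) • along I p x d.hi ∈ radFilt I M (d.hi + 1) := by
    have e : (c * (κ' d - κ d)) • along I p x d.hi =
        pathElem I (arrowAt p (d.hi - 1)).path • along I p y d.lo - κ' d • along I p y d.hi := by
      rw [mul_smul, sub_smul, smul_sub, smul_comm c (κ' d)]
      rw [smul_add] at key
      rw [sub_eq_sub_iff_add_eq_add, add_comm (pathElem I _ • _), key]
    rw [e]
    refine sub_mem hy₂ (Submodule.smul_of_tower_mem _ _ ?_)
    have := along_mem_add (p := p) hy₁ h₂
    rwa [add_comm] at this
  exact sub_eq_zero.1 ((mul_eq_zero.1 (h.eq_zero_of_smul_along_mem h₂ this)).resolve_left hc0)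

/-- By periodicity the initial arrows of `p` coincide with the mast arrows met from position `d.hi -
1 - d.lo` on. -/
theorem along_along_of_le (d : Coord p) (hd : d.IsPeriodic) {r : ℕ} (hr : r ≤ d.lo) (x : M) :
    along I p (along I p x (d.hi - 1 - d.lo)) r = along I p x (d.hi - 1 - d.lo + r) := by
  have h₁ := (hp.isChord d).1
  have h₂ := d.hi_le
  induction r with
  | zero =>
    have := nil_smul_along (I := I) p x (d.hi - 1 - d.lo)
    have e : vtx p (d.hi - 1 - d.lo) = a := (hd 0 (Nat.zero_le _)).trans (vtx_zero p)
    rwa [e, ← along_zero (p := p)] at this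
  | succ r ih =>
    rw [← arrowAt_smul_along _ _ (by omega), ih (by omega), ← add_assoc,
      ← arrowAt_smul_along (r := d.hi - 1 - d.lo + r) _ _ (by omega),
      hp.arrowAt_eq_arrowAt (r := r) (i := d.hi - 1 - d.lo + r) (by omega) (by omega)
        (hd r (by omega)) (hd (r + 1) hr)]

/-- After `d.lo` steps the vector is `x_{d.hi-1}`, and arrow number `d.lo` is not the next mast
arrow there. A chord for it would force a return excluded by `not_return`, so it acts as zero. -/
theorem along_along_of_lt (h : IsFlag I p x) (d : Coord p) (hd : d.IsPeriodic) {r : ℕ}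
    (hr : d.lo < r) (hrl : r ≤ p.length) :
    along I p (along I p x (d.hi - 1 - d.lo)) r = 0 := by
  have hc := hp.isChord d
  have h₁ := hc.1
  have h₂ := d.hi_le
  obtain ⟨n, rfl⟩ : ∃ n, r = d.lo + 1 + n := ⟨r - (d.lo + 1), by omega⟩
  induction n with
  | zero =>
    rw [Nat.add_zero, ← arrowAt_smul_along _ _ (by omega), hp.along_along_of_le d hd le_rfl,
      Nat.sub_add_cancel (by omega)]
    obtain ⟨c, e, β, hβ⟩ := AnyPath.exists_arrow (length_arrowAt p (j := d.lo) (by omega))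
    rw [hβ]
    refine hp.arrow_smul_eq_zero h β (by omega) (fun _ => ?_) fun s hs _ hs' => ?_
    · rw [← hβ]
      exact (hp.arrowAt_ne_of_isChord hc).symm
    · have h₃ := hs.1
      have h₄ := hs.2.1
      refine hp.sequenceN.not_return hp.length_le hc (m := s - 1) (by omega) (by omega) ?_
      rw [← arrowAt_src p (by omega), hs', ← hβ, arrowAt_src p (by omega)]
  | succ n ih =>
    rw [← add_assoc, ← arrowAt_smul_along _ _ (by omega), ih (by omega) (by omega), smul_zero]

/-- A change of the top element which translates a periodic coordinate and fixes those which
emerge further down. -/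
theorem exists_move (h : IsFlag I p x) {κ : Coord p → K} (hκ : IsPoint I x κ) (d : Coord p)
    (hd : d.IsPeriodic) (t : K) : ∃ (x' : M) (κ' : Coord p → K), IsFlag I p x' ∧ IsPoint I x' κ' ∧
      κ' d = κ d + t ∧ ∀ d' : Coord p, d.lo < d'.lo → κ' d' = κ d' := by
  have h₁ := (hp.isChord d).1
  have h₂ := d.hi_le
  -- The repetition starts at this position, so adding `t x_i` to `x` adds `t x_{d.hi-1}` to
  -- `x_{d.lo}` and nothing further down.
  obtain ⟨i, hi⟩ : ∃ i, i = d.hi - 1 - d.lo := ⟨_, rfl⟩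
  obtain ⟨x', hx'⟩ : ∃ x', x' = x + t • along I p x i := ⟨_, rfl⟩
  have hlt : ∀ r, d.lo < r → r ≤ p.length → along I p x' r = along I p x r := fun r hr hrl => by
    rw [hx', along_add, along_smul, hi, hp.along_along_of_lt h d hd hr hrl, smul_zero, add_zero]
  have hlo : along I p x' d.lo = along I p x d.lo + t • along I p x (d.hi - 1) := by
    rw [hx', along_add, along_smul, hi, hp.along_along_of_le d hd le_rfl,
      Nat.sub_add_cancel (by omega)]
  have h' : IsFlag I p x' := by
    refine h.isMastOf.isFlag h.bot (fun hmem => ?_) (e := a) ?_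
    · refine h.along_not_mem (Nat.zero_le _) ?_
      rw [h.along_zero]
      have : t • along I p x i ∈ radFilt I M 1 := Submodule.smul_of_tower_mem _ _
        (radFilt_antitone (by omega) (along_mem p x (r := i) (by omega)))
      rw [hx'] at hmem
      simpa using sub_mem hmem this
    · have := nil_smul_along (I := I) p x i
      have e : vtx p i = a := hi ▸ (hd 0 (Nat.zero_le _)).trans (vtx_zero p)
      rw [e] at this
      rw [hx', smul_add, h.src_smul, quotient_smul_comm, this]
  obtain ⟨κ', hκ'⟩ := hp.exists_isPoint h'
  refine ⟨x', κ', h', hκ', ?_, fun d' hd' => ?_⟩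
  · have key := hκ' d
    rw [hlt _ d.lo_lt_hi h₂, hlo, smul_add, hκ d, quotient_smul_comm,
      arrowAt_smul_along _ _ (by omega), Nat.sub_add_cancel (by omega), ← add_smul] at key
    exact (h.smul_along_injective h₂ key).symm
  · have h₃ := d'.lo_lt_hi
    have h₄ := d'.hi_le
    have key := hκ' d'
    rw [hlt _ hd' (by omega), hlt _ (by omega) h₄, hκ d'] at key
    exact (h.smul_along_injective h₄ key).symm

/-- The periodic coordinates can be prescribed by a choice of the top element. -/
theorem exists_top (h : IsFlag I p x) (τ : Coord p → K) :
    ∃ (x' : M) (κ' : Coord p → K), IsFlag I p x' ∧ IsPoint I x' κ' ∧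
      ∀ d : Coord p, d.IsPeriodic → κ' d = τ d := by
  -- Coordinates are adjusted from the bottom upwards, since `exists_move` controls only those
  -- emerging further down. No chord starts at position 5, which gives the base case.
  suffices ∀ m n, n + m = 5 → ∃ (x' : M) (κ' : Coord p → K), IsFlag I p x' ∧ IsPoint I x' κ' ∧
      ∀ d : Coord p, d.IsPeriodic → n ≤ d.lo → κ' d = τ d by
    obtain ⟨x', κ', h', hκ', hd⟩ := this 5 0 rfl
    exact ⟨x', κ', h', hκ', fun d hd' => hd d hd' (Nat.zero_le _)⟩
  intro m
  induction m with
  | zero =>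
    intro n hn
    obtain ⟨κ, hκ⟩ := hp.exists_isPoint h
    refine ⟨x, κ, h, hκ, fun d _ hd => ?_⟩
    have h₁ := d.lo_lt_hi
    have h₂ := d.hi_le
    have h₃ := hp.length_le
    omega
  | succ m ih =>
    intro n hn
    obtain ⟨x', κ', h', hκ', hd⟩ := ih (n + 1) (by omega)
    by_cases hex : ∃ d : Coord p, d.IsPeriodic ∧ d.lo = n
    · obtain ⟨d, hd₁, hd₂⟩ := hex
      obtain ⟨x'', κ'', h'', hκ'', e₁, e₂⟩ := hp.exists_move h' hκ' d hd₁ (τ d - κ' d)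
      refine ⟨x'', κ'', h'', hκ'', fun d' hd' hn' => ?_⟩
      rcases hn'.eq_or_lt with heq | hlt
      · obtain rfl : d = d' := hp.coord_ext (hd₂.trans heq)
        rw [e₁, add_sub_cancel]
      · rw [e₂ d' (hd₂ ▸ hlt), hd d' hd' hlt]
    · refine ⟨x', κ', h', hκ', fun d hd' hn' => hd d hd' (Nat.lt_of_le_of_ne hn' fun he => ?_)⟩
      exact hex ⟨d, hd', he.symm⟩

end IsNMast

end TopElements

/-! ### The difference of two actions with the same mast. -/

section Difference

variable {K : Type u} {V : Type v} [Field K] [Quiver.{w} V] [Fintype V]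
variable {I : Ideal (PathAlgebra K V)} [I.IsTwoSided]
variable {a b : V} {p : Path a b}
variable {M : Type*} [AddCommGroup M] [Module (PathAlgebra K V ⧸ I) M] [Module K M]
  [IsScalarTower K (PathAlgebra K V ⧸ I) M] {x : M}
variable {M' : Type*} [AddCommGroup M'] [Module (PathAlgebra K V ⧸ I) M'] [Module K M']
  [IsScalarTower K (PathAlgebra K V ⧸ I) M'] {x' : M'}

/-- The linear isomorphism between two modules with the same mast which identifies the bases along
the mast. -/
def IsFlag.equiv (h : IsFlag I p x) (h' : IsFlag I p x') : M ≃ₗ[K] M' :=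
  h.basis.equiv h'.basis (Equiv.refl _)

theorem IsFlag.equiv_along (h : IsFlag I p x) (h' : IsFlag I p x') {r : ℕ} (hr : r ≤ p.length) :
    h.equiv h' (along I p x r) = along I p x' r := by
  have := h.basis.equiv_apply (b' := h'.basis) (e := Equiv.refl _) (i := ⟨r, by omega⟩)
  rwa [h.basis_apply, Equiv.refl_apply, h'.basis_apply] at this

/-- The difference of the actions on two modules with the same mast. -/
def IsFlag.diff (h : IsFlag I p x) (h' : IsFlag I p x') :
    (PathAlgebra K V ⧸ I) →ₗ[K] M →ₗ[K] M :=
  LinearMap.mk₂ K (fun f y => (h.equiv h').symm (f • h.equiv h' y) - f • y)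
    (fun f g y => by simp only [add_smul, map_add]; abel)
    (fun c f y => by rw [smul_assoc, smul_assoc, (h.equiv h').symm.map_smul, smul_sub])
    (fun f y z => by simp only [smul_add, map_add]; abel)
    (fun c f y => by
      rw [(h.equiv h').map_smul, quotient_smul_comm, quotient_smul_comm,
        (h.equiv h').symm.map_smul, smul_sub])

namespace IsFlag

variable (h : IsFlag I p x) (h' : IsFlag I p x')

theorem diff_apply (f : PathAlgebra K V ⧸ I) (y : M) :
    h.diff h' f y = (h.equiv h').symm (f • h.equiv h' y) - f • y := rfl

/-- The middle term is what separates the difference from a crossed derivation; it disappears once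
`diff_mem` and `diff_apply_eq_zero` are available. -/
theorem diff_mul (f g : PathAlgebra K V ⧸ I) (y : M) :
    h.diff h' (f * g) y = f • h.diff h' g y + h.diff h' f (h.diff h' g y) +
      h.diff h' f (g • y) := by
  have e : h.equiv h' (h.diff h' g y) = g • h.equiv h' y - h.equiv h' (g • y) := by
    rw [diff_apply, map_sub, LinearEquiv.apply_symm_apply]
  rw [diff_apply h h' (f * g), diff_apply h h' f (h.diff h' g y), e, diff_apply h h' f (g • y),
    mul_smul, mul_smul, smul_sub, map_sub]
  abel

theorem equiv_symm_along {r : ℕ} (hr : r ≤ p.length) :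
    (h.equiv h').symm (along I p x' r) = along I p x r := by
  rw [LinearEquiv.symm_apply_eq, h.equiv_along h' hr]

theorem diff_initSeg {r : ℕ} (hr : r ≤ p.length) :
    h.diff h' (pathElem I (initSeg p r).path) x = 0 := by
  have e : h.equiv h' x = x' := by
    have := h.equiv_along h' (Nat.zero_le _)
    rwa [h.along_zero, h'.along_zero] at this
  rw [diff_apply, e]
  exact sub_eq_zero.2 (h.equiv_symm_along h' hr)

theorem diff_nil (e : V) : h.diff h' (pathElem I (Path.nil : Path e e)) = 0 := by
  refine h.basis.ext fun i => ?_
  have hi : i.1 ≤ p.length := Nat.lt_succ_iff.1 i.2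
  rw [h.basis_apply, LinearMap.zero_apply, diff_apply, h.equiv_along h' hi]
  by_cases hv : vtx p i = e
  · subst hv
    rw [nil_smul_along, nil_smul_along, h.equiv_symm_along h' hi, sub_self]
  · rw [smul_along_of_ne _ _ _ hv, smul_along_of_ne _ _ _ hv, map_zero, sub_zero]

theorem diff_eq_sum (f : PathAlgebra K V ⧸ I) (y : M) : h.diff h' f y =
    ∑ r ∈ Finset.range (p.length + 1), h.coord r y • h.diff h' f (along I p x r) := by
  conv_lhs => rw [← h.sum_coord y, map_sum]
  exact Finset.sum_congr rfl fun r _ => (h.diff h' f).map_smul _ _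

end IsFlag

namespace IsNMast

variable (hp : IsNMast I p) (h : IsFlag I p x) (h' : IsFlag I p x') {κ κ' : Coord p → K}
  (hκ : IsPoint I x κ) (hκ' : IsPoint I x' κ')
include hp h h' hκ hκ'

/-- Mast arrows act alike on both bases, arrows without a chord act as zero, and only chords record
a difference. -/
theorem diff_arrow_along {c e : V} (β : c ⟶ e) {j : ℕ} (hj : j ≤ p.length) :
    h.diff h' (pathElem I β.toPath) (along I p x j) = 0 ∨
      ∃ d : Coord p, d.lo = j ∧ h.diff h' (pathElem I β.toPath) (along I p x j) =
        (κ' d - κ d) • along I p x d.hi := by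
  rw [h.diff_apply, h.equiv_along h' hj]
  by_cases hβ : j < p.length ∧ arrowAt p j = ⟨c, e, β.toPath⟩
  · left
    have e₁ := arrowAt_smul_along (I := I) p x hβ.1
    have e₂ := arrowAt_smul_along (I := I) p x' hβ.1
    rw [hβ.2] at e₁ e₂
    rw [e₁, e₂, h.equiv_symm_along h' hβ.1, sub_self]
  · have hβ' : j < p.length → arrowAt p j ≠ ⟨c, e, β.toPath⟩ := fun h₁ h₂ => hβ ⟨h₁, h₂⟩
    by_cases hex : ∃ k, IsChord p.length (vtx p) j k ∧ arrowAt p (k - 1) = ⟨c, e, β.toPath⟩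
    · right
      obtain ⟨k, hk, hA⟩ := hex
      obtain ⟨d, rfl, rfl⟩ := hp.exists_coord hk
      refine ⟨d, rfl, ?_⟩
      have e₁ := hκ d
      have e₂ := hκ' d
      rw [hA] at e₁ e₂
      rw [e₁, e₂, map_smul, h.equiv_symm_along h' d.hi_le, sub_smul]
    · left
      rw [hp.arrow_smul_eq_zero h β hj hβ' fun k hk _ hA => hex ⟨k, hk, hA⟩,
        hp.arrow_smul_eq_zero h' β hj hβ' fun k hk _ hA => hex ⟨k, hk, hA⟩, map_zero, sub_zero]

theorem diff_eq_zero (heq : κ = κ') : h.diff h' = 0 := by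
  have harrow : ∀ {c e : V} (β : c ⟶ e), h.diff h' (pathElem I β.toPath) = 0 := by
    intro c e β
    refine LinearMap.ext fun y => ?_
    rw [h.diff_eq_sum]
    refine Finset.sum_eq_zero fun r hr => ?_
    rcases hp.diff_arrow_along h h' hκ hκ' β (j := r) (by simpa [Nat.lt_succ_iff] using hr)
      with h0 | ⟨d, -, h0⟩
    · rw [h0, smul_zero]
    · rw [h0, heq, sub_self, zero_smul, smul_zero]
  refine LinearMap.ext fun f => ?_
  induction f using quotient_induction with
  | zero => exact map_zero _
  | add f g hf hg => rw [map_add, hf, hg]; simp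
  | smul c f hf => rw [LinearMap.map_smul, hf]; simp
  | path q =>
    induction q with
    | nil => exact h.diff_nil h' _
    | cons q β ih =>
      refine LinearMap.ext fun y => ?_
      have e : pathElem I (q.cons β) = pathElem I β.toPath * pathElem I q :=
        (pathElem_mul I β.toPath q).symm
      rw [e, h.diff_mul, ih, harrow]
      simp

/-- Two modules with the same point of affine space are isomorphic. -/
theorem nonempty_equiv (heq : κ = κ') : Nonempty (M ≃ₗ[PathAlgebra K V ⧸ I] M') := by
  have hD := hp.diff_eq_zero h h' hκ hκ' heq
  refine ⟨{ h.equiv h' with map_smul' := fun f y => ?_ }⟩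
  have := h.diff_apply h' f y
  rw [hD] at this
  have := sub_eq_zero.1 this.symm
  rw [LinearEquiv.symm_apply_eq] at this
  exact this.symm

variable (h0 : ∀ d : Coord p, d.lo = 0 → κ d = κ' d)
include h0

/-- Only chords with `1 ≤ lo` contribute, and these end at depth at least 3. -/
theorem diff_arrow_mem {c e : V} (β : c ⟶ e) (y : M) :
    h.diff h' (pathElem I β.toPath) y ∈ radFilt I M 3 := by
  rw [h.diff_eq_sum]
  refine sum_mem fun r hr => Submodule.smul_of_tower_mem _ _ ?_
  rcases hp.diff_arrow_along h h' hκ hκ' β (j := r) (by simpa [Nat.lt_succ_iff] using hr)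
    with h₁ | ⟨d, hd, h₁⟩
  · rw [h₁]
    exact zero_mem _
  · rw [h₁]
    rcases Nat.eq_zero_or_pos d.lo with hd₀ | hd₀
    · rw [h0 d hd₀, sub_self, zero_smul]
      exact zero_mem _
    · have := (hp.isChord d).1
      exact Submodule.smul_of_tower_mem _ _
        (radFilt_antitone (by omega) (along_mem p x d.hi_le))

omit h0 in
-- A chord starting at position 3 or later would end beyond position 4.
theorem diff_arrow_eq_zero {c e : V} (β : c ⟶ e) {y : M} (hy : y ∈ radFilt I M 3) :
    h.diff h' (pathElem I β.toPath) y = 0 := by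
  rw [h.diff_eq_sum]
  refine Finset.sum_eq_zero fun r hr => ?_
  by_cases hr₃ : r < 3
  · rw [h.coord_eq_zero hr₃ hy, zero_smul]
  rcases hp.diff_arrow_along h h' hκ hκ' β (j := r) (by simpa [Nat.lt_succ_iff] using hr)
    with h₁ | ⟨d, hd, h₁⟩
  · rw [h₁, smul_zero]
  · have := (hp.isChord d).1
    have := d.hi_le
    have := hp.length_le
    omega

theorem diff_path {c e : V} (q : Path c e) :
    (∀ y, h.diff h' (pathElem I q) y ∈ radFilt I M 3) ∧
      ∀ y ∈ radFilt I M 3, h.diff h' (pathElem I q) y = 0 := by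
  induction q with
  | nil =>
    rw [h.diff_nil h']
    exact ⟨fun _ => zero_mem _, fun _ _ => rfl⟩
  | cons q β ih =>
    have e : pathElem I (q.cons β) = pathElem I β.toPath * pathElem I q :=
      (pathElem_mul I β.toPath q).symm
    rw [e]
    refine ⟨fun y => ?_, fun y hy => ?_⟩
    · rw [h.diff_mul]
      exact add_mem (add_mem (Submodule.smul_mem _ _ (ih.1 y))
        (hp.diff_arrow_mem h h' hκ hκ' h0 β _)) (hp.diff_arrow_mem h h' hκ hκ' h0 β _)
    · rw [h.diff_mul, ih.2 y hy,
        hp.diff_arrow_eq_zero h h' hκ hκ' β (Submodule.smul_mem _ _ hy)]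
      simp

theorem diff_mem (f : PathAlgebra K V ⧸ I) (y : M) : h.diff h' f y ∈ radFilt I M 3 := by
  induction f using quotient_induction with
  | zero => rw [map_zero]; exact zero_mem _
  | add f g hf hg => rw [map_add]; exact add_mem hf hg
  | smul c f hf =>
    rw [LinearMap.map_smul]
    exact Submodule.smul_of_tower_mem _ _ hf
  | path q => exact (hp.diff_path h h' hκ hκ' h0 q).1 y

theorem diff_apply_eq_zero (f : PathAlgebra K V ⧸ I) {y : M} (hy : y ∈ radFilt I M 3) :
    h.diff h' f y = 0 := by
  induction f using quotient_induction with
  | zero => rw [map_zero]; rfl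
  | add f g hf hg => rw [map_add, LinearMap.add_apply, hf, hg, add_zero]
  | smul c f hf => rw [LinearMap.map_smul, LinearMap.smul_apply, hf, smul_zero]
  | path q => exact (hp.diff_path h h' hκ hκ' h0 q).2 y hy

end IsNMast

end Difference

/-! ### Lines in the variety. -/

section Line

variable {K : Type u} {V : Type v} [Field K] [Quiver.{w} V] [Fintype V]
variable {I : Ideal (PathAlgebra K V)} [I.IsTwoSided]
variable {a b : V} {p : Path a b}
variable {M M' : Type (max u v w)} [AddCommGroup M] [Module (PathAlgebra K V ⧸ I) M] [Module K M]
  [IsScalarTower K (PathAlgebra K V ⧸ I) M] {x : M} [AddCommGroup M']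
  [Module (PathAlgebra K V ⧸ I) M'] [Module K M'] [IsScalarTower K (PathAlgebra K V ⧸ I) M'] {x' : M'}

attribute [local instance] ModuleCat.moduleOfAlgebraModule
  ModuleCat.isScalarTower_of_algebra_moduleCat

/-- If two points of the variety agree in the coordinates which emerge from the top vertex, then
the variety contains the line through these points. -/
theorem IsNMast.exists_line (hp : IsNMast I p) (h : IsFlag I p x) (h' : IsFlag I p x')
    {κ κ' : Coord p → K} (hκ : IsPoint I x κ) (hκ' : IsPoint I x' κ')
    (h0 : ∀ d : Coord p, d.lo = 0 → κ d = κ' d) (s : K) :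
    ∃ (N : ModuleCat.{max u v w} (PathAlgebra K V ⧸ I)) (z : N),
      IsFlag I p z ∧ IsPoint I z (κ + s • (κ' - κ)) := by
  -- Images of the difference lie in the third layer, which it annihilates; so it is a crossed
  -- derivation of square zero.
  obtain ⟨N, ψ, h₁, h₂, -⟩ := h.exists_twist (h.diff h')
    (fun f g y => by
      rw [h.diff_mul, hp.diff_apply_eq_zero h h' hκ hκ' h0 f (hp.diff_mem h h' hκ hκ' h0 g y),
        add_zero])
    (fun f g y => hp.diff_apply_eq_zero h h' hκ hκ' h0 f (hp.diff_mem h h' hκ hκ' h0 g y))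
    (fun f r y hy => by
      rcases Nat.lt_or_ge r 3 with hr | hr
      · exact radFilt_antitone hr (hp.diff_mem h h' hκ hκ' h0 f y)
      · rw [hp.diff_apply_eq_zero h h' hκ hκ' h0 f (radFilt_antitone hr hy)]
        exact zero_mem _)
    (fun r hr => h.diff_initSeg h' hr) s
  refine ⟨N, ψ x, h₂, fun d => ?_⟩
  have hal : ∀ r ≤ p.length, along I p (ψ x) r = ψ (along I p x r) := fun r hr => by
    rw [along, h₁, h.diff_initSeg h' hr, smul_zero, add_zero, along]
  have hlo := d.lo_lt_hi.le.trans d.hi_le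
  have e : h.diff h' (pathElem I (arrowAt p (d.hi - 1)).path) (along I p x d.lo) =
      (κ' d - κ d) • along I p x d.hi := by
    rw [h.diff_apply, h.equiv_along h' hlo, hκ d, hκ' d, map_smul, h.equiv_symm_along h' d.hi_le,
      sub_smul]
  rw [hal _ hlo, hal _ d.hi_le, h₁, e, hκ d, smul_smul, ← add_smul, map_smul]
  rfl

end Line

/-! ### The listed graphs are the periodic chords below the top. -/

section Listed

variable {V : Type v} [Quiver.{w} V]

theorem IsListedGraph.vertices {a b c d : V} {p : Path a b} {u : Path a c} {α : c ⟶ d}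
    {q : Path a d} (h : IsListedGraph p u α q) :
    0 < u.length ∧ u.length + 1 < q.length ∧ q.length ≤ p.length ∧
      ∀ r ≤ u.length, vtx p (q.length - 1 - u.length + r) = vtx p r := by
  cases h <;> refine ⟨by simp, by simp, by simp, fun r hr => ?_⟩ <;>
    simp only [Path.length_cons, Path.length_nil] at hr ⊢ <;> interval_cases r <;>
    simp [vtx, initSeg]

/-- The graph given by a periodic chord not emerging from the top vertex is on the list. -/
theorem isListedGraph_of_isPeriodic {a b c d : V} {p : Path a b} {u : Path a c} {α : c ⟶ d}
    {q : Path a d} {j k : ℕ} (hl : p.length ≤ 4) (hj : 0 < j) (hu : initSeg p j = ⟨a, c, u⟩)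
    (hq : initSeg p k = ⟨a, d, q⟩) (hα : arrowAt p (k - 1) = ⟨c, d, α.toPath⟩)
    (hN : SequenceN p.length (vtx p)) (hc : IsChord p.length (vtx p) j k)
    (hP : IsPeriodic (vtx p) j k)
    (harrow : 2 < p.length → vtx p 0 = vtx p 2 → vtx p 1 = vtx p 3 →
      arrowAt p 0 = arrowAt p 2) : IsListedGraph p u α q := by
  obtain ⟨h₁, h₂, h₃, h₄⟩ := hc
  have hloop := fun {r i m} => hN.eq_of_loop (r := r) (i := i) (m := m)
  -- A chord with `0 < j` ends at position 3 or later.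
  have hlen : p.length = 3 ∨ p.length = 4 := by omega
  rcases hlen with hlen | hlen
  · obtain rfl : j = 1 := by omega
    obtain rfl : k = 3 := by omega
    have p₀ := hP 0 (by omega)
    have p₁ := hP 1 (by omega)
    clear hN hP harrow hloop
    rcases p with _ | ⟨p, f₂⟩
    · simp at hlen
    rcases p with _ | ⟨p, f₁⟩
    · simp at hlen
    rcases p with _ | ⟨p, f₀⟩
    · simp at hlen
    rcases p with _ | ⟨p, f⟩
    swap
    · simp at hlen
    simp [initSeg, arrowAt, vtx, -AnyPath.mk.injEq, Quiver.Hom.toPath] at hu hq hα h₃ h₄ p₀ p₁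
    subst p₀ p₁
    cases hu
    cases hq
    cases hα
    exact .loop_two h₄ _ _ _
  · rw [hlen] at h₂ hN hloop
    have hjk : (j = 1 ∧ k = 3) ∨ (j = 1 ∧ k = 4) ∨ (j = 2 ∧ k = 4) := by omega
    obtain ⟨rfl, rfl⟩ | ⟨rfl, rfl⟩ | ⟨rfl, rfl⟩ := hjk
    · have p₀ := hP 0 (by omega)
      have p₁ := hP 1 (by omega)
      simp only [Nat.reduceSub, Nat.reduceAdd] at p₀ p₁ h₄
      -- A return to the vertex of the initial loops would make the sequence constant up to position
      -- 4.
      have h₅ : vtx p 0 ≠ vtx p 4 := fun he =>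
        h₄ (p₁.trans (p₀.trans (hloop (r := 0) (i := 0) (m := 4) (t := 3) (by omega) p₀ le_rfl rfl
          he.symm (by omega) (by omega)).symm))
      -- Otherwise the arrow from position 2 to 3 would be parallel to the segment from 1 to 4 and
      -- violate (N).
      have h₆ : vtx p 3 ≠ vtx p 4 := fun he => by
        rcases hN 1 4 2 (by omega) le_rfl (by omega) p₁ he with h | h
        · exact h₄ (h.trans he.symm)
        · exact h₄ (p₁.trans h.symm)
      clear hN hP harrow hloop
      rcases p with _ | ⟨p, f₃⟩
      · simp at hlen
      rcases p with _ | ⟨p, f₂⟩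
      · simp at hlen
      rcases p with _ | ⟨p, f₁⟩
      · simp at hlen
      rcases p with _ | ⟨p, f₀⟩
      · simp at hlen
      rcases p with _ | ⟨p, f⟩
      swap
      · simp at hlen
      simp [initSeg, arrowAt, vtx, -AnyPath.mk.injEq, Quiver.Hom.toPath] at hu hq hα h₃ h₄ h₅ h₆ p₀ p₁
      subst p₀ p₁
      cases hu
      cases hq
      cases hα
      exact .loop_two_tail h₄ h₅ h₆ _ _ _ _
    · have p₀ := hP 0 (by omega)
      have p₁ := hP 1 (by omega)
      simp only [Nat.reduceSub, Nat.reduceAdd] at p₀ p₁ h₄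
      -- Otherwise the last step would be a loop, and the sequence would be constant from position 1
      -- on.
      have h₅ : vtx p 1 ≠ vtx p 4 := fun he =>
        h₄ ((hloop (r := 3) (i := 1) (m := 4) (t := 2) (by omega) (he.symm.trans p₁.symm) le_rfl
          p₁.symm (he.symm.trans p₁.symm) (by omega) (by omega)).trans (p₁.trans he))
      have harrow := harrow (by omega) p₀.symm p₁.symm
      clear hN hP hloop
      have h₀ := em (vtx p 0 = vtx p 1)
      rcases p with _ | ⟨p, f₃⟩
      · simp at hlen
      rcases p with _ | ⟨p, f₂⟩
      · simp at hlen
      rcases p with _ | ⟨p, f₁⟩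
      · simp at hlen
      rcases p with _ | ⟨p, f₀⟩
      · simp at hlen
      rcases p with _ | ⟨p, f⟩
      swap
      · simp at hlen
      simp [initSeg, arrowAt, vtx, -AnyPath.mk.injEq, Quiver.Hom.toPath] at hu hq hα h₃ h₄ h₅ p₀ p₁ harrow h₀
      subst p₀ p₁
      cases hu
      cases hq
      cases hα
      cases harrow
      -- Equality of the first two vertices separates graph (ii) from graph (iii).
      rcases h₀ with h₀ | h₀
      · subst h₀
        exact .loop_three_second h₅ _ _ _ _
      · exact .two_cycle h₀ h₄ h₅ _ _ _
    · have p₀ := hP 0 (by omega)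
      have p₁ := hP 1 (by omega)
      have p₂ := hP 2 (by omega)
      simp only [Nat.reduceSub, Nat.reduceAdd] at p₀ p₁ p₂ h₄
      clear hN hP harrow hloop
      rcases p with _ | ⟨p, f₃⟩
      · simp at hlen
      rcases p with _ | ⟨p, f₂⟩
      · simp at hlen
      rcases p with _ | ⟨p, f₁⟩
      · simp at hlen
      rcases p with _ | ⟨p, f₀⟩
      · simp at hlen
      rcases p with _ | ⟨p, f⟩
      swap
      · simp at hlen
      simp [initSeg, arrowAt, vtx, -AnyPath.mk.injEq, Quiver.Hom.toPath] at hu hq hα h₃ h₄ p₀ p₁ p₂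
      subst p₀ p₁ p₂
      cases hu
      cases hq
      cases hα
      exact .loop_three_third h₄ _ _ _ _

end Listed

/-! ### Finiteness of the set of short paths. -/

section Paths

variable {V : Type v} [Quiver.{w} V]

theorem finite_setOf_length_eq [Finite V] [∀ a b : V, Finite (a ⟶ b)] (n : ℕ) :
    {x : AnyPath V | x.path.length = n}.Finite := by
  induction n with
  | zero =>
    refine (Set.finite_range fun e : V => (⟨e, e, Path.nil⟩ : AnyPath V)).subset ?_
    rintro ⟨a, b, p⟩ hx
    obtain rfl := Path.eq_of_length_zero p hx
    exact ⟨a, by rw [Path.eq_nil_of_length_zero p hx]⟩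
  | succ n ih =>
    refine (ih.biUnion fun x _ => Set.finite_range fun f : (Σ e : V, x.tgt ⟶ e) =>
      (⟨x.src, f.1, x.path.cons f.2⟩ : AnyPath V)).subset ?_
    rintro ⟨a, b, p⟩ hx
    cases p with
    | nil => simp at hx
    | @cons c _ q β =>
      exact Set.mem_biUnion (x := (⟨a, c, q⟩ : AnyPath V)) (by simpa using hx) ⟨⟨b, β⟩, rfl⟩

theorem finite_setOf_length_le [Finite V] [∀ a b : V, Finite (a ⟶ b)] (n : ℕ) :
    {x : AnyPath V | x.path.length ≤ n}.Finite := by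
  refine ((Set.finite_Iic n).biUnion fun m _ => finite_setOf_length_eq m).subset ?_
  intro x hx
  exact Set.mem_biUnion (x := x.path.length) hx rfl

end Paths

/-! ### Transcendental coordinate functions. -/

section CoordinateFunctions

variable {K : Type u} {V : Type v} [Field K] [Quiver.{w} V] [Fintype V]
variable {I : Ideal (PathAlgebra K V)} [I.IsTwoSided] {a b : V} {p : Path a b}

theorem aeval_coordFn_eq_zero_iff (D : Detour p) (i : D.Index) (f : Polynomial K) :
    Polynomial.aeval (coordFn I D i) f = 0 ↔ ∀ κ ∈ uniserialVariety I p, f.eval (κ ⟨D, i⟩) = 0 := by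
  have e : Polynomial.aeval (coordFn I D i) f = Ideal.Quotient.mk _
      (Polynomial.aeval (MvPolynomial.X (⟨D, i⟩ : Coord p)) f) :=
    Polynomial.aeval_algHom_apply (Ideal.Quotient.mkₐ K
      (MvPolynomial.vanishingIdeal K (uniserialVariety I p))) _ f
  rw [e, Ideal.Quotient.eq_zero_iff_mem, MvPolynomial.mem_vanishingIdeal_iff]
  refine forall₂_congr fun κ _ => ?_
  rw [← Polynomial.aeval_algHom_apply, MvPolynomial.aeval_X, Polynomial.coe_aeval_eq_eval]

/-- A polynomial relation for the coordinate function is one satisfied by all its values on `V_p`.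
Finitely many values are killed by a product of linear factors, infinitely many by no nonzero
polynomial. -/
theorem transcendental_coordFn_iff (D : Detour p) (i : D.Index) :
    Transcendental K (coordFn I D i) ↔
      ((fun κ : Coord p → K => κ ⟨D, i⟩) '' uniserialVariety I p).Infinite := by
  rw [transcendental_iff]
  constructor
  · intro h hfin
    have := h (∏ c ∈ hfin.toFinset, (Polynomial.X - Polynomial.C c))
      ((aeval_coordFn_eq_zero_iff D i _).2 fun κ hκ => by
        rw [Polynomial.eval_prod]
        exact Finset.prod_eq_zero (hfin.mem_toFinset.2 ⟨κ, hκ, rfl⟩) (by simp))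
    exact (Polynomial.monic_prod_X_sub_C id _).ne_zero this
  · intro h f hf
    refine Polynomial.eq_zero_of_infinite_isRoot f (h.mono ?_)
    rintro _ ⟨κ, hκ, rfl⟩
    exact (aeval_coordFn_eq_zero_iff D i f).1 hf κ hκ

theorem isSlackHalyard_of_infinite (D : Detour p) (i : D.Index)
    (h : ((fun κ : Coord p → K => κ ⟨D, i⟩) '' uniserialVariety I p).Infinite) :
    IsSlackHalyard I D := by
  refine ⟨⟨i, fun h0 => ?_⟩, i, (transcendental_coordFn_iff D i).2 h⟩
  have h₁ := (aeval_coordFn_eq_zero_iff (I := I) D i Polynomial.X).1 (by rw [Polynomial.aeval_X, h0])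
  refine h ((Set.finite_singleton 0).subset ?_)
  rintro _ ⟨κ, hκ, rfl⟩
  simpa using h₁ κ hκ

end CoordinateFunctions

/-! ### Both implications and the classification by masts. -/

section Classification

variable {K : Type u} {V : Type v} [Field K] [Quiver.{w} V] [Fintype V]
variable {I : Ideal (PathAlgebra K V)} [I.IsTwoSided]

attribute [local instance] ModuleCat.moduleOfAlgebraModule
  ModuleCat.isScalarTower_of_algebra_moduleCat

theorem ConditionN.isNMast (hI : IsAdmissible I) (hN : ConditionN I)
    (hJ : Ring.jacobson (PathAlgebra K V ⧸ I) ^ 5 = ⊥) {a b : V} {p : Path a b}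
    (hp : IsMast I p) : IsNMast I p := by
  refine ⟨?_, fun {_ _} him hm {_ _} β hs ht => hN.arrowAt_eq hI hp him hm β hs ht⟩
  by_contra hlen
  obtain ⟨M, x, h⟩ := hp.exists_isFlag hI
  refine h.ne_zero ?_
  rw [pathElem_eq_zero_of_le hI (by norm_num) hJ p (by omega), zero_smul]

namespace IsNMast

variable {a b : V} {p : Path a b} (hp : IsNMast I p)
include hp

theorem eq_of_isMastOf {M : Type*} [AddCommGroup M] [Module (PathAlgebra K V ⧸ I) M] [Module K M]
    [IsScalarTower K (PathAlgebra K V ⧸ I) M] {x : M} (h : IsFlag I p x) {a' b' : V}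
    {q : Path a' b'} (hq : IsMastOf I q M) : (⟨a, b, p⟩ : AnyPath V) = ⟨a', b', q⟩ := by
  have h' : IsFlag I q x := by
    refine hq.isFlag h.bot (fun hmem => ?_) h.src_smul
    have := h.along_not_mem (Nat.zero_le _)
    rw [h.along_zero] at this
    exact this hmem
  obtain rfl : a = a' := by
    by_contra hne
    have e := h'.src_smul
    rw [← h.src_smul, pathElem_smul_smul_of_ne _ _ hne, h.src_smul] at e
    refine h.along_ne_zero (Nat.zero_le _) ?_
    rw [h.along_zero, e]
  exact hp.eq_of_isFlag h h'

theorem isListedGraph_iff (d : Coord p) (hd : 0 < d.lo) :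
    IsListedGraph p d.1.u d.1.α d.2.1 ↔ d.IsPeriodic := by
  refine ⟨fun h => h.vertices.2.2.2, fun h => ?_⟩
  exact isListedGraph_of_isPeriodic hp.length_le hd d.1.initSeg_lo d.initSeg_hi (hp.arrowAt_hi d)
    hp.sequenceN (hp.isChord d) h
    fun h₁ h₂ h₃ => hp.arrowAt_eq_arrowAt (by omega) h₁ h₂ h₃

/-- A non-periodic coordinate is an isomorphism invariant, so its values inject into the isomorphism
classes. -/
theorem finite_image_of_not_isPeriodic (hI : IsAdmissible I) (hfin : FiniteUniserialType I)
    (d : Coord p) (hd : ¬ d.IsPeriodic) :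
    ((fun κ : Coord p → K => κ d) '' uniserialVariety I p).Finite := by
  have hex : ∀ c ∈ (fun κ : Coord p → K => κ d) '' uniserialVariety I p,
      ∃ (M : ModuleCat.{max u v w} (PathAlgebra K V ⧸ I)) (x : M) (κ : Coord p → K),
        IsFlag I p x ∧ IsPoint I x κ ∧ κ d = c := by
    rintro _ ⟨κ, hκ, rfl⟩
    obtain ⟨M, x, h, hx⟩ := (hp.mem_uniserialVariety_iff hI).1 hκ
    exact ⟨M, x, κ, h, hx, rfl⟩
  choose! N x κ h hκ hc using hex
  refine Set.Finite.of_injOn (f := fun c => Quotient.mk (CategoryTheory.isIsomorphicSetoid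
    (ModuleCat.{max u v w} (PathAlgebra K V ⧸ I))) (N c))
    (t := uniserialClasses I) (fun c hc' => ⟨N c, (h c hc').isMastOf.1, rfl⟩) (fun c₁ h₁ c₂ h₂ he => ?_) hfin
  obtain ⟨φ⟩ : Nonempty (N c₁ ≅ N c₂) := Quotient.exact he
  obtain ⟨φ⟩ : Nonempty (N c₁ ≃ₗ[PathAlgebra K V ⧸ I] N c₂) := ⟨φ.toLinearEquiv⟩
  have hφ : IsPoint I (φ (x c₁)) (κ c₁) := fun d' => by
    have := congrArg φ (hκ c₁ h₁ d')
    have e : ∀ (t : K) y, φ (t • y) = t • φ y := (φ.restrictScalars K).map_smul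
    rwa [e, map_smul, along, along, map_smul, map_smul] at this
  rw [← hc c₁ h₁, ← hc c₂ h₂]
  exact hp.point_eq_of_not_isPeriodic (h c₂ h₂) ((h c₁ h₁).map_equiv φ) (hκ c₂ h₂) hφ d hd

variable [Infinite K] (hI : IsAdmissible I) (hm : IsMast I p) (hS : SlackHalyardsListed I)
include hI hm hS

/-- If all slack halyards are on the list, then the points of the variety differ only in the
periodic coordinates. -/
theorem eq_of_slackHalyardsListed {κ κ' : Coord p → K} (hκ : κ ∈ uniserialVariety I p)
    (hκ' : κ' ∈ uniserialVariety I p) (d : Coord p) (hd : ¬ d.IsPeriodic) : κ d = κ' d := by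
  by_contra hne
  obtain ⟨M, x, h, hx⟩ := (hp.mem_uniserialVariety_iff hI).1 hκ
  obtain ⟨M', x', h', hx'⟩ := (hp.mem_uniserialVariety_iff hI).1 hκ'
  -- The periodic coordinates, in particular those from the top vertex, are made to agree with `κ`;
  -- the one at `d` is unaffected.
  obtain ⟨x'', κ'', h'', hx'', hper⟩ := hp.exists_top h' κ
  have hd'' : κ'' d = κ' d := hp.point_eq_of_not_isPeriodic h' h'' hx' hx'' d hd
  rw [← hd''] at hne
  have hline : ∀ s : K, κ + s • (κ'' - κ) ∈ uniserialVariety I p := fun s =>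
    (hp.mem_uniserialVariety_iff hI).2 (hp.exists_line h h'' hx hx''
      (fun d hd => (hper d (hp.isPeriodic_of_lo_eq_zero d hd)).symm) s)
  have hinf : ((fun κ : Coord p → K => κ d) '' uniserialVariety I p).Infinite := by
    refine (Set.infinite_range_of_injective (f := fun s : K => κ d + s * (κ'' d - κ d))
      fun s t hst => ?_).mono ?_
    · exact mul_right_cancel₀ (sub_ne_zero.2 (Ne.symm hne)) (add_left_cancel hst)
    · rintro _ ⟨s, rfl⟩
      exact ⟨_, hline s, rfl⟩
  -- Of two distinct values one is nonzero, and a nonzero value realises the graph.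
  obtain ⟨N, z, μ, hz, hμ, hne'⟩ : ∃ (N : ModuleCat.{max u v w} (PathAlgebra K V ⧸ I)) (z : N)
      (μ : Coord p → K), IsFlag I p z ∧ IsPoint I z μ ∧ μ d ≠ 0 := by
    by_cases h0 : κ d = 0
    · exact ⟨M', x'', κ'', h'', hx'', fun h1 => hne (h0.trans h1.symm)⟩
    · exact ⟨M, x, κ, h, hx, h0⟩
  have hlo : 0 < d.lo := Nat.pos_of_ne_zero fun h0 => hd (hp.isPeriodic_of_lo_eq_zero d h0)
  exact hd ((hp.isListedGraph_iff d hlo).1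
    (hS a b p hm d.1 (isSlackHalyard_of_infinite d.1 d.2 hinf) hlo d.2
      (hp.hasGraph hI hz hμ d hne')))

theorem nonempty_equiv_of_isMastOf {M M' : ModuleCat.{max u v w} (PathAlgebra K V ⧸ I)}
    (hM : IsMastOf I p M) (hM' : IsMastOf I p M') :
    Nonempty (M ≃ₗ[PathAlgebra K V ⧸ I] M') := by
  obtain ⟨x, h⟩ := hM.exists_isFlag hI
  obtain ⟨x', h'⟩ := hM'.exists_isFlag hI
  obtain ⟨κ, hκ⟩ := hp.exists_isPoint h
  obtain ⟨x'', κ'', h'', hκ'', hper⟩ := hp.exists_top h' κ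
  refine hp.nonempty_equiv h h'' hκ hκ'' (funext fun d => ?_)
  by_cases hd : d.IsPeriodic
  · exact (hper d hd).symm
  · exact hp.eq_of_slackHalyardsListed hI hm hS ((hp.mem_uniserialVariety_iff hI).2 ⟨M, x, h, hκ⟩)
      ((hp.mem_uniserialVariety_iff hI).2 ⟨M', x'', h'', hκ''⟩) d hd

theorem exists_affineSubspace : ∃ A : AffineSubspace K (Coord p → K),
    (A : Set (Coord p → K)).Nonempty ∧ (A : Set (Coord p → K)) = uniserialVariety I p := by
  obtain ⟨M, x, h⟩ := hm.exists_isFlag hI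
  obtain ⟨κ, hκ⟩ := hp.exists_isPoint h
  have hmem : κ ∈ uniserialVariety I p := (hp.mem_uniserialVariety_iff hI).2 ⟨M, x, h, hκ⟩
  -- The direction of `V_p` consists of the vectors supported on the periodic coordinates.
  let W : Submodule K (Coord p → K) :=
    { carrier := {μ | ∀ d : Coord p, ¬ d.IsPeriodic → μ d = 0}
      zero_mem' := fun d _ => rfl
      add_mem' := fun {μ ν} hμ hν d hd => by rw [Pi.add_apply, hμ d hd, hν d hd, add_zero]
      smul_mem' := fun c μ hμ d hd => by rw [Pi.smul_apply, hμ d hd, smul_zero] }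
  have hA : (AffineSubspace.mk' κ W : Set (Coord p → K)) = uniserialVariety I p := by
    ext μ
    rw [SetLike.mem_coe, AffineSubspace.mem_mk']
    constructor
    · intro hμ
      obtain ⟨x', κ', h', hκ', hper⟩ := hp.exists_top h μ
      refine (hp.mem_uniserialVariety_iff hI).2 ⟨M, x', h', ?_⟩
      have : κ' = μ := funext fun d => by
        by_cases hd : d.IsPeriodic
        · exact hper d hd
        · rw [hp.point_eq_of_not_isPeriodic h h' hκ hκ' d hd]
          exact (sub_eq_zero.1 (hμ d hd)).symm
      rwa [← this]
    · intro hμ d hd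
      exact sub_eq_zero.2 (hp.eq_of_slackHalyardsListed hI hm hS hμ hmem d hd)
  exact ⟨_, by rw [hA]; exact ⟨κ, hmem⟩, hA⟩

end IsNMast

theorem FiniteUniserialType.slackHalyardsListed [Infinite K] (hI : IsAdmissible I)
    (hJ : Ring.jacobson (PathAlgebra K V ⧸ I) ^ 5 = ⊥) (hfin : FiniteUniserialType I) :
    SlackHalyardsListed I := by
  intro a b p hm D hD hlo i _
  have hp := (hfin.conditionN hI).isNMast hI hJ hm
  refine (hp.isListedGraph_iff ⟨D, i⟩ hlo).2 ?_
  by_contra hd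
  obtain ⟨-, i', hi'⟩ := hD
  -- The detour has only one index, so the transcendental variable is the one at `i`.
  obtain rfl := hp.index_eq D i i'
  exact (transcendental_coordFn_iff D i).1 hi'
    (hp.finite_image_of_not_isPeriodic hI hfin ⟨D, i⟩ hd)

/-- The masts classify the uniserial modules. -/
theorem exists_mast_equiv [Infinite K] (hI : IsAdmissible I)
    (hJ : Ring.jacobson (PathAlgebra K V ⧸ I) ^ 5 = ⊥) (hN : ConditionN I)
    (hS : SlackHalyardsListed I) :
    ∃ Ψ : {x : AnyPath V // IsMast I x.path} ≃ uniserialClasses I,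
      ∀ (x : {x : AnyPath V // IsMast I x.path})
        (M : ModuleCat.{max u v w} (PathAlgebra K V ⧸ I)), IsUniserial (PathAlgebra K V ⧸ I) M →
        (IsMastOf I x.1.path M ↔ (Ψ x).1 = Quotient.mk (CategoryTheory.isIsomorphicSetoid
          (ModuleCat.{max u v w} (PathAlgebra K V ⧸ I))) M) := by
  have hex : ∀ x : {x : AnyPath V // IsMast I x.path},
      ∃ M : ModuleCat.{max u v w} (PathAlgebra K V ⧸ I), IsMastOf I x.1.path M := fun x => x.2
  choose N hN' using hex
  -- Modules with equal masts are isomorphic, and masts are invariant under isomorphism.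
  have key : ∀ (x : {x : AnyPath V // IsMast I x.path})
      (M : ModuleCat.{max u v w} (PathAlgebra K V ⧸ I)),
      IsMastOf I x.1.path M ↔ Quotient.mk (CategoryTheory.isIsomorphicSetoid
        (ModuleCat.{max u v w} (PathAlgebra K V ⧸ I))) (N x) = Quotient.mk _ M := by
    intro x M
    constructor
    · intro hM
      obtain ⟨φ⟩ := (hN.isNMast hI hJ x.2).nonempty_equiv_of_isMastOf hI x.2 hS (hN' x) hM
      exact Quotient.sound ⟨φ.toModuleIso⟩
    · intro he
      obtain ⟨φ⟩ : Nonempty (N x ≅ M) := Quotient.exact he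
      obtain ⟨z, hz⟩ := (hN' x).exists_isFlag hI
      exact (hz.map_equiv φ.toLinearEquiv).isMastOf
  let F : {x : AnyPath V // IsMast I x.path} → uniserialClasses I := fun x =>
    ⟨Quotient.mk _ (N x), N x, (hN' x).1, rfl⟩
  have hF : Function.Bijective F := by
    constructor
    · intro x y hxy
      have h₁ : IsMastOf I x.1.path (N y) := (key x (N y)).2 (congrArg Subtype.val hxy)
      obtain ⟨z, hz⟩ := h₁.exists_isFlag hI
      -- Injectivity is the uniqueness of the mast of a module.
      exact Subtype.ext ((hN.isNMast hI hJ x.2).eq_of_isMastOf hz (hN' y))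
    · rintro ⟨_, M, hM, rfl⟩
      obtain ⟨n, hn⟩ := hI.exists_pathElem_eq_zero
      obtain ⟨a, b, p, x, h⟩ := BoundQuiver.exists_isFlag hM (radFilt_eq_bot_of_pathElem hn M)
      exact ⟨⟨⟨a, b, p⟩, M, h.isMastOf⟩, Subtype.ext ((key _ M).1 h.isMastOf)⟩
  exact ⟨Equiv.ofBijective F hF, fun x M _ => key x M⟩

/-- Masts have length at most 4, and a finite quiver has finitely many such paths. -/
theorem finiteUniserialType_of_slackHalyardsListed [Infinite K] [∀ a b : V, Finite (a ⟶ b)]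
    (hI : IsAdmissible I) (hJ : Ring.jacobson (PathAlgebra K V ⧸ I) ^ 5 = ⊥) (hN : ConditionN I)
    (hS : SlackHalyardsListed I) : FiniteUniserialType I := by
  obtain ⟨Ψ, -⟩ := exists_mast_equiv hI hJ hN hS
  have : Finite {x : AnyPath V // IsMast I x.path} :=
    ((finite_setOf_length_le 4).subset fun (x : AnyPath V) (hx : IsMast I x.path) =>
      (hN.isNMast hI hJ hx).length_le).to_subtype
  exact Set.finite_coe_iff.1 (Finite.of_equiv _ Ψ)

end Classification

end BoundQuiver

end

theorem corollary7p3 {K : Type u} {V : Type v} [Field K] [Infinite K]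
    [Quiver.{w} V] [Fintype V] [∀ a b : V, Finite (a ⟶ b)]
    (I : Ideal (BoundQuiver.PathAlgebra K V)) [I.IsTwoSided]
    (hI : BoundQuiver.IsAdmissible I)
    (hJ : Ring.jacobson (BoundQuiver.PathAlgebra K V ⧸ I) ^ 5 = ⊥) :
    (BoundQuiver.FiniteUniserialType I ↔
      BoundQuiver.ConditionN I ∧ BoundQuiver.SlackHalyardsListed I) ∧
    (BoundQuiver.FiniteUniserialType I →
      (∀ (a b : V) (p : Quiver.Path a b), BoundQuiver.IsMast I p →
        ∃ A : AffineSubspace K (BoundQuiver.Coord p → K),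
          (A : Set (BoundQuiver.Coord p → K)).Nonempty ∧
          (A : Set (BoundQuiver.Coord p → K)) = BoundQuiver.uniserialVariety I p) ∧
      ∃ Ψ : {x : BoundQuiver.AnyPath V // BoundQuiver.IsMast I x.path} ≃
          BoundQuiver.uniserialClasses I,
        ∀ (x : {x : BoundQuiver.AnyPath V // BoundQuiver.IsMast I x.path})
          (M : ModuleCat.{max u v w} (BoundQuiver.PathAlgebra K V ⧸ I)),
          BoundQuiver.IsUniserial (BoundQuiver.PathAlgebra K V ⧸ I) M →
          (BoundQuiver.IsMastOf I x.1.path M ↔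
            (Ψ x).1 = Quotient.mk (CategoryTheory.isIsomorphicSetoid
              (ModuleCat.{max u v w} (BoundQuiver.PathAlgebra K V ⧸ I))) M)) := by
  have listed := fun hfin : BoundQuiver.FiniteUniserialType I =>
    hfin.slackHalyardsListed hI hJ
  refine ⟨⟨fun hfin => ⟨hfin.conditionN hI, listed hfin⟩, fun h =>
    BoundQuiver.finiteUniserialType_of_slackHalyardsListed hI hJ h.1 h.2⟩, fun hfin => ⟨?_,
    BoundQuiver.exists_mast_equiv hI hJ (hfin.conditionN hI) (listed hfin)⟩⟩
  intro a b p hp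
  exact ((hfin.conditionN hI).isNMast hI hJ hp).exists_affineSubspace hI hp (listed hfin)
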